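/- Let $K$ be a non-empty compact metric space, $N\ge 2$, and let $\gamma=(\gamma_1,\dots,\gamma_N)$ be maps $K\to K$ with $K=\bigcup_j\gamma_j(K)$ which are proper contractions: for each $j$ there are constants $0<c'\le c<1$ with $c'd(x,y)\le d(\gamma_j(x),\gamma_j(y))\le c\,d(x,y)$ for all $x,y$. For a word $w=(w_1,\dots,w_n)\in\{1,\dots,N\}^n$ put $\gamma_w=\gamma_{w_n}\circ\cdots\circ\gamma_{w_1}$. Let $B_\gamma=\{b : b=\gamma_i(a)=\gamma_j(a)\text{ for some }a\in K,\ i\ne j\}$ and $P_\gamma=\{a : \gamma_w(a)\in B_\gamma\text{ for some word }w\text{ of length}\ge 1\}$. Assume that there is a continuous $h:K\to K$ with $h(\gamma_j(y))=y$ for all $j,y$, that $B_\gamma$ is finite, and that $B_\gamma\cap P_\gamma=\emptyset$. Let $A=C(K)$, and for $n\ge 0$ let $X^{\otimes n}$ be the $n$-fold tensor power of the correspondence $X_\gamma$ of $\gamma$, that is, the $A$-$A$-correspondence $C(\mathcal C_{\gamma^n})$ with $\mathcal C_{\gamma^n}=\{(\gamma_w(y),y) : y\in K,\ w\in\{1,\dots,N\}^n\}$,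 $(a\cdot f\cdot a')(x,y)=a(x)f(x,y)a'(y)$ and $(f|g)_A(y)=\sum_w\overline{f(\gamma_w(y),y)}\,g(\gamma_w(y),y)$. Let $\mathcal K(X^{\otimes n})$ be the algebra of compact operators of this Hilbert module (so $\mathcal K(X^{\otimes 0})=A$), let $\mathcal F^{(n)}=\sum_{k=0}^n\mathcal K(X^{\otimes k})\otimes I_{n-k}\subset\mathcal L(X^{\otimes n})$, and let the core $\mathcal F^{(\infty)}=\overline{\bigcup_n\mathcal F^{(n)}}$ be the inductive limit along $T\mapsto T\otimes I$. Let $\Pi^{(n)}:\mathcal F^{(n)}\to M_{N^n}(C(K))$ be the matrix representation, determined by $(Tf)(\gamma_w(y),y)=\sum_v\Pi^{(n)}(T)_{w,v}(y)\,f(\gamma_v(y),y)$. For $b\in B_\gamma$ and $n\ge 0$ let $J^{(b,n,n)}=\{T\in\mathcal F^{(n)} : \Pi^{(n)}(T)(b)=0\}$, let $J^{(b,n,m)}=J^{(b,n,n)}+\mathcal K(X^{\otimes n+1})+\cdots+\mathcal K(X^{\otimes m})$ for $m>n$, and let $\overline J^{(b,n)}$ be the closure of $\bigcup_{m>n}J^{(b,n,m)}$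 in $\mathcal F^{(\infty)}$. Let $\ker\tau=\{x : \tau(x^*x)=0\}$ for a trace $\tau$. Then the primitive ideal space of the core is $$\mathrm{Prim}(\mathcal F^{(\infty)})=\{0\}\cup\{\overline J^{(b,n)} : b\in B_\gamma,\ n\ge 0\},$$ and the open sets of its Jacobson topology are exactly the empty set and the cofinite subsets that contain the point $0$. Moreover: 1. There is a unique tracial state $\tau^\infty$ on $\mathcal F^{(\infty)}$ with $\tau^\infty(T)=N^{-n}\int_K\mathrm{Tr}\big(\Pi^{(n)}(T)(x)\big)\,d\mu(x)$ for all $n$ and $T\in\mathcal F^{(n)}$, where $\mu$ is the Hutchinson measure, i.e. the probability measure with $\mu=\frac1N\sum_j(\gamma_j)_*\mu$. Its kernel is the zero ideal, and its GNS representation generates the injective $\mathrm{II}_1$ factor. 2. For $b\in B_\gamma$ and $n\ge 0$ there is a unique tracial state $\tau^{(b,n)}$ on $\mathcal F^{(\infty)}$ with $\tau^{(b,n)}(T)=N^{-n}\,\mathrm{Tr}\big(\Pi^{(n)}(T)(b)\big)$ for $T\in\mathcal F^{(n)}$ and $\tau^{(b,n)}=0$ on $\mathcal K(X^{\otimes m})$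 for all $m>n$. Its kernel is $\overline J^{(b,n)}$, and its GNS representation generates a finite factor isomorphic to $M_{N^n}(\mathbb C)$, which is isomorphic to $\mathcal F^{(\infty)}/\overline J^{(b,n)}$. -/

import Mathlib

open scoped ComplexOrder InnerProductSpace ENNReal Topology

universe u

noncomputable section

/-! ### Self-similar maps -/

/-- A self-similar map on a compact metric space `K`: proper contractions `γ_1, …, γ_N` of `K`
with `K = ⋃ γ_j(K)`. -/
structure SelfSimilarMap (K : Type u) [MetricSpace K] (N : ℕ) where
  map : Fin N → K → K
  proper : ∀ j, ∃ c' c : ℝ, 0 < c' ∧ c' ≤ c ∧ c < 1 ∧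
    ∀ x y, c' * dist x y ≤ dist (map j x) (map j y) ∧ dist (map j x) (map j y) ≤ c * dist x y
  cover : ⋃ j, Set.range (map j) = Set.univ

/-- The algebra of linear operators on `C(K)`. -/
def Op (K : Type u) [TopologicalSpace K] : Type u := Module.End ℂ C(K, ℂ)

namespace Op

variable {K : Type u} [TopologicalSpace K]

instance : Ring (Op K) := @Module.End.instRing ℂ C(K, ℂ) _ _ _
instance : Algebra ℂ (Op K) := @Module.End.instAlgebra ℂ ℂ C(K, ℂ) _ _ _ _ _ _ _ _
instance : FunLike (Op K) C(K, ℂ) C(K, ℂ) :=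
  inferInstanceAs (FunLike (C(K, ℂ) →ₗ[ℂ] C(K, ℂ)) C(K, ℂ) C(K, ℂ))

@[ext] lemma ext {T S : Op K} (h : ∀ f, T f = S f) : T = S := DFunLike.ext T S h
@[simp] lemma add_apply (T S : Op K) (f : C(K, ℂ)) : (T + S) f = T f + S f := rfl
@[simp] lemma mul_apply (T S : Op K) (f : C(K, ℂ)) : (T * S) f = T (S f) := rfl
@[simp] lemma smul_apply (c : ℂ) (T : Op K) (f : C(K, ℂ)) : (c • T) f = c • T f := rfl
@[simp] lemma zero_apply (f : C(K, ℂ)) : (0 : Op K) f = 0 := rfl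
@[simp] lemma one_apply (f : C(K, ℂ)) : (1 : Op K) f = f := rfl

end Op

namespace SelfSimilarMap

variable {K : Type u} [MetricSpace K] {N : ℕ} (γ : SelfSimilarMap K N)

/-- The composition `γ_{w_{n-1}} ∘ ⋯ ∘ γ_{w_0}` attached to a word `w` of length `n`. -/
def word : (n : ℕ) → (Fin n → Fin N) → K → K
  | 0, _ => id
  | n + 1, w => word n (Fin.tail w) ∘ γ.map (w 0)

/-- The branch set `B_γ`. -/
def branchSet : Set K := {b | ∃ a i j, i ≠ j ∧ γ.map i a = b ∧ γ.map j a = b}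

/-- The postcritical set `P_γ`. -/
def postcriticalSet : Set K := {a | ∃ k, 1 ≤ k ∧ ∃ w : Fin k → Fin N, γ.word k w a ∈ γ.branchSet}

end SelfSimilarMap

/-- A self-similar map satisfying Assumption B. The continuous map `h` is uniquely determined
by the family `γ`, since the images `γ_j(K)` cover `K`. -/
structure BranchedMap (K : Type u) [MetricSpace K] (N : ℕ) extends SelfSimilarMap K N where
  h : C(K, K)
  h_map : ∀ j y, h (map j y) = y
  finite_branchSet : toSelfSimilarMap.branchSet.Finite
  disjoint_postcritical : Disjoint toSelfSimilarMap.branchSet toSelfSimilarMap.postcriticalSet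

namespace BranchedMap

variable {K : Type u} [MetricSpace K] {N : ℕ} (γ : BranchedMap K N)

abbrev word (n : ℕ) (w : Fin n → Fin N) : K → K := γ.toSelfSimilarMap.word n w

lemma continuous_map (j : Fin N) : Continuous (γ.map j) := by
  obtain ⟨c', c, h0, hc, h1, hd⟩ := γ.proper j
  exact (LipschitzWith.of_dist_le_mul (K := ⟨c, h0.le.trans hc⟩)
    fun x y => (hd x y).2).continuous

lemma continuous_word (n : ℕ) (w : Fin n → Fin N) : Continuous (γ.word n w) := by
  induction n with
  | zero => exact continuous_id
  | succ n ih => exact (ih (Fin.tail w)).comp (γ.continuous_map _)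

lemma iterate_word (n : ℕ) (w : Fin n → Fin N) (y : K) : γ.h^[n] (γ.word n w y) = y := by
  induction n generalizing y with
  | zero => rfl
  | succ n ih =>
    rw [Function.iterate_succ_apply']
    change γ.h (γ.h^[n] (γ.word n (Fin.tail w) (γ.map (w 0) y))) = y
    rw [ih, γ.h_map]

lemma exists_word (n : ℕ) (x : K) : ∃ w y, γ.word n w y = x := by
  induction n generalizing x with
  | zero => exact ⟨Fin.elim0, x, rfl⟩
  | succ n ih =>
    obtain ⟨w, y, rfl⟩ := ih x
    have hy : y ∈ ⋃ j, Set.range (γ.map j) := by rw [γ.cover]; trivial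
    obtain ⟨j, z, rfl⟩ := Set.mem_iUnion.1 hy
    exact ⟨Fin.cons j w, z, rfl⟩

/-! ### The correspondences `X^{⊗ n}`

The cograph `{(γ_w(y), y) : w a word of length n, y ∈ K}` is the graph of `h^n`, so that a
function `ξ` on it is the same thing as the function `x ↦ ξ (x, h^n x)` on `K`. In this way
`X^{⊗ n}`, the space of continuous functions on the cograph of `γ^n`, is the space `C(K)` with
* left action `(a · f)(x) = a(x) f(x)` and right action `(f · b)(x) = f(x) b(h^n x)`;
* inner product `(f | g)_n (y) = ∑_w conj (f (γ_w y)) * g (γ_w y)`, over words `w` of length `n`;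
* tensor product `X^{⊗ n} ⊗ X^{⊗ m} → X^{⊗ (n + m)}` given by `f ⊗ g = f * (g ∘ h^n)`. -/

/-- The cograph of `γ^n`. -/
def cograph (n : ℕ) : Set (K × K) := {p | ∃ w : Fin n → Fin N, γ.word n w p.2 = p.1}

lemma cograph_eq (n : ℕ) : γ.cograph n = {p | γ.h^[n] p.1 = p.2} := by
  ext ⟨x, y⟩
  constructor
  · rintro ⟨w, hw⟩
    simp only at hw
    simp [← hw, γ.iterate_word]
  · intro hxy
    obtain ⟨w, z, rfl⟩ := γ.exists_word n x
    simp only [Set.mem_ofPred_eq, γ.iterate_word] at hxy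
    exact ⟨w, by simp [hxy]⟩

/-- The right action of `C(K)` on `X^{⊗ n}`. -/
def rsmul (n : ℕ) (f b : C(K, ℂ)) : C(K, ℂ) := f * b.comp ⟨γ.h^[n], γ.h.continuous.iterate n⟩

@[simp] lemma rsmul_word (n : ℕ) (f b : C(K, ℂ)) (w : Fin n → Fin N) (y : K) :
    γ.rsmul n f b (γ.word n w y) = f (γ.word n w y) * b y := by
  simp [rsmul, γ.iterate_word]

/-- The vector `(f (γ_w y))_w`: the image of `f ∈ X^{⊗ n}` in the fibre over `y`. -/
def fibre (n : ℕ) (y : K) : C(K, ℂ) →ₗ[ℂ] EuclideanSpace ℂ (Fin n → Fin N) where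
  toFun f := WithLp.toLp 2 fun w => f (γ.word n w y)
  map_add' _ _ := rfl
  map_smul' _ _ := rfl

@[simp] lemma fibre_apply (n : ℕ) (y : K) (f : C(K, ℂ)) (w : Fin n → Fin N) :
    γ.fibre n y f w = f (γ.word n w y) := rfl

/-- The `C(K)`-valued inner product of `X^{⊗ n}`. -/
def innerX (n : ℕ) (f g : C(K, ℂ)) : C(K, ℂ) where
  toFun y := ∑ w : Fin n → Fin N, star (f (γ.word n w y)) * g (γ.word n w y)
  continuous_toFun := continuous_finsetSum _ fun w _ =>
    ((f.continuous.comp (γ.continuous_word n w)).star).mul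
      (g.continuous.comp (γ.continuous_word n w))

lemma innerX_apply (n : ℕ) (f g : C(K, ℂ)) (y : K) :
    γ.innerX n f g y = ⟪γ.fibre n y f, γ.fibre n y g⟫_ℂ := by
  simp [innerX, PiLp.inner_apply, mul_comm]

lemma innerX_succ (n : ℕ) (f g : C(K, ℂ)) (y : K) :
    γ.innerX (n + 1) f g y = ∑ j, γ.innerX n f g (γ.map j y) := by
  change (∑ w : Fin (n + 1) → Fin N, _) = ∑ j, ∑ w : Fin n → Fin N, _
  rw [← (Fin.consEquiv fun _ => Fin N).sum_comp, Fintype.sum_prod_type]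
  rfl

/-- The inner product of `X^{⊗ (n + 1)}` is that of the inner tensor product
`X^{⊗ n} ⊗_{C(K)} X`. -/
lemma innerX_tensor (n : ℕ) (f f' g g' : C(K, ℂ)) :
    γ.innerX (n + 1) (γ.rsmul n f g) (γ.rsmul n f' g') =
      γ.innerX 1 g (γ.innerX n f f' * g') := by
  ext y
  rw [innerX_succ, innerX_succ]
  refine Finset.sum_congr rfl fun j _ => ?_
  simp only [innerX, ContinuousMap.coe_mk, rsmul_word, star_mul', ContinuousMap.mul_apply,
    Finset.univ_unique, Finset.sum_singleton]
  simp only [SelfSimilarMap.word, id, BranchedMap.word, Finset.sum_mul, Finset.mul_sum]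
  refine Finset.sum_congr rfl fun w _ => ?_
  ring

/-! ### Adjointable operators -/

/-- `S` is the adjoint of `T` on the Hilbert module `X^{⊗ n}`. -/
def IsAdjoint (n : ℕ) (T S : Op K) : Prop :=
  ∀ f g, γ.innerX n (T f) g = γ.innerX n f (S g)

/-- `T` is bounded by `C` on the Hilbert module `X^{⊗ n}`, i.e.
`(T f | T f)_n ≤ C² (f | f)_n` for all `f`. For adjointable `T` the least such `C` is the norm
of `T` as an operator on the Hilbert module. -/
def IsBound (n : ℕ) (T : Op K) (C : ℝ) : Prop :=
  0 ≤ C ∧ ∀ f y, ‖γ.fibre n y (T f)‖ ≤ C * ‖γ.fibre n y f‖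

lemma norm_inner_self_eq {E : Type*} [NormedAddCommGroup E] [InnerProductSpace ℂ E] (x : E) :
    ‖⟪x, x⟫_ℂ‖ = ‖x‖ * ‖x‖ := by
  rw [← inner_self_re_eq_norm, inner_self_eq_norm_mul_norm]

variable {γ} {n m : ℕ} {T S T' S' : Op K} {C D : ℝ}

lemma norm_fibre_succ (f : C(K, ℂ)) (y : K) :
    ‖γ.fibre (n + 1) y f‖ ^ 2 = ∑ j, ‖γ.fibre n (γ.map j y) f‖ ^ 2 := by
  have h : ∀ k z, ((‖γ.fibre k z f‖ ^ 2 : ℝ) : ℂ) = γ.innerX k f f z := fun k z => by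
    rw [innerX_apply, inner_self_eq_norm_sq_to_K]; simp
  exact_mod_cast (by push_cast [h]; exact_mod_cast γ.innerX_succ n f f y :
    ((‖γ.fibre (n + 1) y f‖ ^ 2 : ℝ) : ℂ) = ((∑ j, ‖γ.fibre n (γ.map j y) f‖ ^ 2 : ℝ) : ℂ))

lemma IsAdjoint.succ (hT : γ.IsAdjoint n T S) : γ.IsAdjoint (n + 1) T S := fun f g => by
  ext y
  simp only [innerX_succ, hT f g]

lemma IsAdjoint.mono (hT : γ.IsAdjoint n T S) (h : n ≤ m) : γ.IsAdjoint m T S :=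
  Nat.le_induction hT (fun _ _ => IsAdjoint.succ) m h

lemma IsBound.succ (hT : γ.IsBound n T C) : γ.IsBound (n + 1) T C := by
  refine ⟨hT.1, fun f y => ?_⟩
  refine le_of_sq_le_sq ?_ (mul_nonneg hT.1 (norm_nonneg _))
  rw [mul_pow, norm_fibre_succ, norm_fibre_succ, Finset.mul_sum]
  refine Finset.sum_le_sum fun j _ => ?_
  rw [← mul_pow]
  exact pow_le_pow_left₀ (norm_nonneg _) (hT.2 _ _) 2

lemma IsBound.mono (hT : γ.IsBound n T C) (h : n ≤ m) : γ.IsBound m T C :=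
  Nat.le_induction hT (fun _ _ => IsBound.succ) m h

lemma IsBound.mono_right (hT : γ.IsBound n T C) (h : C ≤ D) : γ.IsBound n T D :=
  ⟨hT.1.trans h, fun f y => (hT.2 f y).trans (by gcongr)⟩

lemma isAdjoint_iff : γ.IsAdjoint n T S ↔
    ∀ f g y, ⟪γ.fibre n y (T f), γ.fibre n y g⟫_ℂ = ⟪γ.fibre n y f, γ.fibre n y (S g)⟫_ℂ := by
  simp only [IsAdjoint, DFunLike.ext_iff, innerX_apply]

lemma IsAdjoint.symm (h : γ.IsAdjoint n T S) : γ.IsAdjoint n S T := by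
  rw [isAdjoint_iff] at *
  intro f g y
  rw [← inner_conj_symm, ← h, inner_conj_symm]

lemma IsAdjoint.unique (h : γ.IsAdjoint n T S) (h' : γ.IsAdjoint m T S') : S = S' := by
  have h1 := h.mono (le_max_left n m)
  have h2 := h'.mono (le_max_right n m)
  rw [isAdjoint_iff] at h1 h2
  ext g x
  obtain ⟨w, y, rfl⟩ := γ.exists_word (max n m) x
  have h3 : γ.fibre (max n m) y (S g) = γ.fibre (max n m) y (S' g) := by
    rw [← sub_eq_zero, ← map_sub, ← inner_self_eq_zero (𝕜 := ℂ)]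
    nth_rw 2 [map_sub]
    rw [inner_sub_right, ← h1, ← h2, sub_self]
  exact congrArg (fun v : EuclideanSpace ℂ (Fin (max n m) → Fin N) => v w) h3

lemma IsAdjoint.isBound (h : γ.IsAdjoint n T S) (hT : γ.IsBound n T C) : γ.IsBound n S C := by
  rw [isAdjoint_iff] at h
  refine ⟨hT.1, fun f y => ?_⟩
  rcases eq_or_ne ‖γ.fibre n y (S f)‖ 0 with h0 | h0
  · rw [h0]; exact mul_nonneg hT.1 (norm_nonneg _)
  have h1 : ‖γ.fibre n y (S f)‖ * ‖γ.fibre n y (S f)‖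
      ≤ (C * ‖γ.fibre n y f‖) * ‖γ.fibre n y (S f)‖ := by
    rw [← norm_inner_self_eq (E := EuclideanSpace ℂ (Fin n → Fin N)), ← h]
    calc _ ≤ ‖γ.fibre n y (T (S f))‖ * ‖γ.fibre n y f‖ := norm_inner_le_norm _ _
      _ ≤ (C * ‖γ.fibre n y (S f)‖) * ‖γ.fibre n y f‖ := by gcongr; exact hT.2 _ _
      _ = _ := by ring
  exact le_of_mul_le_mul_right h1 (lt_of_le_of_ne (norm_nonneg _) h0.symm)

lemma IsBound.sqrt (h : γ.IsAdjoint n T S) (hC : γ.IsBound n (S * T) C) :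
    γ.IsBound n T (√C) := by
  rw [isAdjoint_iff] at h
  refine ⟨Real.sqrt_nonneg _, fun f y => ?_⟩
  refine le_of_sq_le_sq ?_ (mul_nonneg (Real.sqrt_nonneg _) (norm_nonneg _))
  have hCf := hC.2 f y
  rw [mul_pow, Real.sq_sqrt hC.1, sq, ← norm_inner_self_eq (E := EuclideanSpace ℂ (Fin n → Fin N)), h]
  calc _ ≤ ‖γ.fibre n y f‖ * ‖γ.fibre n y (S (T f))‖ := norm_inner_le_norm _ _
    _ ≤ ‖γ.fibre n y f‖ * (C * ‖γ.fibre n y f‖) := by gcongr; exact hCf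
    _ = _ := by ring

lemma IsBound.add (hT : γ.IsBound n T C) (hS : γ.IsBound n S D) : γ.IsBound n (T + S) (C + D) :=
  ⟨add_nonneg hT.1 hS.1, fun f y => by
    rw [Op.add_apply, map_add, add_mul]
    exact (norm_add_le _ _).trans (add_le_add (hT.2 _ _) (hS.2 _ _))⟩

lemma IsBound.mul (hT : γ.IsBound n T C) (hS : γ.IsBound n S D) : γ.IsBound n (T * S) (C * D) :=
  ⟨mul_nonneg hT.1 hS.1, fun f y => by
    rw [Op.mul_apply, mul_assoc]
    exact (hT.2 _ _).trans (mul_le_mul_of_nonneg_left (hS.2 _ _) hT.1)⟩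

lemma IsBound.smul (hT : γ.IsBound n T C) (c : ℂ) : γ.IsBound n (c • T) (‖c‖ * C) :=
  ⟨mul_nonneg (norm_nonneg _) hT.1, fun f y => by
    rw [Op.smul_apply, map_smul, norm_smul, mul_assoc]
    exact mul_le_mul_of_nonneg_left (hT.2 _ _) (norm_nonneg _)⟩

lemma IsAdjoint.add (h : γ.IsAdjoint n T S) (h' : γ.IsAdjoint n T' S') :
    γ.IsAdjoint n (T + T') (S + S') := by
  rw [isAdjoint_iff] at *
  intro f g y
  simp only [Op.add_apply, map_add, inner_add_left, inner_add_right, h, h']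

lemma IsAdjoint.mul (h : γ.IsAdjoint n T S) (h' : γ.IsAdjoint n T' S') :
    γ.IsAdjoint n (T * T') (S' * S) := by
  rw [isAdjoint_iff] at *
  intro f g y
  simp only [Op.mul_apply, h, h']

lemma IsAdjoint.smul (h : γ.IsAdjoint n T S) (c : ℂ) :
    γ.IsAdjoint n (c • T) (star c • S) := by
  rw [isAdjoint_iff] at *
  intro f g y
  simp only [Op.smul_apply, map_smul, inner_smul_left, inner_smul_right, h]
  rfl

variable (γ)

/-- The union `⋃ₙ L(X^{⊗ n})` of the algebras of adjointable operators along the embeddings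
`T ↦ T ⊗ I`. As `X^{⊗ n}` and `X^{⊗ (n + 1)}` have the same underlying space `C(K)` and
`(T ⊗ I)(f ⊗ g) = T f ⊗ g = T f * (g ∘ h^n) = T (f * (g ∘ h^n)) = T (f ⊗ g)`, the operator `T ⊗ I`
is `T` itself. -/
def adjointable : Subalgebra ℂ (Op K) where
  carrier := {T | ∃ n S C, γ.IsAdjoint n T S ∧ γ.IsBound n T C}
  mul_mem' := by
    rintro T T' ⟨n, S, C, h, hC⟩ ⟨n', S', C', h', hC'⟩
    exact ⟨max n n', S' * S, C * C', (h.mono (le_max_left _ _)).mul (h'.mono (le_max_right _ _)),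
      (hC.mono (le_max_left _ _)).mul (hC'.mono (le_max_right _ _))⟩
  add_mem' := by
    rintro T T' ⟨n, S, C, h, hC⟩ ⟨n', S', C', h', hC'⟩
    exact ⟨max n n', S + S', C + C', (h.mono (le_max_left _ _)).add (h'.mono (le_max_right _ _)),
      (hC.mono (le_max_left _ _)).add (hC'.mono (le_max_right _ _))⟩
  algebraMap_mem' c := by
    refine ⟨0, star c • 1, ‖c‖ * 1, ?_, ?_⟩
    · rw [Algebra.algebraMap_eq_smul_one]
      exact IsAdjoint.smul (fun f g => rfl) c
    · rw [Algebra.algebraMap_eq_smul_one]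
      exact IsBound.smul ⟨zero_le_one, fun f y => by simp⟩ c

/-- The adjoint of an adjointable operator. -/
instance : Star γ.adjointable where
  star T := ⟨T.2.choose_spec.choose, by
    obtain ⟨C, h, hC⟩ := T.2.choose_spec.choose_spec
    exact ⟨_, T.1, C, h.symm, h.isBound hC⟩⟩

variable {γ}

lemma exists_isAdjoint_star (T : γ.adjointable) :
    ∃ n C, γ.IsAdjoint n T.1 (star T).1 ∧ γ.IsBound n T.1 C :=
  ⟨_, T.2.choose_spec.choose_spec⟩

lemma star_eq {T : γ.adjointable} (h : γ.IsAdjoint n T.1 S) : (star T).1 = S := by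
  obtain ⟨m, C, h', -⟩ := exists_isAdjoint_star T
  exact h'.unique h

instance : StarRing γ.adjointable where
  star_involutive T := by
    obtain ⟨n, C, h, -⟩ := exists_isAdjoint_star T
    exact Subtype.ext (star_eq h.symm)
  star_mul T T' := by
    obtain ⟨n, C, h, -⟩ := exists_isAdjoint_star T
    obtain ⟨n', C', h', -⟩ := exists_isAdjoint_star T'
    exact Subtype.ext (star_eq ((h.mono (le_max_left n n')).mul (h'.mono (le_max_right n n'))))
  star_add T T' := by
    obtain ⟨n, C, h, -⟩ := exists_isAdjoint_star T
    obtain ⟨n', C', h', -⟩ := exists_isAdjoint_star T'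
    exact Subtype.ext (star_eq ((h.mono (le_max_left n n')).add (h'.mono (le_max_right n n'))))

instance : StarModule ℂ γ.adjointable where
  star_smul c T := by
    obtain ⟨n, C, h, -⟩ := exists_isAdjoint_star T
    exact Subtype.ext (star_eq (h.smul c))

/-- The inductive limit of the operator norms of the C*-algebras `L(X^{⊗ n})`
(the embeddings `T ↦ T ⊗ I` are isometric, so all of them agree where they are defined). -/
instance : Norm γ.adjointable where
  norm T := sInf {C | ∃ n, γ.IsBound n T.1 C}

lemma norm_le {T : γ.adjointable} (h : γ.IsBound n T.1 C) : ‖T‖ ≤ C :=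
  csInf_le ⟨0, fun _ ⟨_, h⟩ => h.1⟩ ⟨n, h⟩

lemma norm_nonneg' (T : γ.adjointable) : 0 ≤ ‖T‖ :=
  Real.sInf_nonneg fun _ ⟨_, h⟩ => h.1

lemma exists_isBound (T : γ.adjointable) {C : ℝ} (h : ‖T‖ < C) : ∃ n, γ.IsBound n T.1 C := by
  obtain ⟨n, S, D, -, hD⟩ := T.2
  have hne : {C | ∃ n, γ.IsBound n T.1 C}.Nonempty := ⟨D, n, hD⟩
  obtain ⟨D, ⟨n, hn⟩, hDC⟩ := exists_lt_of_csInf_lt hne h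
  exact ⟨n, hn.mono_right hDC.le⟩

lemma exists_isBound₂ (T T' : γ.adjointable) {C C' : ℝ} (h : ‖T‖ < C) (h' : ‖T'‖ < C') :
    ∃ n, γ.IsBound n T.1 C ∧ γ.IsBound n T'.1 C' := by
  obtain ⟨n, hn⟩ := exists_isBound T h
  obtain ⟨n', hn'⟩ := exists_isBound T' h'
  exact ⟨max n n', hn.mono (le_max_left _ _), hn'.mono (le_max_right _ _)⟩

lemma norm_add_le' (T S : γ.adjointable) : ‖T + S‖ ≤ ‖T‖ + ‖S‖ := by
  refine le_of_forall_pos_le_add fun ε hε => ?_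
  obtain ⟨n, h1, h2⟩ := exists_isBound₂ T S
    (lt_add_of_pos_right _ (half_pos hε)) (lt_add_of_pos_right _ (half_pos hε))
  have h3 : ‖T + S‖ ≤ _ := norm_le (h1.add h2)
  linarith

lemma norm_mul_le' (T S : γ.adjointable) : ‖T * S‖ ≤ ‖T‖ * ‖S‖ := by
  have h : ∀ δ : ℝ, 0 < δ → ‖T * S‖ ≤ (‖T‖ + δ) * (‖S‖ + δ) := fun δ hδ => by
    obtain ⟨n, h1, h2⟩ := exists_isBound₂ T S
      (lt_add_of_pos_right _ hδ) (lt_add_of_pos_right _ hδ)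
    exact norm_le (T := T * S) (h1.mul h2)
  generalize ‖T * S‖ = c at *
  generalize ‖T‖ = a at *
  generalize ‖S‖ = b at *
  have hcont : Filter.Tendsto (fun δ : ℝ => (a + δ) * (b + δ)) (nhdsWithin 0 (Set.Ioi 0))
      (nhds ((a + 0) * (b + 0))) :=
    Filter.Tendsto.mono_left (Continuous.tendsto (by fun_prop) 0) nhdsWithin_le_nhds
  rw [add_zero, add_zero] at hcont
  refine ge_of_tendsto hcont ?_
  filter_upwards [self_mem_nhdsWithin] with δ hδ using h δ hδ

lemma norm_smul_le' (c : ℂ) (T : γ.adjointable) : ‖c • T‖ ≤ ‖c‖ * ‖T‖ := by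
  have h : ∀ δ : ℝ, 0 < δ → ‖c • T‖ ≤ ‖c‖ * (‖T‖ + δ) := fun δ hδ => by
    obtain ⟨n, hn⟩ := exists_isBound T (lt_add_of_pos_right ‖T‖ hδ)
    exact norm_le (T := c • T) (hn.smul c)
  generalize ‖c • T‖ = a at *
  generalize ‖T‖ = b at *
  have hcont : Filter.Tendsto (fun δ : ℝ => ‖c‖ * (b + δ)) (nhdsWithin 0 (Set.Ioi 0))
      (nhds (‖c‖ * (b + 0))) :=
    Filter.Tendsto.mono_left (Continuous.tendsto (by fun_prop) 0) nhdsWithin_le_nhds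
  rw [add_zero] at hcont
  refine ge_of_tendsto hcont ?_
  filter_upwards [self_mem_nhdsWithin] with δ hδ using h δ hδ

lemma norm_neg' (T : γ.adjointable) : ‖-T‖ = ‖T‖ := by
  have h : ∀ T : γ.adjointable, ‖-T‖ ≤ ‖T‖ := fun T => by
    have := norm_smul_le' (-1) T
    rwa [neg_one_smul, norm_neg, norm_one, one_mul] at this
  refine le_antisymm (h T) ?_
  have := h (-T)
  rwa [neg_neg] at this

lemma norm_zero' : ‖(0 : γ.adjointable)‖ = 0 :=
  le_antisymm (norm_le (n := 0) ⟨le_rfl, fun f y => by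
    change ‖γ.fibre 0 y 0‖ ≤ _
    rw [map_zero, norm_zero, zero_mul]⟩) (norm_nonneg' _)

instance : SeminormedRing γ.adjointable where
  dist T S := ‖-T + S‖
  dist_self T := by rw [neg_add_cancel, norm_zero']
  dist_comm T S := by
    rw [← norm_neg', neg_add, neg_neg, add_comm]
  dist_triangle T S R := by
    have e : -T + R = (-T + S) + (-S + R) := by rw [add_assoc, add_neg_cancel_left]
    rw [e]
    exact norm_add_le' _ _
  dist_eq _ _ := rfl
  norm_mul_le := norm_mul_le'

instance : NormedAlgebra ℂ γ.adjointable where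
  norm_smul_le := norm_smul_le'

instance : NormedStarGroup γ.adjointable where
  norm_star_le T := by
    refine le_of_forall_pos_le_add fun ε hε => ?_
    obtain ⟨n, hn⟩ := exists_isBound T (lt_add_of_pos_right ‖T‖ hε)
    obtain ⟨m, C, h, -⟩ := exists_isAdjoint_star T
    exact norm_le ((h.mono (le_max_right n m)).isBound (hn.mono (le_max_left n m)))

lemma norm_mul_self_le' (T : γ.adjointable) : ‖T‖ * ‖T‖ ≤ ‖star T * T‖ := by
  refine le_of_forall_pos_le_add fun ε hε => ?_
  obtain ⟨n, hn⟩ := exists_isBound (star T * T) (lt_add_of_pos_right _ hε)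
  obtain ⟨m, C, h, -⟩ := exists_isAdjoint_star T
  have h1 := norm_le (T := T)
    (IsBound.sqrt (h.mono (le_max_right n m)) (hn.mono (le_max_left n m)))
  calc ‖T‖ * ‖T‖ ≤ √(‖star T * T‖ + ε) * √(‖star T * T‖ + ε) :=
        mul_le_mul h1 h1 (norm_nonneg' _) (Real.sqrt_nonneg _)
    _ = _ := Real.mul_self_sqrt hn.1

/-! ### The core -/

variable (γ) in
/-- The rank one operator `θ_{f,g} ξ = f · (g | ξ)_n` of `X^{⊗ n}`. -/
def theta (n : ℕ) (f g : C(K, ℂ)) : Op K :=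
  { toFun := fun ξ => γ.rsmul n f (γ.innerX n g ξ)
    map_add' := fun ξ η => by
      ext x
      simp [rsmul, innerX, mul_add, Finset.sum_add_distrib]
    map_smul' := fun c ξ => by
      ext x
      simp only [rsmul, innerX, ContinuousMap.mul_apply, ContinuousMap.comp_apply,
        ContinuousMap.coe_mk, ContinuousMap.smul_apply, smul_eq_mul, RingHom.id_apply,
        Finset.mul_sum]
      exact Finset.sum_congr rfl fun w _ => by ring : C(K, ℂ) →ₗ[ℂ] C(K, ℂ) }

lemma fibre_theta (n : ℕ) (f g ξ : C(K, ℂ)) (y : K) :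
    γ.fibre n y (γ.theta n f g ξ) = ⟪γ.fibre n y g, γ.fibre n y ξ⟫_ℂ • γ.fibre n y f := by
  rw [← innerX_apply]
  ext w
  change γ.rsmul n f (γ.innerX n g ξ) (γ.word n w y) = _ * f (γ.word n w y)
  rw [rsmul_word, mul_comm]

lemma isAdjoint_theta (n : ℕ) (f g : C(K, ℂ)) :
    γ.IsAdjoint n (γ.theta n f g) (γ.theta n g f) := by
  rw [isAdjoint_iff]
  intro ξ η y
  rw [fibre_theta, fibre_theta, inner_smul_left, inner_smul_right, inner_conj_symm, mul_comm]

variable [CompactSpace K]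

lemma isBound_theta (n : ℕ) (f g : C(K, ℂ)) : ∃ C, γ.IsBound n (γ.theta n f g) C := by
  have h : ∀ f : C(K, ℂ), ∀ y, ‖γ.fibre n y f‖ ≤ √‖γ.innerX n f f‖ := fun f y => by
    refine Real.le_sqrt_of_sq_le ?_
    rw [sq, ← norm_inner_self_eq (E := EuclideanSpace ℂ (Fin n → Fin N)), ← innerX_apply]
    exact (γ.innerX n f f).norm_coe_le_norm y
  refine ⟨√‖γ.innerX n g g‖ * √‖γ.innerX n f f‖, by positivity, fun ξ y => ?_⟩
  rw [fibre_theta, norm_smul]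
  calc _ ≤ (‖γ.fibre n y g‖ * ‖γ.fibre n y ξ‖) * ‖γ.fibre n y f‖ := by
        gcongr; exact norm_inner_le_norm _ _
    _ ≤ (√‖γ.innerX n g g‖ * ‖γ.fibre n y ξ‖) * √‖γ.innerX n f f‖ := by
        gcongr <;> exact h _ _
    _ = _ := by ring

variable (γ)

/-- `θ_{f,g}` as an adjointable operator. -/
def rankOne (n : ℕ) (f g : C(K, ℂ)) : γ.adjointable :=
  ⟨γ.theta n f g, n, γ.theta n g f, (isBound_theta n f g).choose, isAdjoint_theta n f g,
    (isBound_theta n f g).choose_spec⟩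

/-- The finite rank operators of `X^{⊗ n}`. -/
def finiteRank (n : ℕ) : Submodule ℂ γ.adjointable :=
  Submodule.span ℂ {T | ∃ f g, T = γ.rankOne n f g}

/-- The compact operators `K(X^{⊗ n})`, embedded by `T ↦ T ⊗ I`. For `n = 0` these are the
multiplication operators, so that `K(X^{⊗ 0}) = A = C(K)`. -/
def compacts (n : ℕ) : Submodule ℂ γ.adjointable := (γ.finiteRank n).topologicalClosure

/-- The finite core `F^(n) = A ⊗ I + K(X) ⊗ I + ⋯ + K(X^{⊗ n})`. -/
def finiteCore (n : ℕ) : Submodule ℂ γ.adjointable := ⨆ k ≤ n, γ.compacts k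

variable {γ}

lemma mul_rankOne {T : γ.adjointable} {S : Op K} (h : γ.IsAdjoint n T.1 S) (f g : C(K, ℂ)) :
    T * γ.rankOne n f g = γ.rankOne n (T.1 f) g := by
  apply Subtype.ext
  ext ξ x
  obtain ⟨w, y, rfl⟩ := γ.exists_word n x
  have h1 : γ.fibre n y (T.1 (γ.theta n f g ξ)) = γ.fibre n y (γ.theta n (T.1 f) g ξ) := by
    rw [isAdjoint_iff] at h
    have h2 : ∀ η, ⟪γ.fibre n y (T.1 (γ.theta n f g ξ)), γ.fibre n y η⟫_ℂ
        = ⟪γ.fibre n y (γ.theta n (T.1 f) g ξ), γ.fibre n y η⟫_ℂ := fun η => by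
      rw [h, fibre_theta, fibre_theta, inner_smul_left, inner_smul_left, h]
    rw [← sub_eq_zero, ← map_sub, ← inner_self_eq_zero (𝕜 := ℂ)]
    nth_rw 1 [map_sub]
    rw [inner_sub_left, h2, sub_self]
  exact congrArg (fun v : EuclideanSpace ℂ (Fin n → Fin N) => v w) h1

lemma mul_mem_finiteRank {T R : γ.adjointable} {S : Op K} (h : γ.IsAdjoint n T.1 S)
    (hR : R ∈ γ.finiteRank n) : T * R ∈ γ.finiteRank n := by
  induction hR using Submodule.span_induction with
  | mem x hx =>
    obtain ⟨f, g, rfl⟩ := hx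
    exact Submodule.subset_span ⟨T.1 f, g, mul_rankOne h f g⟩
  | zero => rw [mul_zero]; exact zero_mem _
  | add x y _ _ hx hy => rw [mul_add]; exact add_mem hx hy
  | smul c x _ hx => rw [mul_smul_comm]; exact Submodule.smul_mem _ c hx

lemma star_rankOne (n : ℕ) (f g : C(K, ℂ)) : star (γ.rankOne n f g) = γ.rankOne n g f :=
  Subtype.ext (star_eq (isAdjoint_theta n f g))

lemma star_mem_finiteRank {R : γ.adjointable} (hR : R ∈ γ.finiteRank n) :
    star R ∈ γ.finiteRank n := by
  induction hR using Submodule.span_induction with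
  | mem x hx =>
    obtain ⟨f, g, rfl⟩ := hx
    exact Submodule.subset_span ⟨g, f, star_rankOne n f g⟩
  | zero => rw [star_zero]; exact zero_mem _
  | add x y _ _ hx hy => rw [star_add]; exact add_mem hx hy
  | smul c x _ hx => rw [star_smul]; exact Submodule.smul_mem _ _ hx

lemma exists_isAdjoint_of_mem_finiteRank {R : γ.adjointable} (hR : R ∈ γ.finiteRank n) :
    ∃ S, γ.IsAdjoint n R.1 S := by
  induction hR using Submodule.span_induction with
  | mem x hx => obtain ⟨f, g, rfl⟩ := hx; exact ⟨_, isAdjoint_theta n f g⟩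
  | zero =>
    refine ⟨0, isAdjoint_iff.2 fun f g y => ?_⟩
    change ⟪γ.fibre n y 0, _⟫_ℂ = ⟪_, γ.fibre n y 0⟫_ℂ
    rw [map_zero, inner_zero_left, inner_zero_right]
  | add x y _ _ hx hy => obtain ⟨S, h⟩ := hx; obtain ⟨S', h'⟩ := hy; exact ⟨_, h.add h'⟩
  | smul c x _ hx => obtain ⟨S, h⟩ := hx; exact ⟨_, h.smul c⟩

lemma star_mem_compacts {R : γ.adjointable} (hR : R ∈ γ.compacts n) : star R ∈ γ.compacts n :=
  map_mem_closure continuous_star hR fun _ h => star_mem_finiteRank h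

lemma mul_mem_compacts {k : ℕ} {T R : γ.adjointable} (hT : T ∈ γ.compacts k)
    (hR : R ∈ γ.compacts n) (hk : k ≤ n) : T * R ∈ γ.compacts n :=
  map_mem_closure₂ continuous_mul hT hR fun _ hT' _ hR' => by
    obtain ⟨S, h⟩ := exists_isAdjoint_of_mem_finiteRank hT'
    exact mul_mem_finiteRank (h.mono hk) hR'

lemma mul_mem_compacts' {k : ℕ} {T R : γ.adjointable} (hT : T ∈ γ.compacts k)
    (hR : R ∈ γ.compacts n) : T * R ∈ γ.compacts (max k n) := by
  rcases le_total k n with h | h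
  · rw [max_eq_right h]; exact mul_mem_compacts hT hR h
  · rw [max_eq_left h]
    have := star_mem_compacts (mul_mem_compacts (star_mem_compacts hR) (star_mem_compacts hT) h)
    rwa [star_mul, star_star, star_star] at this

lemma compacts_le {k : ℕ} (h : k ≤ n) : γ.compacts k ≤ γ.finiteCore n :=
  le_iSup₂ (f := fun k (_ : k ≤ n) => γ.compacts k) k h

lemma iSup_finiteCore : ⨆ n, γ.finiteCore n = ⨆ n, γ.compacts n :=
  le_antisymm (iSup_le fun _ => iSup₂_le fun k _ => le_iSup γ.compacts k)
    (iSup_le fun n => (compacts_le le_rfl).trans (le_iSup γ.finiteCore n))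

lemma finiteCore_mono : Monotone γ.finiteCore := fun _ _ h =>
  iSup₂_le fun _ hk => compacts_le (hk.trans h)

variable (γ) in
/-- The union `⋃ₙ F^(n)`, a `*`-algebra. -/
def unionCore : StarSubalgebra ℂ γ.adjointable where
  carrier := ⋃ n, γ.finiteCore n
  zero_mem' := Set.mem_iUnion.2 ⟨0, zero_mem _⟩
  add_mem' := by
    intro a b ha hb
    obtain ⟨n, ha⟩ := Set.mem_iUnion.1 ha
    obtain ⟨m, hb⟩ := Set.mem_iUnion.1 hb
    exact Set.mem_iUnion.2 ⟨max n m, add_mem (finiteCore_mono (le_max_left n m) ha)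
      (finiteCore_mono (le_max_right n m) hb)⟩
  mul_mem' := by
    intro a b ha hb
    rw [← Submodule.coe_iSup_of_directed _ finiteCore_mono.directed_le, iSup_finiteCore,
      SetLike.mem_coe] at *
    induction ha using Submodule.iSup_induction' with
    | zero => rw [zero_mul]; exact zero_mem _
    | add x y _ _ hx hy => rw [add_mul]; exact add_mem hx hy
    | mem k x hx =>
      induction hb using Submodule.iSup_induction' with
      | zero => rw [mul_zero]; exact zero_mem _
      | add x y _ _ hx hy => rw [mul_add]; exact add_mem hx hy
      | mem n y hy => exact Submodule.mem_iSup_of_mem (max k n) (mul_mem_compacts' hx hy)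
  algebraMap_mem' c := by
    refine Set.mem_iUnion.2 ⟨0, compacts_le le_rfl (Submodule.le_topologicalClosure _ ?_)⟩
    refine Submodule.subset_span ⟨algebraMap ℂ C(K, ℂ) c, 1, Subtype.ext ?_⟩
    ext ξ x
    change c * ξ x = c * ∑ w : Fin 0 → Fin N, star (1 : ℂ) * ξ x
    simp
  star_mem' := by
    intro a ha
    rw [← Submodule.coe_iSup_of_directed _ finiteCore_mono.directed_le, iSup_finiteCore,
      SetLike.mem_coe] at *
    induction ha using Submodule.iSup_induction' with
    | zero => rw [star_zero]; exact zero_mem _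
    | add x y _ _ hx hy => rw [star_add]; exact add_mem hx hy
    | mem k x hx => exact Submodule.mem_iSup_of_mem k (star_mem_compacts hx)

end BranchedMap

open UniformSpace in
/-- The completion of a `*`-algebra with respect to a C*-seminorm is a C*-algebra. -/
def cstarCompletion (A : Type u) [SeminormedRing A] [StarRing A] [NormedStarGroup A]
    [NormedAlgebra ℂ A] [StarModule ℂ A] (hA : ∀ x : A, ‖x‖ * ‖x‖ ≤ ‖star x * x‖) :
    CStarAlgebra (Completion A) :=
  have hc : UniformContinuous (star : A → A) := (starNormedAddGroupHom (E := A)).uniformContinuous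
  have hs : Continuous (Completion.map (star : A → A)) := Completion.continuous_map
  have hcoe : ∀ a : A, Completion.map star (a : Completion A) = ((star a : A) : Completion A) :=
    Completion.map_coe hc
  have h1 : ∀ x : Completion A, Completion.map star (Completion.map star x) = x := fun x => by
    refine Completion.induction_on x (isClosed_eq (hs.comp hs) continuous_id) fun a => ?_
    rw [hcoe, hcoe, star_star]
  have h2 : ∀ x y : Completion A,
      Completion.map star (x * y) = Completion.map star y * Completion.map star x := fun x y => by
    refine Completion.induction_on₂ x y (isClosed_eq (hs.comp (continuous_fst.mul continuous_snd))
      ((hs.comp continuous_snd).mul (hs.comp continuous_fst))) fun a b => ?_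
    rw [← Completion.coe_mul, hcoe, hcoe, hcoe, star_mul, Completion.coe_mul]
  have h3 : ∀ x y : Completion A,
      Completion.map star (x + y) = Completion.map star x + Completion.map star y := fun x y => by
    refine Completion.induction_on₂ x y (isClosed_eq (hs.comp (continuous_fst.add continuous_snd))
      ((hs.comp continuous_fst).add (hs.comp continuous_snd))) fun a b => ?_
    rw [← Completion.coe_add, hcoe, hcoe, hcoe, star_add, Completion.coe_add]
  have h4 : ∀ x : Completion A, ‖x‖ * ‖x‖ ≤ ‖Completion.map star x * x‖ := fun x => by
    refine Completion.induction_on x (isClosed_le (continuous_norm.mul continuous_norm)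
      (continuous_norm.comp (hs.mul continuous_id))) fun a => ?_
    rw [hcoe, ← Completion.coe_mul, Completion.norm_coe, Completion.norm_coe]
    exact hA a
  have h5 : ∀ (c : ℂ) (x : Completion A),
      Completion.map star (c • x) = star c • Completion.map star x := fun c x => by
    refine Completion.induction_on x (isClosed_eq (hs.comp (continuous_const_smul c))
      (hs.const_smul (star c))) fun a => ?_
    rw [← Completion.coe_smul, hcoe, hcoe, star_smul, Completion.coe_smul]
  { (inferInstance : NormedRing (Completion A)), (inferInstance : CompleteSpace (Completion A)),
    (inferInstance : Algebra ℂ (Completion A)) with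
    star := Completion.map star
    star_involutive := h1
    star_mul := h2
    star_add := h3
    norm_mul_self_le := h4
    norm_smul_le := norm_smul_le
    star_smul := h5 }

namespace BranchedMap

variable {K : Type u} [MetricSpace K] [CompactSpace K] {N : ℕ} (γ : BranchedMap K N)

instance : NormedAlgebra ℂ γ.unionCore where
  norm_smul_le c T := norm_smul_le c T.1

instance : NormedStarGroup γ.unionCore where
  norm_star_le T := NormedStarGroup.norm_star_le T.1

/-- The core `F^(∞)`, the C*-algebraic inductive limit of the finite cores `F^(n)`. -/
def Core : Type u := UniformSpace.Completion γ.unionCore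

instance : CStarAlgebra γ.Core :=
  cstarCompletion γ.unionCore fun T => norm_mul_self_le' T.1

instance : PartialOrder γ.Core := CStarAlgebra.spectralOrder _

instance : StarOrderedRing γ.Core := CStarAlgebra.spectralOrderedRing _

variable {γ}

/-- The inclusion of `⋃ₙ F^(n)` into `F^(∞)`. -/
def toCore : γ.unionCore →⋆ₐ[ℂ] γ.Core where
  toFun T := (T : UniformSpace.Completion γ.unionCore)
  map_one' := rfl
  map_mul' := UniformSpace.Completion.coe_mul
  map_zero' := rfl
  map_add' := UniformSpace.Completion.coe_add
  commutes' _ := rfl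
  map_star' T := (UniformSpace.Completion.map_coe
    (starNormedAddGroupHom (E := γ.unionCore)).uniformContinuous T).symm

lemma norm_toCore (T : γ.unionCore) : ‖toCore T‖ = ‖(T : γ.adjointable)‖ :=
  UniformSpace.Completion.norm_coe T

lemma denseRange_toCore : DenseRange (toCore : γ.unionCore → γ.Core) :=
  UniformSpace.Completion.denseRange_coe

variable (γ)

/-! ### The matrix representation and the ideals `J^(b,n)` -/

/-- `a = Π^(n)(T)`: the matrix `a ∈ M_{N^n}(C(K))` implements the operator `T` on `X^{⊗ n}`, where
`X^{⊗ n}` is embedded into the free module `C(K)^{N^n}` by `f ↦ (f ∘ γ_w)_w`. -/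
def Represents (n : ℕ) (T : γ.adjointable)
    (a : Matrix (Fin n → Fin N) (Fin n → Fin N) C(K, ℂ)) : Prop :=
  ∀ (f : C(K, ℂ)) (y : K) (w : Fin n → Fin N),
    T.1 f (γ.word n w y) = ∑ v, a w v y * f (γ.word n v y)

/-- `J^(b,n,n) = {T ∈ F^(n) | Π^(n)(T)(b) = 0}`. -/
def finiteIdeal (b : K) (n : ℕ) : Submodule ℂ γ.adjointable where
  carrier := {T | T ∈ γ.finiteCore n ∧ ∃ a, γ.Represents n T a ∧ ∀ w v, a w v b = 0}
  zero_mem' := ⟨zero_mem _, 0, fun f y w => by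
    simp only [Matrix.zero_apply, ContinuousMap.zero_apply, zero_mul, Finset.sum_const_zero]
    rfl, fun _ _ => rfl⟩
  add_mem' := by
    rintro T S ⟨hT, a, ha, ha'⟩ ⟨hS, c, hc, hc'⟩
    refine ⟨add_mem hT hS, a + c, fun f y w => ?_, fun w v => ?_⟩
    · change T.1 f (γ.word n w y) + S.1 f (γ.word n w y) = _
      simp only [ha f y w, hc f y w, ← Finset.sum_add_distrib, Matrix.add_apply,
        ContinuousMap.add_apply, add_mul]
    · simp only [Matrix.add_apply, ContinuousMap.add_apply, ha', hc', add_zero]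
  smul_mem' := by
    rintro c T ⟨hT, a, ha, ha'⟩
    refine ⟨Submodule.smul_mem _ c hT, c • a, fun f y w => ?_, fun w v => ?_⟩
    · change c * T.1 f (γ.word n w y) = _
      simp only [ha f y w, Finset.mul_sum, Matrix.smul_apply, ContinuousMap.smul_apply,
        smul_eq_mul, mul_assoc]
    · simp only [Matrix.smul_apply, ContinuousMap.smul_apply, ha', smul_zero]

/-- `J^(b,n,m) = J^(b,n,n) + K(X^{⊗ (n + 1)}) + ⋯ + K(X^{⊗ m})`. -/
def partialIdeal (b : K) (n m : ℕ) : Submodule ℂ γ.adjointable :=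
  γ.finiteIdeal b n ⊔ ⨆ k ∈ Set.Ioc n m, γ.compacts k

/-- `J̄^(b,n)`, the closure of `⋃_{m > n} J^(b,n,m)` in `F^(∞)`. -/
def coreIdeal (b : K) (n : ℕ) : Set γ.Core :=
  closure (toCore '' {T | ∃ m, n < m ∧ (T : γ.adjointable) ∈ γ.partialIdeal b n m})

end BranchedMap

/-! ### Primitive ideals -/

section CStar

variable {A : Type u} [CStarAlgebra A]

/-- A representation on a Hilbert space `H ≠ 0` is irreducible if it has no closed invariant
subspaces besides `0` and `H`. -/
def IsIrreducibleRep {H : Type u} [NormedAddCommGroup H] [InnerProductSpace ℂ H] [CompleteSpace H]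
    (π : A →⋆ₐ[ℂ] (H →L[ℂ] H)) : Prop :=
  Nontrivial H ∧ ∀ M : Submodule ℂ H, IsClosed (M : Set H) →
    (∀ a, ∀ v ∈ M, π a v ∈ M) → M = ⊥ ∨ M = ⊤

variable (A) in
/-- `Prim(A)`: the kernels of the irreducible representations of `A`. -/
def primitiveIdeals : Set (Ideal A) :=
  {P | ∃ (H : Type u) (_ : NormedAddCommGroup H) (_ : InnerProductSpace ℂ H)
    (_ : CompleteSpace H) (π : A →⋆ₐ[ℂ] (H →L[ℂ] H)),
    IsIrreducibleRep π ∧ ∀ a, a ∈ P ↔ π a = 0}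

variable (A) in
/-- The Jacobson (hull-kernel) topology on `Prim(A)`: its open sets are the sets
`{P | I ⊄ P}` for two-sided ideals `I`. -/
@[reducible] def jacobsonTopology : TopologicalSpace (primitiveIdeals A) :=
  TopologicalSpace.generateFrom
    {U | ∃ I : Ideal A, I.IsTwoSided ∧ U = {P : primitiveIdeals A | ¬ I ≤ (P : Ideal A)}}

/-! ### Traces and the von Neumann algebras they generate -/

/-- The von Neumann algebra `π(A)''` generated by a representation. -/
def generatedVN {H : Type u} [NormedAddCommGroup H] [InnerProductSpace ℂ H] [CompleteSpace H]
    (π : A →⋆ₐ[ℂ] (H →L[ℂ] H)) : VonNeumannAlgebra H where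
  toStarSubalgebra :=
    StarSubalgebra.centralizer ℂ (StarSubalgebra.centralizer ℂ (Set.range π) : Set (H →L[ℂ] H))
  centralizer_centralizer' := Set.centralizer_centralizer_centralizer _

variable [PartialOrder A] [StarOrderedRing A]

/-- A tracial state. -/
def IsTracialState (τ : A →ₚ[ℂ] ℂ) : Prop := τ 1 = 1 ∧ ∀ x y, τ (x * y) = τ (y * x)

/-- The kernel `{x | τ(x* x) = 0}` of a trace. -/
def traceKernel (τ : A →ₚ[ℂ] ℂ) : Set A := {x | τ (star x * x) = 0}

/-- The von Neumann algebra generated by the GNS representation of `τ`. -/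
def gnsVN (τ : A →ₚ[ℂ] ℂ) : VonNeumannAlgebra τ.GNS := generatedVN τ.gnsStarAlgHom

end CStar

namespace VonNeumannAlgebra

variable {H : Type u} [NormedAddCommGroup H] [InnerProductSpace ℂ H] [CompleteSpace H]
  (M : VonNeumannAlgebra H)

/-- `M ≠ 0` has trivial centre. -/
def IsFactor : Prop := Nontrivial H ∧ ∀ x ∈ M, x ∈ M.commutant → ∃ c : ℂ, x = c • 1

/-- A factor of type II₁: it is finite (isometries are unitary) and has no minimal projections. -/
def IsTypeII1Factor : Prop :=
  M.IsFactor ∧ (∀ u ∈ M, star u * u = 1 → u * star u = 1) ∧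
    ∀ p ∈ M, IsStarProjection p → p ≠ 0 → ∃ q ∈ M, IsStarProjection q ∧ q ≠ 0 ∧ q ≠ p ∧ p * q = q

/-- `M` is injective: there is a projection of norm one from `B(H)` onto `M`. -/
def IsInjective : Prop :=
  ∃ E : (H →L[ℂ] H) →ₗ[ℂ] (H →L[ℂ] H), (∀ x, E x ∈ M) ∧ (∀ x ∈ M, E x = x) ∧ ∀ x, ‖E x‖ ≤ ‖x‖

end VonNeumannAlgebra

namespace BranchedMap

variable {K : Type u} [MetricSpace K] [CompactSpace K] {N : ℕ} (γ : BranchedMap K N)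

/-- The Hutchinson measure: the probability measure `μ` with `μ = N⁻¹ ∑_j (γ_j)_* μ`. -/
def IsHutchinsonMeasure [MeasurableSpace K] (μ : MeasureTheory.Measure K) : Prop :=
  MeasureTheory.IsProbabilityMeasure μ ∧ μ = (N : ℝ≥0∞)⁻¹ • ∑ j, μ.map (γ.map j)

/-- `τ^∞`, the tracial state of `F^(∞)` with `τ^∞(T) = N^{-n} ∫ Tr(Π^(n)(T)(x)) dμ(x)` on `F^(n)`,
where `μ` is the Hutchinson measure. -/
def IsContinuousTrace [MeasurableSpace K] (τ : γ.Core →ₚ[ℂ] ℂ) : Prop :=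
  IsTracialState τ ∧ ∃ μ, γ.IsHutchinsonMeasure μ ∧
    ∀ (n : ℕ) (T : γ.unionCore), (T : γ.adjointable) ∈ γ.finiteCore n →
      ∀ a, γ.Represents n T a → τ (toCore T) = ((N : ℂ) ^ n)⁻¹ * ∫ x, ∑ w, a w w x ∂μ

/-- `τ^(b,n)`, the tracial state of `F^(∞)` with `τ^(b,n)(T) = N^{-n} Tr(Π^(n)(T)(b))` on `F^(n)`
and `τ^(b,n) = 0` on `K(X^{⊗ m})` for `m > n`. -/
def IsDiscreteTrace (b : K) (n : ℕ) (τ : γ.Core →ₚ[ℂ] ℂ) : Prop :=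
  IsTracialState τ ∧
    (∀ T : γ.unionCore, (T : γ.adjointable) ∈ γ.finiteCore n →
      ∀ a, γ.Represents n T a → τ (toCore T) = ((N : ℂ) ^ n)⁻¹ * ∑ w, a w w b) ∧
    ∀ m, n < m → ∀ T : γ.unionCore, (T : γ.adjointable) ∈ γ.compacts m → τ (toCore T) = 0

end BranchedMap

end

-- The cograph of `γ^n` is the graph of `h^n`, so every `X^{⊗ n}` is realised on `C(K)` and `T ⊗ I`
-- is `T` itself: all the algebras consist of operators on one space. An operator of level `n` acts
-- on the fibre over `y`, that is, on the vectors `(f(γ_w y))_w`. Two words of length `n` can agree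
-- at `y` only if `y` lies on the strict forward orbit of a branch point. These collision points
-- form a finite set, whose complement is dense because `K` has no isolated points; matrices are
-- therefore unique. Since `B_γ` and `P_γ` are disjoint, no branch point is a collision point, and
-- evaluation over a branch point is onto.
--
-- Two facts about compact operators carry the ideal theory. A compact operator of level `n` whose
-- matrix vanishes on `B_γ` is compact of level `n + 1` (`mem_compacts_succ_of_vanish`). A compact
-- operator of level `m` has equal columns at colliding words. If `γ_i` and `γ_j` both send `h b` to
-- `b`, the difference of the `(i,i)` and `(i,j)` blocks along the orbit of `b` hence annihilates
-- all compacts of level above `n`, while it is `Π^(n)(T)(b)` on `F^(n)`. This gives a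
-- representation of the core onto `M_{N^n}(ℂ)` with kernel `J̄^(b,n)` (`exists_unionRep`,
-- `mem_coreIdeal_iff`). The first fact shows that the common kernel of these representations up to
-- level `n` is the closure of the compacts of level above `n` (`mem_closure_tail`).
--
-- The primitive ideals follow from a dichotomy. Since words contract, the norm of `T` is almost
-- attained by a vector of `X^{⊗ m}` in all fibres at once, for every large `m`; so a representation
-- that is nonzero on `K(X^{⊗ m})` for infinitely many `m` is faithful (`eq_zero_of_frequently`).
-- Any other representation annihilates all compacts of high level, so its kernel contains a finite
-- intersection of ideals `J̄^(b,k)`; if it is irreducible, primeness and simplicity of matrix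
-- algebras leave just one of them. Zero is primitive because evaluation along an orbit that avoids
-- `B_γ` is a pure state, by excision. Each nonzero element lies in only finitely many `J̄^(b,n)`,
-- which gives the topology.
--
-- The discrete traces are the normalised traces of the matrix representations. The Hutchinson trace
-- is consistent across levels by invariance of `μ`. For its von Neumann algebra, the matrix of `T`
-- at level `n` is almost constant in `y` when `n` is large, and the collision set is `μ`-null;
-- matrix units cut off near this set therefore almost commute past `T` like scalar matrix units
-- (`HasMatrixApproximation`). A central element is then scalar, a minimal projection would have too
-- many orthogonal equivalent copies, and averaging over the corresponding right multiplications,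
-- followed by a weak limit, is a norm one projection onto the commutant of the right
-- multiplications. That commutant is the algebra itself, by the commutation theorem
-- `mem_generatedVN_of_commute`.

universe v

namespace BranchedMap

variable {K : Type u} [MetricSpace K] {N : ℕ} {γ : BranchedMap K N}

/-! ### Geometry of the words -/

variable (γ) in
lemma exists_contraction :
    ∃ c : ℝ, 0 ≤ c ∧ c < 1 ∧ ∀ j x y, dist (γ.map j x) (γ.map j y) ≤ c * dist x y := by
  choose c' c h0 hc h1 hd using γ.proper
  have hne : (Finset.univ : Finset (Option (Fin N))).Nonempty := ⟨none, Finset.mem_univ _⟩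
  -- The extra index `none` contributes 0, which makes the supremum nonnegative and the index set
  -- nonempty even without letters.
  refine ⟨Finset.univ.sup' hne (fun o => o.elim 0 c), ?_, ?_, fun j x y => ?_⟩
  · exact Finset.le_sup' (fun o : Option (Fin N) => o.elim 0 c) (Finset.mem_univ none)
  · rw [Finset.sup'_lt_iff]
    rintro (_ | j) -
    · exact zero_lt_one
    · exact h1 j
  · refine (hd j x y).2.trans (mul_le_mul_of_nonneg_right ?_ dist_nonneg)
    exact Finset.le_sup' (fun o : Option (Fin N) => o.elim 0 c) (Finset.mem_univ (some j))

lemma dist_word_le {c : ℝ} (hc : 0 ≤ c)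
    (h : ∀ j x y, dist (γ.map j x) (γ.map j y) ≤ c * dist x y) (n : ℕ) (w : Fin n → Fin N)
    (x y : K) : dist (γ.word n w x) (γ.word n w y) ≤ c ^ n * dist x y := by
  induction n generalizing x y with
  | zero => simp [SelfSimilarMap.word, BranchedMap.word]
  | succ n ih =>
    refine (ih (Fin.tail w) (γ.map (w 0) x) (γ.map (w 0) y)).trans ?_
    rw [pow_succ, mul_assoc]
    exact mul_le_mul_of_nonneg_left (h _ _ _) (pow_nonneg hc n)

variable (γ) in
/-- The words contract uniformly. -/
lemma exists_dist_word_lt [CompactSpace K] {ε : ℝ} (hε : 0 < ε) :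
    ∃ n₀, ∀ n ≥ n₀, ∀ (w : Fin n → Fin N) (x y : K),
      dist (γ.word n w x) (γ.word n w y) < ε := by
  obtain ⟨c, hc0, hc1, hc⟩ := γ.exists_contraction
  have h1 : Filter.Tendsto (fun n : ℕ => c ^ n * Metric.diam (Set.univ : Set K))
      Filter.atTop (𝓝 (0 * Metric.diam (Set.univ : Set K))) :=
    (tendsto_pow_atTop_nhds_zero_of_lt_one hc0 hc1).mul_const _
  rw [zero_mul] at h1
  obtain ⟨n₀, h2⟩ := Filter.eventually_atTop.1 (h1.eventually_lt_const hε)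
  refine ⟨n₀, fun n hn w x y => lt_of_le_of_lt ?_ (h2 n hn)⟩
  refine (dist_word_le hc0 hc n w x y).trans (mul_le_mul_of_nonneg_left ?_ (pow_nonneg hc0 n))
  exact Metric.dist_le_diam_of_mem isCompact_univ.isBounded trivial trivial

lemma word_injective (n : ℕ) (w : Fin n → Fin N) : Function.Injective (γ.word n w) :=
  Function.LeftInverse.injective (γ.iterate_word n w)

lemma word_succ (n : ℕ) (w : Fin (n + 1) → Fin N) (y : K) :
    γ.word (n + 1) w y = γ.word n (Fin.tail w) (γ.map (w 0) y) := rfl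

@[simp] lemma word_cons (n : ℕ) (j : Fin N) (w : Fin n → Fin N) (y : K) :
    γ.word (n + 1) (Fin.cons j w : Fin (n + 1) → Fin N) y = γ.word n w (γ.map j y) := rfl

@[simp] lemma word_zero (w : Fin 0 → Fin N) (y : K) : γ.word 0 w y = y := rfl

lemma exists_map_h (x : K) : ∃ j, γ.map j (γ.h x) = x := by
  have hx : x ∈ ⋃ j, Set.range (γ.map j) := by rw [γ.cover]; trivial
  obtain ⟨j, z, rfl⟩ := Set.mem_iUnion.1 hx
  exact ⟨j, by rw [γ.h_map]⟩

lemma exists_word_iterate (n : ℕ) (x : K) : ∃ w, γ.word n w (γ.h^[n] x) = x := by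
  obtain ⟨w, y, rfl⟩ := γ.exists_word n x
  exact ⟨w, by rw [γ.iterate_word]⟩

lemma mem_branchSet_iff {x : K} : x ∈ γ.branchSet ↔
    ∃ i j, i ≠ j ∧ γ.map i (γ.h x) = x ∧ γ.map j (γ.h x) = x := by
  constructor
  · rintro ⟨a, i, j, hij, rfl, h⟩
    exact ⟨i, j, hij, by rw [γ.h_map], by rw [γ.h_map, h]⟩
  · rintro ⟨i, j, hij, h1, h2⟩
    exact ⟨_, i, j, hij, h1, h2⟩

/-- A word of length `k + 1` leads from `h^(k+1) b` back to `b`, so `h^(k+1) b` is postcritical.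
This is the point where disjointness of `B_γ` and `P_γ` enters. -/
lemma iterate_notMem_branchSet {b : K} (hb : b ∈ γ.branchSet) (k : ℕ) :
    γ.h^[k + 1] b ∉ γ.branchSet := fun h => by
  obtain ⟨w, hw⟩ := γ.exists_word_iterate (k + 1) b
  refine Set.disjoint_left.1 γ.disjoint_postcritical h ⟨k + 1, by omega, w, ?_⟩
  change γ.word (k + 1) w _ ∈ _
  rwa [hw]

variable (γ) in
/-- The points at which two words of length `n` take the same value. -/
def collisionSet (n : ℕ) : Set K := {y | ¬ Function.Injective fun w => γ.word n w y}

lemma collisionSet_zero : γ.collisionSet 0 = ∅ := by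
  ext y
  simp only [collisionSet, Set.mem_ofPred_eq, Set.mem_empty_iff_false, iff_false, not_not]
  exact Function.injective_of_subsingleton _

/-- Applying `h^n` to `γ_w y = γ_v y` shows that the first letters have the same value at `y`:
either they differ and this value is a branch point, or they are equal and the tails collide there.
-/
lemma mem_collisionSet_succ {n : ℕ} {y : K} (hy : y ∈ γ.collisionSet (n + 1)) :
    (∃ j, γ.map j y ∈ γ.branchSet) ∨ ∃ j, γ.map j y ∈ γ.collisionSet n := by
  by_contra! hcon
  refine hy fun w v hwv => ?_
  have h1 : γ.word n (Fin.tail w) (γ.map (w 0) y) = γ.word n (Fin.tail v) (γ.map (v 0) y) := hwv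
  have h2 : γ.map (w 0) y = γ.map (v 0) y := by
    rw [← γ.iterate_word n (Fin.tail w) (γ.map (w 0) y), h1, γ.iterate_word]
  have h3 : w 0 = v 0 := by
    by_contra h
    exact hcon.1 (w 0) ⟨y, w 0, v 0, h, rfl, h2.symm⟩
  have h4 : Fin.tail w = Fin.tail v := by
    rw [← h2] at h1
    exact not_not.1 (hcon.2 (w 0)) h1
  rw [← Fin.cons_self_tail w, ← Fin.cons_self_tail v, h3, h4]

lemma finite_collisionSet (n : ℕ) : (γ.collisionSet n).Finite := by
  induction n with
  | zero => rw [collisionSet_zero]; exact Set.finite_empty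
  | succ n ih =>
    refine ((γ.finite_branchSet.image γ.h).union (ih.image γ.h)).subset fun y hy => ?_
    rcases mem_collisionSet_succ hy with ⟨j, hj⟩ | ⟨j, hj⟩
    · exact Or.inl ⟨_, hj, γ.h_map j y⟩
    · exact Or.inr ⟨_, hj, γ.h_map j y⟩

lemma mem_collisionSet {n : ℕ} {y : K} (hy : y ∈ γ.collisionSet n) :
    ∃ b ∈ γ.branchSet, ∃ k, γ.h^[k + 1] b = y := by
  induction n generalizing y with
  | zero => rw [collisionSet_zero] at hy; exact hy.elim
  | succ n ih =>
    rcases mem_collisionSet_succ hy with ⟨j, hj⟩ | ⟨j, hj⟩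
    · exact ⟨_, hj, 0, γ.h_map j y⟩
    · obtain ⟨b, hb, k, hk⟩ := ih hj
      exact ⟨b, hb, k + 1, by rw [Function.iterate_succ_apply', hk, γ.h_map]⟩

/-- Collisions occur only at points `h^(k+1) b'`, which are not branch points. Hence the points `γ_w
b` are distinct and functions can be prescribed on them; the finite dimensional representations at
`b` are surjective for this reason. -/
lemma branchSet_notMem_collisionSet {b : K} (hb : b ∈ γ.branchSet) (n : ℕ) :
    b ∉ γ.collisionSet n := fun h => by
  obtain ⟨b', hb', k, rfl⟩ := mem_collisionSet h
  exact iterate_notMem_branchSet hb' k hb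

/-- With two letters, the point of a one-point space would be a branch point fixed by `h`. -/
lemma not_subsingleton (γ : BranchedMap K N) (hN : 2 ≤ N) [Nonempty K] : ¬ Subsingleton K := fun h => by
  obtain ⟨x⟩ := ‹Nonempty K›
  have hx : x ∈ γ.branchSet := ⟨x, ⟨0, by omega⟩, ⟨1, by omega⟩, by simp, h.elim _ _, h.elim _ _⟩
  refine iterate_notMem_branchSet hx 0 ?_
  rwa [h.elim (γ.h^[0 + 1] x) x]

/-- A long word whose range contains an isolated point has its whole range in a small ball, hence is
constant; as words are injective, `K` would be a point. Without isolated points, finite sets have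
dense complement. -/
lemma nhdsNE_neBot [CompactSpace K] (γ : BranchedMap K N) (hN : 2 ≤ N) (x : K) : (𝓝[≠] x).NeBot := by
  have : Nonempty K := ⟨x⟩
  by_contra hcon
  rw [Filter.not_neBot, ← isOpen_singleton_iff_punctured_nhds] at hcon
  obtain ⟨ε, hε, hball⟩ := Metric.isOpen_iff.1 hcon x rfl
  obtain ⟨n, hn⟩ := γ.exists_dist_word_lt hε
  obtain ⟨w, y, hy⟩ := γ.exists_word n x
  refine γ.not_subsingleton hN ⟨fun a b => word_injective (γ := γ) n w ?_⟩
  have h : ∀ a, γ.word n w a = x := fun a => by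
    have := hn n le_rfl w a y
    rw [hy] at this
    exact hball this
  rw [h, h]

variable (γ) in
lemma dense_compl_collisionSet [CompactSpace K] (hN : 2 ≤ N) (n : ℕ) :
    Dense (γ.collisionSet n)ᶜ := by
  have : ∀ x : K, (𝓝[≠] x).NeBot := γ.nhdsNE_neBot hN
  rw [Set.compl_eq_univ_sdiff]
  exact dense_univ.sdiff_finite (finite_collisionSet n)

/-- Pasting along the closed sets where `σ i` fixes the point and where some other `σ j` does: `c`
vanishes on the overlap. It provides functions supported on one branch `γ_w(K)`. -/
lemma continuous_ite_fixed {X ι E : Type*} [TopologicalSpace X] [T2Space X] [Finite ι]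
    [TopologicalSpace E] [Zero E] {σ : ι → X → X} (hσ : ∀ i, Continuous (σ i))
    (hex : ∀ x, ∃ i, σ i x = x) {c : X → E} (hc : Continuous c)
    (h0 : ∀ x i j, i ≠ j → σ i x = x → σ j x = x → c x = 0) (i : ι) [DecidableEq X] :
    Continuous fun x => if σ i x = x then c x else 0 := by
  have hA : ∀ i, IsClosed {x | σ i x = x} := fun i => isClosed_eq (hσ i) continuous_id
  have hB : IsClosed (⋃ j : {j // j ≠ i}, {x | σ j x = x}) :=
    isClosed_iUnion_of_finite fun j => hA j
  rw [← continuousOn_univ]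
  have hun : (Set.univ : Set X) = {x | σ i x = x} ∪ ⋃ j : {j // j ≠ i}, {x | σ j x = x} := by
    symm
    refine Set.eq_univ_of_forall fun x => ?_
    obtain ⟨j, hj⟩ := hex x
    by_cases hji : j = i
    · subst hji; exact Or.inl hj
    · exact Or.inr (Set.mem_iUnion.2 ⟨⟨j, hji⟩, hj⟩)
  rw [hun]
  refine ContinuousOn.union_of_isClosed ?_ ?_ (hA i) hB
  · refine hc.continuousOn.congr fun x hx => ?_
    simp only [Set.mem_ofPred_eq] at hx
    simp [hx]
  · refine (continuous_const (y := (0 : E))).continuousOn.congr fun x hx => ?_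
    obtain ⟨⟨j, hj⟩, hx⟩ := Set.mem_iUnion.1 hx
    by_cases hi : σ i x = x
    · simp only [hi, if_true]
      exact h0 x j i hj hx hi
    · simp [hi]

end BranchedMap

/-! ### Bump functions -/

section Bump

variable {X : Type*} [TopologicalSpace X] [NormalSpace X] [T1Space X]

lemma exists_bump {s : Set X} (hs : IsClosed s) {x : X} (hx : x ∉ s) :
    ∃ f : C(X, ℝ), f x = 1 ∧ (∀ y ∈ s, f y = 0) ∧ ∀ y, f y ∈ Set.Icc (0 : ℝ) 1 := by
  obtain ⟨f, h0, h1, h⟩ := exists_continuous_zero_one_of_isClosed hs (isClosed_singleton (x := x))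
    (Set.disjoint_singleton_right.2 hx)
  exact ⟨f, h1 rfl, fun y hy => h0 hy, h⟩

/-- A real function as a complex one. -/
def ContinuousMap.ofRealC {X : Type*} [TopologicalSpace X] (f : C(X, ℝ)) : C(X, ℂ) :=
  ⟨fun x => (f x : ℂ), by fun_prop⟩

@[simp] lemma ContinuousMap.ofRealC_apply {X : Type*} [TopologicalSpace X] (f : C(X, ℝ)) (x : X) :
    f.ofRealC x = (f x : ℂ) := rfl

lemma exists_interpolation {ι : Type*} [Fintype ι] {p : ι → X}
    (hp : Function.Injective p) (ξ : ι → ℂ) : ∃ f : C(X, ℂ), ∀ i, f (p i) = ξ i := by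
  classical
  have h : ∀ i, ∃ f : C(X, ℝ), f (p i) = 1 ∧ (∀ y ∈ p '' {i}ᶜ, f y = 0) ∧
      ∀ y, f y ∈ Set.Icc (0 : ℝ) 1 := fun i =>
    exists_bump ((Set.toFinite _).isClosed) (by
      rintro ⟨j, hj, hji⟩
      exact hj (hp hji))
  choose f hf1 hf0 _ using h
  refine ⟨∑ i, ξ i • (f i).ofRealC, fun i => ?_⟩
  rw [ContinuousMap.sum_apply, Finset.sum_eq_single i]
  · simp [hf1]
  · intro j _ hj
    have := hf0 j (p i) ⟨i, fun h => hj h.symm, rfl⟩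
    simp [this]
  · simp

end Bump

namespace BranchedMap

variable {K : Type u} [MetricSpace K] {N : ℕ} {γ : BranchedMap K N} {n m : ℕ}

/-! ### Operators of a given level -/

lemma rsmul_apply (n : ℕ) (f b : C(K, ℂ)) (x : K) :
    γ.rsmul n f b x = f x * b (γ.h^[n] x) := rfl

lemma fibre_rsmul (n : ℕ) (f b : C(K, ℂ)) (y : K) :
    γ.fibre n y (γ.rsmul n f b) = b y • γ.fibre n y f := by
  ext w
  simp [mul_comm]

lemma apply_eq_fibre (γ : BranchedMap K N) (n : ℕ) (x : K) :
    ∃ w, γ.word n w (γ.h^[n] x) = x ∧ ∀ f : C(K, ℂ), f x = γ.fibre n (γ.h^[n] x) f w := by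
  obtain ⟨w, hw⟩ := γ.exists_word_iterate n x
  exact ⟨w, hw, fun f => by rw [fibre_apply, hw]⟩

lemma eq_of_forall_fibre (γ : BranchedMap K N) (n : ℕ)
    {f g : C(K, ℂ)} (h : ∀ y, γ.fibre n y f = γ.fibre n y g) :
    f = g := by
  ext x
  obtain ⟨w, -, hw⟩ := γ.apply_eq_fibre n x
  rw [hw, hw, h]

lemma eq_of_forall_inner (γ : BranchedMap K N) (n : ℕ) {f f' : C(K, ℂ)}
    (h : ∀ g y, ⟪γ.fibre n y f, γ.fibre n y g⟫_ℂ = ⟪γ.fibre n y f', γ.fibre n y g⟫_ℂ) :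
    f = f' := by
  refine γ.eq_of_forall_fibre n fun y => ?_
  rw [← sub_eq_zero, ← map_sub, ← inner_self_eq_zero (𝕜 := ℂ)]
  nth_rw 1 [map_sub]
  rw [inner_sub_left, h, sub_self]

/-- Adjointable operators are linear over the right action, as seen by moving the operator to the
other side of the inner product. This permits localisation over the points `y`. -/
lemma IsAdjoint.map_rsmul {T S : Op K} (h : γ.IsAdjoint n T S) (f b : C(K, ℂ)) :
    T (γ.rsmul n f b) = γ.rsmul n (T f) b := by
  rw [isAdjoint_iff] at h
  refine γ.eq_of_forall_inner n fun g y => ?_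
  rw [h, fibre_rsmul, fibre_rsmul, inner_smul_left, inner_smul_left, h]

/-- The reason why `T ↦ T ⊗ I` is isometric. After multiplication of `f` by a function of `h^n` that
is 1 at `y` and 0 at the other points `γ_j (h y)`, the fibre of level `n + 1` over `h y` consists of
copies of the fibre of level `n` over `y`. The number of copies is positive and cancels. -/
lemma IsAdjoint.isBound_of_succ {T S : Op K} {C : ℝ} (h : γ.IsAdjoint n T S)
    (hC : γ.IsBound (n + 1) T C) : γ.IsBound n T C := by
  classical
  refine ⟨hC.1, fun f y => ?_⟩
  obtain ⟨j₀, hj₀⟩ := exists_map_h (γ := γ) y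
  set z := γ.h y
  obtain ⟨b, hb1, hb0, -⟩ := exists_bump (s := (Set.range fun j => γ.map j z) \ {y}) (x := y)
    ((Set.toFinite _).isClosed) (by simp)
  have key : ∀ g : C(K, ℂ), ‖γ.fibre (n + 1) z (γ.rsmul n g b.ofRealC)‖ ^ 2 =
      (Finset.univ.filter fun j => γ.map j z = y).card * ‖γ.fibre n y g‖ ^ 2 := fun g => by
    rw [norm_fibre_succ, Finset.card_filter, Nat.cast_sum, Finset.sum_mul]
    refine Finset.sum_congr rfl fun j _ => ?_
    rw [fibre_rsmul, norm_smul]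
    by_cases hj : γ.map j z = y
    · simp [hj, hb1]
    · simp [hj, hb0 _ ⟨⟨j, rfl⟩, hj⟩]
  have h1 := hC.2 (γ.rsmul n f b.ofRealC) z
  rw [h.map_rsmul] at h1
  have h2 := pow_le_pow_left₀ (norm_nonneg _) h1 2
  rw [mul_pow, key, key] at h2
  have hpos : (0 : ℝ) < (Finset.univ.filter fun j => γ.map j z = y).card := by
    exact_mod_cast Finset.card_pos.2 ⟨j₀, by simp [hj₀]⟩
  refine le_of_sq_le_sq ?_ (mul_nonneg hC.1 (norm_nonneg _))
  rw [mul_pow]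
  nlinarith

lemma IsAdjoint.isBound_of_le {T S : Op K} {C : ℝ} (h : γ.IsAdjoint n T S) (hnm : n ≤ m)
    (hC : γ.IsBound m T C) : γ.IsBound n T C := by
  induction m, hnm using Nat.le_induction with
  | base => exact hC
  | succ m hm ih => exact ih ((h.mono hm).isBound_of_succ hC)

variable (γ) in
/-- The adjointable operators of `X^{⊗ n}`. -/
def adjointableAt (n : ℕ) : Submodule ℂ γ.adjointable where
  carrier := {T | γ.IsAdjoint n T.1 (star T).1}
  zero_mem' := fun f g => by
    rw [star_zero]
    ext y
    simp [innerX_apply]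
  add_mem' := fun {T S} hT hS => by
    simp only [Set.mem_ofPred_eq, star_add]
    exact IsAdjoint.add hT hS
  smul_mem' := fun c T hT => by
    simp only [Set.mem_ofPred_eq, star_smul]
    exact IsAdjoint.smul hT c

lemma mem_adjointableAt {T : γ.adjointable} :
    T ∈ γ.adjointableAt n ↔ γ.IsAdjoint n T.1 (star T).1 := Iff.rfl

lemma adjointableAt_of_isAdjoint {T : γ.adjointable} {S : Op K} (h : γ.IsAdjoint n T.1 S) :
    T ∈ γ.adjointableAt n := by
  rw [mem_adjointableAt, star_eq h]
  exact h

lemma adjointableAt_mono : Monotone γ.adjointableAt := fun _ _ h _ hT => IsAdjoint.mono hT h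

lemma star_mem_adjointableAt {T : γ.adjointable} (h : T ∈ γ.adjointableAt n) :
    star T ∈ γ.adjointableAt n := adjointableAt_of_isAdjoint (IsAdjoint.symm h)

lemma exists_mem_adjointableAt (T : γ.adjointable) : ∃ n, T ∈ γ.adjointableAt n := by
  obtain ⟨n, C, h, -⟩ := exists_isAdjoint_star T
  exact ⟨n, h⟩

lemma isBound_of_norm_lt {T : γ.adjointable} (hT : T ∈ γ.adjointableAt n) {C : ℝ}
    (h : ‖T‖ < C) : γ.IsBound n T.1 C := by
  obtain ⟨m, hm⟩ := exists_isBound T h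
  exact IsAdjoint.isBound_of_le hT (le_max_left n m) (hm.mono (le_max_right n m))

lemma isBound_norm {T : γ.adjointable} (hT : T ∈ γ.adjointableAt n) :
    γ.IsBound n T.1 ‖T‖ := by
  refine ⟨norm_nonneg' T, fun f y => ?_⟩
  refine le_of_forall_pos_le_add fun ε hε => ?_
  set a := ‖γ.fibre n y f‖
  have ha : 0 ≤ a := norm_nonneg _
  have h1 : ‖T‖ < ‖T‖ + ε / (a + 1) := lt_add_of_pos_right _ (by positivity)
  refine ((isBound_of_norm_lt hT h1).2 f y).trans ?_
  rw [add_mul]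
  gcongr
  rw [div_mul_eq_mul_div, div_le_iff₀ (by positivity)]
  nlinarith

lemma norm_apply_le {T : γ.adjointable} (hT : T ∈ γ.adjointableAt n) (f : C(K, ℂ)) (x : K) :
    ‖T.1 f x‖ ≤ ‖T‖ * ‖γ.fibre n (γ.h^[n] x) f‖ := by
  obtain ⟨w, -, hw⟩ := γ.apply_eq_fibre n x
  rw [hw]
  exact (PiLp.norm_apply_le _ w).trans ((isBound_norm hT).2 f _)

lemma tendsto_apply {u : ℕ → γ.adjointable} {T : γ.adjointable}
    (hu : ∀ k, u k ∈ γ.adjointableAt n) (hT : T ∈ γ.adjointableAt n)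
    (h : Filter.Tendsto u Filter.atTop (𝓝 T)) (f : C(K, ℂ)) (x : K) :
    Filter.Tendsto (fun k => (u k).1 f x) Filter.atTop (𝓝 (T.1 f x)) := by
  rw [tendsto_iff_norm_sub_tendsto_zero] at h ⊢
  have h1 := h.mul_const ‖γ.fibre n (γ.h^[n] x) f‖
  rw [zero_mul] at h1
  refine squeeze_zero (fun _ => norm_nonneg _) (fun k => ?_) h1
  exact norm_apply_le (sub_mem (hu k) hT) f x

/-! ### The matrix representation -/

variable (γ) in
/-- The block diagonal matrix representing `T ⊗ I` when `a` represents `T`. -/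
noncomputable def blockDiag (n : ℕ) : Matrix (Fin n → Fin N) (Fin n → Fin N) C(K, ℂ) →ₗ[ℂ]
    Matrix (Fin (n + 1) → Fin N) (Fin (n + 1) → Fin N) C(K, ℂ) where
  toFun a := Matrix.of fun w v => if w 0 = v 0 then
    (a (Fin.tail w) (Fin.tail v)).comp ⟨γ.map (w 0), γ.continuous_map _⟩ else 0
  map_add' a b := by
    ext w v y
    by_cases h : w 0 = v 0 <;> simp [h]
  map_smul' c a := by
    ext w v y
    by_cases h : w 0 = v 0 <;> simp [h]

lemma blockDiag_cons_cons (a : Matrix (Fin n → Fin N) (Fin n → Fin N) C(K, ℂ)) (i j : Fin N)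
    (w v : Fin n → Fin N) (y : K) :
    γ.blockDiag n a (Fin.cons i w) (Fin.cons j v) y = if i = j then a w v (γ.map i y) else 0 := by
  by_cases h : i = j
  · subst h; simp [blockDiag]
  · simp [blockDiag, h]

lemma sum_words_succ {E : Type*} [AddCommMonoid E] (F : (Fin (n + 1) → Fin N) → E) :
    ∑ w, F w = ∑ j, ∑ w : Fin n → Fin N, F (Fin.cons j w) := by
  rw [← (Fin.consEquiv fun _ => Fin N).sum_comp, Fintype.sum_prod_type]
  rfl

variable {T S : γ.adjointable} {a b : Matrix (Fin n → Fin N) (Fin n → Fin N) C(K, ℂ)}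

lemma Represents.add (hT : γ.Represents n T a) (hS : γ.Represents n S b) :
    γ.Represents n (T + S) (a + b) := fun f y w => by
  change T.1 f (γ.word n w y) + S.1 f (γ.word n w y) = _
  simp only [hT f y w, hS f y w, ← Finset.sum_add_distrib, Matrix.add_apply,
    ContinuousMap.add_apply, add_mul]

lemma Represents.smul (hT : γ.Represents n T a) (c : ℂ) :
    γ.Represents n (c • T) (c • a) := fun f y w => by
  change c * T.1 f (γ.word n w y) = _
  simp only [hT f y w, Finset.mul_sum, Matrix.smul_apply, ContinuousMap.smul_apply,
    smul_eq_mul, mul_assoc]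

lemma Represents.sub (hT : γ.Represents n T a) (hS : γ.Represents n S b) :
    γ.Represents n (T - S) (a - b) := by
  have h1 : (-1 : ℂ) • b = -b := by ext; simp
  have := hT.add (hS.smul (-1))
  rwa [neg_one_smul, h1, ← sub_eq_add_neg, ← sub_eq_add_neg] at this

lemma Represents.mul (hT : γ.Represents n T a) (hS : γ.Represents n S b) :
    γ.Represents n (T * S) (a * b) := fun f y w => by
  change T.1 (S.1 f) (γ.word n w y) = _
  rw [hT]
  simp only [hS f y, Matrix.mul_apply, ContinuousMap.sum_apply, ContinuousMap.mul_apply,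
    Finset.mul_sum, Finset.sum_mul, mul_assoc]
  rw [Finset.sum_comm]

lemma Represents.blockDiag (hT : γ.Represents n T a) :
    γ.Represents (n + 1) T (γ.blockDiag n a) := fun f y w => by
  rw [word_succ, hT, sum_words_succ]
  obtain ⟨j, w, rfl⟩ : ∃ j v, w = Fin.cons j v := ⟨w 0, Fin.tail w, (Fin.cons_self_tail w).symm⟩
  simp only [blockDiag_cons_cons, Fin.cons_zero, Fin.tail_cons, word_cons]
  simp only [ite_mul, zero_mul, Finset.sum_ite_irrel, Finset.sum_const_zero]
  rw [Finset.sum_ite_eq]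
  simp

lemma represents_one : γ.Represents n (1 : γ.adjointable) 1 := fun f y w => by
  change f _ = _
  simp [Matrix.one_apply, apply_ite (fun g : C(K, ℂ) => g y), ite_mul]

lemma exists_unit_vector {y : K} (hy : y ∉ γ.collisionSet n) (v : Fin n → Fin N) :
    ∃ f : C(K, ℂ), ∀ w, f (γ.word n w y) = if w = v then 1 else 0 :=
  exists_interpolation (not_not.1 hy) _

lemma Represents.eq_of_unit (hT : γ.Represents n T a) {y : K} {v : Fin n → Fin N} {f : C(K, ℂ)}
    (hf : ∀ w, f (γ.word n w y) = if w = v then 1 else 0) (w : Fin n → Fin N) :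
    a w v y = T.1 f (γ.word n w y) := by
  rw [hT]
  simp [hf]

variable [CompactSpace K]

lemma rankOne_mem_finiteRank (n : ℕ) (f g : C(K, ℂ)) : γ.rankOne n f g ∈ γ.finiteRank n :=
  Submodule.subset_span ⟨f, g, rfl⟩

lemma rankOne_mem_compacts (n : ℕ) (f g : C(K, ℂ)) : γ.rankOne n f g ∈ γ.compacts n :=
  Submodule.le_topologicalClosure _ (rankOne_mem_finiteRank n f g)

lemma finiteRank_le_adjointableAt (n : ℕ) : γ.finiteRank n ≤ γ.adjointableAt n := fun _ hT => by
  obtain ⟨S, h⟩ := exists_isAdjoint_of_mem_finiteRank hT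
  exact adjointableAt_of_isAdjoint h

lemma exists_seq_of_mem_compacts {T : γ.adjointable} (hT : T ∈ γ.compacts n) :
    ∃ u : ℕ → γ.adjointable, (∀ k, u k ∈ γ.finiteRank n) ∧
      Filter.Tendsto u Filter.atTop (𝓝 T) := by
  obtain ⟨u, hu, h⟩ := mem_closure_iff_seq_limit.1 hT
  exact ⟨u, hu, h⟩

/-- The limit has some level, perhaps larger than `n`. At a common level norm convergence implies
pointwise convergence of the functions `T f`, and the adjoint relation of level `n` is an identity
of finite sums of values, so it survives the limit. -/
lemma compacts_le_adjointableAt (n : ℕ) : γ.compacts n ≤ γ.adjointableAt n := fun T hT => by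
  obtain ⟨u, hu, h⟩ := exists_seq_of_mem_compacts hT
  obtain ⟨m, hm⟩ := exists_mem_adjointableAt T
  have hTM := adjointableAt_mono (le_max_left m n) hm
  have huM := fun k => adjointableAt_mono (le_max_right m n)
    (finiteRank_le_adjointableAt n (hu k))
  rw [mem_adjointableAt]
  intro f g
  ext y
  have h1 := fun f x => tendsto_apply huM hTM h f x
  have h2 := fun f x => tendsto_apply (fun k => star_mem_adjointableAt (huM k))
    (star_mem_adjointableAt hTM) ((continuous_star.tendsto T).comp h) f x
  have h3 : Filter.Tendsto (fun k => γ.innerX n ((u k).1 f) g y) Filter.atTop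
      (𝓝 (γ.innerX n (T.1 f) g y)) :=
    tendsto_finsetSum _ fun w _ => ((h1 f _).star).mul_const _
  have h4 : Filter.Tendsto (fun k => γ.innerX n f ((star (u k)).1 g) y) Filter.atTop
      (𝓝 (γ.innerX n f ((star T).1 g) y)) :=
    tendsto_finsetSum _ fun w _ => (h2 g _).const_mul _
  refine tendsto_nhds_unique h3 (h4.congr fun k => ?_)
  rw [finiteRank_le_adjointableAt n (hu k) f g]

lemma finiteCore_le_adjointableAt (n : ℕ) : γ.finiteCore n ≤ γ.adjointableAt n :=
  iSup₂_le fun k hk => (compacts_le_adjointableAt k).trans (adjointableAt_mono hk)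

lemma represents_rankOne (n : ℕ) (f g : C(K, ℂ)) :
    γ.Represents n (γ.rankOne n f g) fun w v =>
      f.comp ⟨γ.word n w, γ.continuous_word n w⟩ *
        star (g.comp ⟨γ.word n v, γ.continuous_word n v⟩) := fun ξ y w => by
  change γ.rsmul n f (γ.innerX n g ξ) (γ.word n w y) = _
  rw [rsmul_word]
  simp [innerX, Finset.mul_sum, mul_assoc]

lemma eq_of_eqOn_compl_collisionSet (hN : 2 ≤ N) {E : Type*} [TopologicalSpace E] [T2Space E]
    {f g : C(K, E)} (h : ∀ y ∉ γ.collisionSet n, f y = g y) : f = g := by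
  refine DFunLike.coe_injective ?_
  exact Continuous.ext_on (γ.dense_compl_collisionSet hN n) f.continuous g.continuous h

/-- Off the collision set the unit vectors of the fibre are attained by continuous functions, so the
entries can be read off from `T`; density does the rest. -/
lemma Represents.unique (hN : 2 ≤ N) (hT : γ.Represents n T a) (hT' : γ.Represents n T b) :
    a = b := by
  ext1 w v
  refine eq_of_eqOn_compl_collisionSet (γ := γ) (n := n) hN fun y hy => ?_
  obtain ⟨f, hf⟩ := exists_unit_vector hy v
  rw [hT.eq_of_unit hf, hT'.eq_of_unit hf]

lemma Represents.norm_le (hN : 2 ≤ N) (hT : γ.Represents n T a) (hT' : T ∈ γ.adjointableAt n)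
    (w v : Fin n → Fin N) (y : K) : ‖a w v y‖ ≤ ‖T‖ := by
  have hcl : IsClosed {y | ‖a w v y‖ ≤ ‖T‖} := isClosed_le (by fun_prop) continuous_const
  refine closure_minimal (s := (γ.collisionSet n)ᶜ) (fun y hy => ?_) hcl
    (γ.dense_compl_collisionSet hN n y)
  obtain ⟨f, hf⟩ := exists_unit_vector hy v
  rw [Set.mem_ofPred_eq, hT.eq_of_unit hf]
  refine (norm_apply_le hT' f _).trans ?_
  rw [γ.iterate_word]
  have h1 : γ.fibre n y f = EuclideanSpace.single v 1 := by
    ext u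
    simp [hf]
  rw [h1]
  simp

lemma Represents.star (hN : 2 ≤ N) (hT : γ.Represents n T a) (hT' : T ∈ γ.adjointableAt n)
    (hS : γ.Represents n (star T) b) : b = a.conjTranspose := by
  ext1 w v
  refine eq_of_eqOn_compl_collisionSet (γ := γ) (n := n) hN fun y hy => ?_
  obtain ⟨f, hf⟩ := exists_unit_vector hy v
  obtain ⟨g, hg⟩ := exists_unit_vector hy w
  have h1 := DFunLike.congr_fun (hT' g f) y
  simp only [innerX, ContinuousMap.coe_mk, hf, hg] at h1
  rw [hS.eq_of_unit hf, Matrix.conjTranspose_apply, ContinuousMap.star_apply, hT.eq_of_unit hg]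
  simpa using h1.symm

end BranchedMap

namespace BranchedMap

variable {K : Type u} [MetricSpace K] {N : ℕ} {γ : BranchedMap K N} {n m : ℕ} [CompactSpace K]

/-! ### Matrices of the elements of the finite cores -/

/-- The entries of a rank one operator are `f(γ_w y)` times the conjugate of `g(γ_v y)`, so columns
of colliding words agree. This separates compact operators from operators `T ⊗ I`, whose block
diagonal matrices need not have the property. -/
lemma exists_represents_finiteRank {T : γ.adjointable} (hT : T ∈ γ.finiteRank n) :
    ∃ a, γ.Represents n T a ∧
      ∀ y w v v', γ.word n v y = γ.word n v' y → a w v y = a w v' y := by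
  induction hT using Submodule.span_induction with
  | mem x hx =>
    obtain ⟨f, g, rfl⟩ := hx
    exact ⟨_, represents_rankOne n f g, fun y w v v' h => by simp [h]⟩
  | zero =>
    refine ⟨0, fun f y w => ?_, fun _ _ _ _ _ => rfl⟩
    simp only [Matrix.zero_apply, ContinuousMap.zero_apply, zero_mul, Finset.sum_const_zero]
    rfl
  | add x y _ _ hx hy =>
    obtain ⟨a, ha, ha'⟩ := hx
    obtain ⟨b, hb, hb'⟩ := hy
    exact ⟨_, ha.add hb, fun y w v v' h => by
      simp only [Matrix.add_apply, ContinuousMap.add_apply, ha' y w v v' h, hb' y w v v' h]⟩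
  | smul c x _ hx =>
    obtain ⟨a, ha, ha'⟩ := hx
    exact ⟨_, ha.smul c, fun y w v v' h => by
      simp only [Matrix.smul_apply, ContinuousMap.smul_apply, ha' y w v v' h]⟩

/-- Entries are bounded by the operator norm, so the matrices of an approximating sequence converge
uniformly and the column condition passes to the limit. -/
lemma exists_represents_compacts (hN : 2 ≤ N) {T : γ.adjointable} (hT : T ∈ γ.compacts n) :
    ∃ a, γ.Represents n T a ∧
      ∀ y w v v', γ.word n v y = γ.word n v' y → a w v y = a w v' y := by
  obtain ⟨u, hu, h⟩ := exists_seq_of_mem_compacts hT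
  choose a ha ha' using fun k => exists_represents_finiteRank (hu k)
  have huL := fun k => finiteRank_le_adjointableAt n (hu k)
  have hTL := compacts_le_adjointableAt n hT
  have hc : ∀ w v, ∃ b, Filter.Tendsto (fun k => a k w v) Filter.atTop (𝓝 b) := fun w v => by
    refine cauchySeq_tendsto_of_complete (Metric.cauchySeq_iff.2 fun ε hε => ?_)
    obtain ⟨k₀, hk₀⟩ := Metric.cauchySeq_iff.1 h.cauchySeq ε hε
    refine ⟨k₀, fun k hk l hl => lt_of_le_of_lt ?_ (hk₀ k hk l hl)⟩
    rw [dist_eq_norm, dist_eq_norm, ContinuousMap.norm_le _ (norm_nonneg' _)]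
    exact fun y => ((ha k).sub (ha l)).norm_le hN (sub_mem (huL k) (huL l)) w v y
  choose b hb using hc
  have hb' : ∀ w v y, Filter.Tendsto (fun k => a k w v y) Filter.atTop (𝓝 (b w v y)) :=
    fun w v y => ((continuous_eval_const y).tendsto _).comp (hb w v)
  refine ⟨b, fun f y w => ?_, fun y w v v' hv => ?_⟩
  · refine tendsto_nhds_unique (tendsto_apply huL hTL h f (γ.word n w y)) ?_
    refine Filter.Tendsto.congr (fun k => (ha k f y w).symm) ?_
    exact tendsto_finsetSum _ fun v _ => (hb' w v y).mul_const _
  · refine tendsto_nhds_unique (hb' w v y) ((hb' w v' y).congr fun k => ?_)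
    exact (ha' k y w v v' hv).symm

omit [CompactSpace K] in
lemma Represents.exists_of_le {T : γ.adjointable}
    {a : Matrix (Fin n → Fin N) (Fin n → Fin N) C(K, ℂ)} (ha : γ.Represents n T a) (h : n ≤ m) :
    ∃ b, γ.Represents m T b := by
  induction m, h using Nat.le_induction with
  | base => exact ⟨a, ha⟩
  | succ m _ ih => obtain ⟨b, hb⟩ := ih; exact ⟨_, hb.blockDiag⟩

lemma exists_represents (hN : 2 ≤ N) {T : γ.adjointable} (hT : T ∈ γ.finiteCore n) :
    ∃ a, γ.Represents n T a := by
  let R : Submodule ℂ γ.adjointable :=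
    { carrier := {T | ∃ a, γ.Represents n T a}
      zero_mem' := (exists_represents_finiteRank (zero_mem _)).imp fun a ha => ha.1
      add_mem' := by rintro T S ⟨a, ha⟩ ⟨b, hb⟩; exact ⟨_, ha.add hb⟩
      smul_mem' := by rintro c T ⟨a, ha⟩; exact ⟨_, ha.smul c⟩ }
  have h : γ.finiteCore n ≤ R := iSup₂_le fun k hk S hS => by
    obtain ⟨a, ha, -⟩ := exists_represents_compacts hN hS
    exact ha.exists_of_le hk
  exact h hT

lemma exists_mem_finiteCore (T : γ.unionCore) : ∃ n, (T : γ.adjointable) ∈ γ.finiteCore n :=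
  Set.mem_iUnion.1 T.2

lemma mem_unionCore {T : γ.adjointable} (h : T ∈ γ.finiteCore n) : T ∈ γ.unionCore :=
  Set.mem_iUnion.2 ⟨n, h⟩

/-- A compatible family of linear maps on the matrix algebras over `C(K)` induces a linear map
on `⋃ₙ F^(n)`. -/
lemma exists_linearMap_of_compatible (hN : 2 ≤ N) {V : Type*} [AddCommGroup V] [Module ℂ V] (l : ℕ)
    (L : ∀ k, Matrix (Fin (l + k) → Fin N) (Fin (l + k) → Fin N) C(K, ℂ) →ₗ[ℂ] V)
    (hL : ∀ k a, L (k + 1) (γ.blockDiag (l + k) a) = L k a) :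
    ∃ Φ : γ.unionCore →ₗ[ℂ] V, ∀ k (T : γ.unionCore) a, γ.Represents (l + k) T a →
      Φ T = L k a := by
  have h1 : ∀ (T : γ.unionCore) k a, γ.Represents (l + k) T a → ∀ m ≥ k,
      ∃ b, γ.Represents (l + m) T b ∧ L m b = L k a := fun T k a ha m hm => by
    induction m, hm using Nat.le_induction with
    | base => exact ⟨a, ha, rfl⟩
    | succ m _ ih =>
      obtain ⟨b, hb, h⟩ := ih
      exact ⟨_, hb.blockDiag, (hL m b).trans h⟩
  have h2 : ∀ (T : γ.unionCore) k a k' a', γ.Represents (l + k) T a →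
      γ.Represents (l + k') T a' → L k a = L k' a' := fun T k a k' a' ha ha' => by
    obtain ⟨b, hb, h⟩ := h1 T k a ha _ (le_max_left k k')
    obtain ⟨b', hb', h'⟩ := h1 T k' a' ha' _ (le_max_right k k')
    rw [← h, ← h', hb.unique hN hb']
  have h3 : ∀ T : γ.unionCore, ∃ k a, γ.Represents (l + k) T a := fun T => by
    obtain ⟨n, hn⟩ := exists_mem_finiteCore T
    exact ⟨n, exists_represents hN (finiteCore_mono (Nat.le_add_left n l) hn)⟩
  choose k a ha using h3
  refine ⟨{ toFun := fun T => L (k T) (a T), map_add' := fun T S => ?_, map_smul' := fun c T => ?_ },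
    fun k' T a' ha' => h2 T _ _ _ _ (ha T) ha'⟩
  · obtain ⟨b, hb, h⟩ := h1 T _ _ (ha T) _ (le_max_left (k T) (k S))
    obtain ⟨b', hb', h'⟩ := h1 S _ _ (ha S) _ (le_max_right (k T) (k S))
    rw [← h, ← h', ← map_add]
    exact h2 (T + S) _ _ _ _ (ha _) (hb.add hb')
  · rw [RingHom.id_apply, ← map_smul]
    exact h2 (c • T) _ _ _ _ (ha _) ((ha T).smul c)

/-! ### Multiplication operators and rank one operators -/

variable (γ) in
/-- Multiplication by a continuous function, as an element of `K(X^{⊗ 0})`. -/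
noncomputable def mulOp (b : C(K, ℂ)) : γ.adjointable := γ.rankOne 0 b 1

@[simp] lemma mulOp_apply (b f : C(K, ℂ)) : (γ.mulOp b).1 f = b * f := by
  ext x
  change b x * ∑ w : Fin 0 → Fin N, star (1 : ℂ) * f x = _
  simp

lemma rankOne_apply (n : ℕ) (f g ξ : C(K, ℂ)) :
    (γ.rankOne n f g).1 ξ = γ.rsmul n f (γ.innerX n g ξ) := rfl

omit [CompactSpace K] in
lemma adjointable_ext {T S : γ.adjointable} (h : ∀ f x, T.1 f x = S.1 f x) : T = S :=
  Subtype.ext (Op.ext fun f => ContinuousMap.ext (h f))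

omit [CompactSpace K] in
lemma innerX_rsmul_left (n : ℕ) (f g b : C(K, ℂ)) (y : K) :
    γ.innerX n (γ.rsmul n f b) g y = star (b y) * γ.innerX n f g y := by
  rw [innerX_apply, innerX_apply, fibre_rsmul, inner_smul_left]
  rfl

omit [CompactSpace K] in
lemma innerX_rsmul_right (n : ℕ) (f g b : C(K, ℂ)) (y : K) :
    γ.innerX n f (γ.rsmul n g b) y = b y * γ.innerX n f g y := by
  rw [innerX_apply, innerX_apply, fibre_rsmul, inner_smul_right]

lemma mul_rankOne' {T : γ.adjointable} (hT : T ∈ γ.adjointableAt n) (f g : C(K, ℂ)) :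
    T * γ.rankOne n f g = γ.rankOne n (T.1 f) g := mul_rankOne hT f g

lemma rankOne_mem_adjointableAt (n : ℕ) (f g : C(K, ℂ)) : γ.rankOne n f g ∈ γ.adjointableAt n :=
  adjointableAt_of_isAdjoint (isAdjoint_theta n f g)

lemma rankOne_mul_rankOne (n : ℕ) (f g f' g' : C(K, ℂ)) :
    γ.rankOne n f g * γ.rankOne n f' g' = γ.rankOne n (γ.rsmul n f (γ.innerX n g f')) g' :=
  mul_rankOne' (rankOne_mem_adjointableAt n f g) f' g'

lemma rankOne_rsmul_right (n : ℕ) (f g b : C(K, ℂ)) :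
    γ.rankOne n f (γ.rsmul n g b) = γ.rankOne n (γ.rsmul n f (star b)) g :=
  adjointable_ext fun ξ x => by
    simp only [rankOne_apply, rsmul_apply, innerX_rsmul_left, ContinuousMap.star_apply, mul_assoc]

lemma rankOne_add_left (n : ℕ) (f f' g : C(K, ℂ)) :
    γ.rankOne n (f + f') g = γ.rankOne n f g + γ.rankOne n f' g :=
  adjointable_ext fun ξ x => by
    change (f + f') x * _ = f x * _ + f' x * _
    rw [ContinuousMap.add_apply, add_mul]

lemma rankOne_smul_left (n : ℕ) (c : ℂ) (f g : C(K, ℂ)) :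
    γ.rankOne n (c • f) g = c • γ.rankOne n f g :=
  adjointable_ext fun ξ x => by
    change (c • f) x * _ = c * (f x * _)
    rw [ContinuousMap.smul_apply, smul_eq_mul, mul_assoc]

/-- Composition with `h^n`. -/
noncomputable def compIterate (n : ℕ) (γ : BranchedMap K N) (b : C(K, ℂ)) : C(K, ℂ) :=
  b.comp ⟨γ.h^[n], γ.h.continuous.iterate n⟩

omit [CompactSpace K] in
@[simp] lemma compIterate_apply (n : ℕ) (b : C(K, ℂ)) (x : K) :
    compIterate n γ b x = b (γ.h^[n] x) := rfl

lemma rankOne_mul_mulOp (n : ℕ) (f g b : C(K, ℂ)) :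
    γ.rankOne n f g * γ.mulOp (compIterate n γ b) = γ.rankOne n (γ.rsmul n f b) g :=
  adjointable_ext fun ξ x => by
    change γ.rsmul n f (γ.innerX n g ((γ.mulOp (compIterate n γ b)).1 ξ)) x = _
    have h : compIterate n γ b * ξ = γ.rsmul n ξ b := mul_comm _ _
    rw [mulOp_apply, h, rsmul_apply, innerX_rsmul_right, rankOne_apply, rsmul_apply, rsmul_apply,
      mul_assoc]

/-- Away from the branch set, multiplication operators on `X` are compact. -/
lemma rankOne_rsmul_mem_finiteRank_succ (n : ℕ) (f g : C(K, ℂ)) {c : C(K, ℝ)} (hc : ∀ x, 0 ≤ c x)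
    (hcB : ∀ b ∈ γ.branchSet, c b = 0) :
    γ.rankOne n (γ.rsmul n f c.ofRealC) g ∈ γ.finiteRank (n + 1) := by
  classical
  -- `u j` is `√c` on the branch `γ_j(K)` and 0 elsewhere, which is continuous because `c` vanishes
  -- where branches meet. Multiplication by `c` on `X` is then the sum of the operators
  -- `θ_{u_j,u_j}`.
  let u : Fin N → C(K, ℂ) := fun j => ⟨fun x => if γ.map j (γ.h x) = x then (√(c x) : ℂ) else 0,
    continuous_ite_fixed (σ := fun j x => γ.map j (γ.h x))
      (fun j => (γ.continuous_map j).comp γ.h.continuous) (fun x => exists_map_h x)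
      (c := fun x => (√(c x) : ℂ)) (by fun_prop)
      (fun x i j hij hi hj => by rw [hcB x (mem_branchSet_iff.2 ⟨i, j, hij, hi, hj⟩)]; simp) j⟩
  have hu : ∀ j x, u j x = if γ.map j (γ.h x) = x then (√(c x) : ℂ) else 0 := fun _ _ => rfl
  have key : ∀ (F : K → ℂ) (z : K),
      ∑ j, u j z * ∑ k, star (u j (γ.map k (γ.h z))) * F (γ.map k (γ.h z)) = c z * F z := by
    intro F z
    by_cases hz : c z = 0
    · simp [hu, hz]
    obtain ⟨j, hj⟩ := exists_map_h (γ := γ) z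
    have huniq : ∀ k, γ.map k (γ.h z) = z → k = j := fun k hk => by
      by_contra hkj
      exact hz (hcB z (mem_branchSet_iff.2 ⟨k, j, hkj, hk, hj⟩))
    rw [Finset.sum_eq_single j, Finset.sum_eq_single j]
    · rw [hj, hu, if_pos hj, Complex.star_def, Complex.conj_ofReal, ← mul_assoc,
        ← Complex.ofReal_mul, Real.mul_self_sqrt (hc z)]
    · intro k _ hk
      rw [hu, γ.h_map, hj, if_neg (fun h => hk (huniq k h.symm)), star_zero, zero_mul]
    · simp
    · intro k _ hk
      rw [hu, if_neg (fun h => hk (huniq k h)), zero_mul]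
    · simp
  have h1 : γ.rankOne n (γ.rsmul n f c.ofRealC) g =
      ∑ j, γ.rankOne (n + 1) (γ.rsmul n f (u j)) (γ.rsmul n g (u j)) := by
    refine adjointable_ext fun ξ x => ?_
    have hsum : ∀ (F : Fin N → γ.adjointable), (∑ j, F j).1 ξ x = ∑ j, (F j).1 ξ x := fun F => by
      induction (Finset.univ : Finset (Fin N)) using Finset.induction_on with
      | empty => rfl
      | insert i s his ih =>
        rw [Finset.sum_insert his, Finset.sum_insert his, ← ih]
        rfl
    rw [hsum, rankOne_apply, rsmul_apply, rsmul_apply]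
    have h2 := key (fun z => γ.innerX n g ξ z) (γ.h^[n] x)
    simp only [ContinuousMap.ofRealC_apply]
    rw [mul_assoc, ← h2, Finset.mul_sum]
    refine Finset.sum_congr rfl fun j _ => ?_
    rw [rankOne_apply, rsmul_apply, rsmul_apply, innerX_succ, Function.iterate_succ_apply',
      mul_assoc]
    simp only [innerX_rsmul_left]
  rw [h1]
  exact sum_mem fun j _ => rankOne_mem_finiteRank _ _ _

lemma mul_mulOp_mem_compacts_succ {T : γ.adjointable} (hT : T ∈ γ.compacts n) {c : C(K, ℝ)}
    (hc : ∀ x, 0 ≤ c x) (hcB : ∀ b ∈ γ.branchSet, c b = 0) :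
    T * γ.mulOp (compIterate n γ c.ofRealC) ∈ γ.compacts (n + 1) := by
  refine map_mem_closure (f := fun S => S * γ.mulOp (compIterate n γ c.ofRealC))
    (continuous_mul_const _) hT fun R hR => ?_
  change R * _ ∈ γ.finiteRank (n + 1)
  induction hR using Submodule.span_induction with
  | mem x hx =>
    obtain ⟨f, g, rfl⟩ := hx
    rw [rankOne_mul_mulOp]
    exact rankOne_rsmul_mem_finiteRank_succ n f g hc hcB
  | zero => rw [zero_mul]; exact zero_mem _
  | add x y _ _ hx hy => rw [add_mul]; exact add_mem hx hy
  | smul c x _ hx => rw [smul_mul_assoc]; exact Submodule.smul_mem _ c hx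

lemma norm_le_sum_norm {ι : Type*} [Fintype ι] (x : EuclideanSpace ℂ ι) : ‖x‖ ≤ ∑ i, ‖x i‖ := by
  classical
  have h : x = ∑ i, EuclideanSpace.single i (x i) := by
    ext j
    simp [Finset.sum_apply]
  calc ‖x‖ = ‖∑ i, EuclideanSpace.single i (x i)‖ := by rw [← h]
    _ ≤ ∑ i, ‖EuclideanSpace.single i (x i)‖ := norm_sum_le _ _
    _ = _ := by simp

omit [CompactSpace K] in
lemma Represents.norm_fibre_le {T : γ.adjointable}
    {a : Matrix (Fin n → Fin N) (Fin n → Fin N) C(K, ℂ)} (ha : γ.Represents n T a) {y : K} {ε : ℝ}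
    (h : ∀ w v, ‖a w v y‖ ≤ ε) (f : C(K, ℂ)) :
    ‖γ.fibre n y (T.1 f)‖ ≤ (N : ℝ) ^ n * (N : ℝ) ^ n * ε * ‖γ.fibre n y f‖ := by
  refine (norm_le_sum_norm _).trans ?_
  have h1 : ∀ w, ‖γ.fibre n y (T.1 f) w‖ ≤ (N : ℝ) ^ n * (ε * ‖γ.fibre n y f‖) := fun w => by
    rw [fibre_apply, ha]
    refine (norm_sum_le _ _).trans ?_
    calc _ ≤ ∑ v : Fin n → Fin N, ε * ‖γ.fibre n y f‖ := Finset.sum_le_sum fun v _ => by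
          rw [norm_mul]
          refine mul_le_mul (h w v) (PiLp.norm_apply_le (γ.fibre n y f) v) (norm_nonneg _) ?_
          exact (norm_nonneg _).trans (h w v)
      _ = _ := by simp
  calc _ ≤ ∑ w : Fin n → Fin N, (N : ℝ) ^ n * (ε * ‖γ.fibre n y f‖) :=
        Finset.sum_le_sum fun w _ => h1 w
    _ = _ := by simp; ring

/-- A compact operator of `X^{⊗ n}` whose matrix vanishes on the branch set is a compact operator
of `X^{⊗ (n + 1)}`. -/
lemma mem_compacts_succ_of_vanish {T : γ.adjointable} (hT : T ∈ γ.compacts n)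
    {a : Matrix (Fin n → Fin N) (Fin n → Fin N) C(K, ℂ)} (ha : γ.Represents n T a)
    (h0 : ∀ b ∈ γ.branchSet, ∀ w v, a w v b = 0) : T ∈ γ.compacts (n + 1) := by
  refine (Submodule.isClosed_topologicalClosure (γ.finiteRank (n + 1))).closure_subset ?_
  refine Metric.mem_closure_iff.2 fun ε hε => ?_
  -- Chosen so that the crude bound of the operator norm by `N^(2n)` times the largest entry stays
  -- below `ε`.
  set δ : ℝ := ε / (2 * ((N : ℝ) ^ n * (N : ℝ) ^ n + 1)) with hδ
  have hδ0 : 0 < δ := by positivity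
  have hV : IsOpen {y | ∀ w v, ‖a w v y‖ < δ} := by
    simp only [Set.ofPred_forall]
    exact isOpen_iInter_of_finite fun w => isOpen_iInter_of_finite fun v =>
      isOpen_lt (by fun_prop) continuous_const
  obtain ⟨c, hc0, hc1, hc⟩ := exists_continuous_zero_one_of_isClosed
    γ.finite_branchSet.isClosed hV.isClosed_compl
    (Set.disjoint_compl_right_iff_subset.2 fun b hb w v => by rw [h0 b hb]; simpa using hδ0)
  -- `c` vanishes on `B_γ`, so this product is compact of level `n + 1`. It is close to `T`, because
  -- `1 - c` is supported where all entries of the matrix are below `δ`.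
  refine ⟨T * γ.mulOp (compIterate n γ c.ofRealC),
    mul_mulOp_mem_compacts_succ hT (fun x => (hc x).1) (fun b hb => hc0 hb), ?_⟩
  have hTL := compacts_le_adjointableAt n hT
  have hb : γ.IsBound n (T - T * γ.mulOp (compIterate n γ c.ofRealC) : γ.adjointable).1
      ((N : ℝ) ^ n * (N : ℝ) ^ n * δ) := by
    refine ⟨by positivity, fun f y => ?_⟩
    have h1 : (T - T * γ.mulOp (compIterate n γ c.ofRealC) : γ.adjointable).1 f =
        γ.rsmul n (T.1 f) (1 - c.ofRealC) := by
      change T.1 f - T.1 ((γ.mulOp (compIterate n γ c.ofRealC)).1 f) = _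
      have h : compIterate n γ c.ofRealC * f = γ.rsmul n f c.ofRealC := mul_comm _ _
      rw [mulOp_apply, h, IsAdjoint.map_rsmul hTL]
      ext x
      simp only [ContinuousMap.sub_apply, rsmul_apply, ContinuousMap.one_apply]
      ring
    rw [h1, fibre_rsmul, norm_smul]
    by_cases hy : ∀ w v, ‖a w v y‖ < δ
    · have h2 : ‖(1 - c.ofRealC : C(K, ℂ)) y‖ ≤ 1 := by
        have h3 : (1 - c.ofRealC : C(K, ℂ)) y = ((1 - c y : ℝ) : ℂ) := by simp
        rw [h3, Complex.norm_real, Real.norm_eq_abs, abs_le]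
        constructor <;> linarith [(hc y).1, (hc y).2]
      calc _ ≤ 1 * ‖γ.fibre n y (T.1 f)‖ := by gcongr
        _ ≤ _ := by rw [one_mul]; exact ha.norm_fibre_le (fun w v => (hy w v).le) f
    · have h2 : (1 - c.ofRealC : C(K, ℂ)) y = 0 := by
        simp [hc1 (show y ∈ {y | ∀ w v, ‖a w v y‖ < δ}ᶜ from hy)]
      rw [h2, norm_zero, zero_mul]
      positivity
  rw [dist_eq_norm]
  refine (norm_le hb).trans_lt ?_
  rw [hδ, mul_div_assoc', div_lt_iff₀ (by positivity)]
  nlinarith [show (0 : ℝ) ≤ (N : ℝ) ^ n * (N : ℝ) ^ n by positivity]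

end BranchedMap

namespace BranchedMap

variable {K : Type u} [MetricSpace K] {N : ℕ} {γ : BranchedMap K N} {n m : ℕ} [CompactSpace K]

/-! ### Representations which do not annihilate the compact operators are isometric -/

variable (γ) in
/-- A rank one operator as an element of the union of the finite cores. -/
noncomputable def unionRankOne (n : ℕ) (f g : C(K, ℂ)) : γ.unionCore :=
  ⟨γ.rankOne n f g, mem_unionCore (compacts_le le_rfl (rankOne_mem_compacts n f g))⟩

omit [CompactSpace K] in
lemma continuous_fibre (n : ℕ) (f : C(K, ℂ)) : Continuous fun y => γ.fibre n y f :=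
  (PiLp.continuous_toLp 2 _).comp
    (continuous_pi fun w => f.continuous.comp (γ.continuous_word n w))

omit [CompactSpace K] in
lemma innerX_self_apply (n : ℕ) (f : C(K, ℂ)) (y : K) :
    γ.innerX n f f y = ((‖γ.fibre n y f‖ ^ 2 : ℝ) : ℂ) := by
  rw [innerX_apply, inner_self_eq_norm_sq_to_K]
  simp

omit [CompactSpace K] in
lemma norm_fibre_le_of_le {c : ℝ} {f g : C(K, ℂ)} (hc : 0 ≤ c)
    (h : ∀ y, c * ‖γ.fibre n y f‖ ≤ ‖γ.fibre n y g‖) (hnm : n ≤ m) (y : K) :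
    c * ‖γ.fibre m y f‖ ≤ ‖γ.fibre m y g‖ := by
  induction m, hnm using Nat.le_induction generalizing y with
  | base => exact h y
  | succ m _ ih =>
    refine le_of_sq_le_sq ?_ (norm_nonneg _)
    rw [mul_pow, norm_fibre_succ, norm_fibre_succ, Finset.mul_sum]
    refine Finset.sum_le_sum fun j _ => ?_
    rw [← mul_pow]
    exact pow_le_pow_left₀ (mul_nonneg hc (norm_nonneg _)) (ih _) 2

variable (γ) in
/-- A function that is not zero has nonzero restrictions to all fibres of `h^m` for large `m`. -/
lemma exists_forall_fibre_ne_zero {f : C(K, ℂ)} (hf : f ≠ 0) :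
    ∃ m₀, ∀ m ≥ m₀, ∀ y, γ.fibre m y f ≠ 0 := by
  obtain ⟨x, hx⟩ : ∃ x, f x ≠ 0 := by
    by_contra! h
    exact hf (ContinuousMap.ext h)
  obtain ⟨ε, hε, hball⟩ := Metric.isOpen_iff.1 (isOpen_ne_fun f.continuous continuous_const) x hx
  obtain ⟨m₀, hm₀⟩ := γ.exists_dist_word_lt hε
  refine ⟨m₀, fun m hm y h => ?_⟩
  obtain ⟨w, z, hz⟩ := γ.exists_word m x
  have h1 : γ.word m w y ∈ Metric.ball x ε := by
    rw [Metric.mem_ball, ← hz]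
    exact hm₀ m hm w y z
  refine hball h1 ?_
  rw [← fibre_apply, h]
  rfl

/-- For `T` in the union of the finite cores and `c < ‖T‖`, there are unit vectors `e` of
`X^{⊗ m}`, for all large `m`, such that `(T e | T e)_m ≥ c²`. -/
lemma exists_unit_vector_le (T : γ.unionCore) {c : ℝ} (hc0 : 0 ≤ c)
    (hc : c < ‖(T : γ.adjointable)‖) : ∃ m₀, ∀ m ≥ m₀, (T : γ.adjointable) ∈ γ.adjointableAt m ∧
      ∃ e : C(K, ℂ), γ.innerX m e e = 1 ∧ ∀ y, c ≤ ‖γ.fibre m y (T.1.1 e)‖ := by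
  obtain ⟨n, hn⟩ := exists_mem_finiteCore T
  have hT := finiteCore_le_adjointableAt n hn
  have h1 : ¬ γ.IsBound n T.1.1 c := fun h => (norm_le h).not_gt hc
  obtain ⟨f, y₀, hfy⟩ : ∃ f y, c * ‖γ.fibre n y f‖ < ‖γ.fibre n y (T.1.1 f)‖ := by
    by_contra! h
    exact h1 ⟨hc0, h⟩
  have hV : IsOpen {y | c * ‖γ.fibre n y f‖ < ‖γ.fibre n y (T.1.1 f)‖} :=
    isOpen_lt (continuous_const.mul (continuous_fibre n f).norm) (continuous_fibre n _).norm
  -- Cutting `f` off by a function of `h^n` supported where the strict inequality holds yields the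
  -- weak inequality in every fibre, while the value `b y₀ = 1` keeps the function nonzero.
  obtain ⟨b, hb1, hb0, -⟩ := exists_bump hV.isClosed_compl (x := y₀) (by simpa using hfy)
  set f' := γ.rsmul n f b.ofRealC with hf'
  have hTf' : T.1.1 f' = γ.rsmul n (T.1.1 f) b.ofRealC := IsAdjoint.map_rsmul hT _ _
  have h2 : ∀ y, c * ‖γ.fibre n y f'‖ ≤ ‖γ.fibre n y (T.1.1 f')‖ := fun y => by
    rw [hTf', hf', fibre_rsmul, fibre_rsmul, norm_smul, norm_smul]
    by_cases hy : c * ‖γ.fibre n y f‖ < ‖γ.fibre n y (T.1.1 f)‖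
    · rw [mul_left_comm]
      exact mul_le_mul_of_nonneg_left hy.le (norm_nonneg _)
    · have : b y = 0 := hb0 y hy
      simp [this]
  have hf'0 : f' ≠ 0 := fun h => by
    have h3 : γ.fibre n y₀ f = 0 := by
      have h4 : γ.fibre n y₀ f' = γ.fibre n y₀ f := by
        rw [hf', fibre_rsmul, ContinuousMap.ofRealC_apply, hb1]
        simp
      rw [← h4, h, map_zero]
    have h5 := (isBound_norm hT).2 f y₀
    rw [h3, norm_zero, mul_zero] at h5
    rw [h3, norm_zero, mul_zero] at hfy
    exact absurd hfy (not_lt.2 h5)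
  obtain ⟨m₀, hm₀⟩ := γ.exists_forall_fibre_ne_zero hf'0
  refine ⟨max n m₀, fun m hm => ?_⟩
  have hTm := adjointableAt_mono ((le_max_left _ _).trans hm) hT
  refine ⟨hTm, ?_⟩
  have hpos : ∀ y, 0 < ‖γ.fibre m y f'‖ := fun y =>
    norm_pos_iff.2 (hm₀ m ((le_max_right _ _).trans hm) y)
  -- For large `m` no fibre of `f'` vanishes, so it can be normalised by a function of `h^m`.
  let q : C(K, ℝ) := ⟨fun y => ‖γ.fibre m y f'‖⁻¹,
    (continuous_fibre m f').norm.inv₀ fun y => (hpos y).ne'⟩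
  have hq : ∀ y, q y = ‖γ.fibre m y f'‖⁻¹ := fun _ => rfl
  refine ⟨γ.rsmul m f' q.ofRealC, ?_, fun y => ?_⟩
  · ext y
    rw [innerX_self_apply, fibre_rsmul, norm_smul, ContinuousMap.ofRealC_apply, hq,
      Complex.norm_real, Real.norm_of_nonneg (inv_nonneg.2 (hpos y).le),
      inv_mul_cancel₀ (hpos y).ne']
    simp
  · rw [IsAdjoint.map_rsmul hTm, fibre_rsmul, norm_smul, ContinuousMap.ofRealC_apply, hq,
      Complex.norm_real, Real.norm_of_nonneg (inv_nonneg.2 (hpos y).le), inv_mul_eq_div,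
      le_div_iff₀ (hpos y)]
    exact norm_fibre_le_of_le hc0 h2 ((le_max_left _ _).trans hm) y

section Representation

variable {A : Type*} [Semiring A] [StarRing A] [Algebra ℂ A] {H : Type*} [NormedAddCommGroup H]
    [InnerProductSpace ℂ H] [CompleteSpace H] (π : A →⋆ₐ[ℂ] (H →L[ℂ] H))

lemma inner_map_self (a : A) (v w : H) : ⟪π a v, w⟫_ℂ = ⟪v, π (star a) w⟫_ℂ := by
  rw [map_star, ContinuousLinearMap.star_eq_adjoint, ContinuousLinearMap.adjoint_inner_right]

lemma norm_map_sq (a : A) (v : H) : ((‖π a v‖ ^ 2 : ℝ) : ℂ) = ⟪v, π (star a * a) v⟫_ℂ := by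
  rw [map_mul, mul_apply_eq_comp, ← inner_map_self, inner_self_eq_norm_sq_to_K]
  simp

lemma norm_map_sq_of_eq {r p q : A} {c : ℝ}
    (h : star r * r = (c : ℂ) • (star p * p) + star q * q) (v : H) :
    ‖π r v‖ ^ 2 = c * ‖π p v‖ ^ 2 + ‖π q v‖ ^ 2 := by
  have h1 : ((‖π r v‖ ^ 2 : ℝ) : ℂ) = c * ((‖π p v‖ ^ 2 : ℝ) : ℂ) + ((‖π q v‖ ^ 2 : ℝ) : ℂ) := by
    rw [norm_map_sq, norm_map_sq, norm_map_sq, h, map_add, map_smul]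
    simp
  exact_mod_cast h1

end Representation

lemma norm_rep_le {A : Type*} [CStarAlgebra A] {H : Type*} [NormedAddCommGroup H]
    [InnerProductSpace ℂ H] [CompleteSpace H] (π : A →⋆ₐ[ℂ] (H →L[ℂ] H)) (a : A) : ‖π a‖ ≤ ‖a‖ :=
  NonUnitalStarAlgHom.norm_apply_le π a

variable (γ) in
/-- The inclusion of the union of the finite cores into the core, as a function. -/
noncomputable def incl (T : γ.unionCore) : γ.Core := toCore (γ := γ) T

lemma incl_add (T S : γ.unionCore) : γ.incl (T + S) = γ.incl T + γ.incl S :=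
  map_add (toCore (γ := γ)) T S

lemma incl_sub (T S : γ.unionCore) : γ.incl (T - S) = γ.incl T - γ.incl S :=
  map_sub (toCore (γ := γ)) T S

lemma incl_mul (T S : γ.unionCore) : γ.incl (T * S) = γ.incl T * γ.incl S :=
  map_mul (toCore (γ := γ)) T S

lemma incl_smul (c : ℂ) (T : γ.unionCore) : γ.incl (c • T) = c • γ.incl T :=
  map_smul (toCore (γ := γ)) c T

lemma incl_star (T : γ.unionCore) : γ.incl (star T) = star (γ.incl T) :=
  map_star (toCore (γ := γ)) T

lemma incl_zero : γ.incl 0 = 0 := map_zero (toCore (γ := γ))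

lemma incl_one : γ.incl 1 = 1 := map_one (toCore (γ := γ))

lemma norm_incl (T : γ.unionCore) : ‖γ.incl T‖ = ‖(T : γ.adjointable)‖ := norm_toCore T

lemma denseRange_incl : DenseRange γ.incl := denseRange_toCore

variable {H : Type v} [NormedAddCommGroup H] [InnerProductSpace ℂ H] [CompleteSpace H]

/-- The representations that do not annihilate `K(X^{⊗ m})`, for `m` large, almost attain the
norm of an element of the union of the finite cores. -/
lemma le_norm_of_rankOne_ne_zero {T : γ.unionCore} {c : ℝ} (hc0 : 0 ≤ c)
    (hT : (T : γ.adjointable) ∈ γ.adjointableAt m) {e : C(K, ℂ)} (he : γ.innerX m e e = 1)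
    (hce : ∀ y, c ≤ ‖γ.fibre m y (T.1.1 e)‖) (π : γ.unionCore →⋆ₐ[ℂ] (H →L[ℂ] H))
    (hπ : ∃ f g, π (γ.unionRankOne m f g) ≠ 0) : c ≤ ‖π T‖ := by
  obtain ⟨f, ξ, hfξ⟩ := hπ
  -- The nonnegative function `(Te | Te) - c²` is written as `d²`. With `η = ξ · d` this gives
  -- `θ_{Te,ξ}* θ_{Te,ξ} = c² θ_{e,ξ}* θ_{e,ξ} + θ_{e,η}* θ_{e,η}`, and hence a lower bound of `π T`
  -- on the range of `π θ_{e,ξ}`.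
  let d : C(K, ℝ) := ⟨fun y => √(‖γ.fibre m y (T.1.1 e)‖ ^ 2 - c ^ 2),
    (((continuous_fibre m _).norm.pow 2).sub continuous_const).sqrt⟩
  have hd : ∀ y, d y * d y = ‖γ.fibre m y (T.1.1 e)‖ ^ 2 - c ^ 2 := fun y =>
    Real.mul_self_sqrt (sub_nonneg.2 (pow_le_pow_left₀ hc0 (hce y) 2))
  set η := γ.rsmul m ξ d.ofRealC with hη
  have h1 : γ.rankOne m f ξ = γ.rankOne m f e * γ.rankOne m e ξ := by
    rw [rankOne_mul_rankOne, he]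
    congr 1
    ext x
    simp [rsmul_apply]
  have h2 : star (γ.rankOne m (T.1.1 e) ξ) * γ.rankOne m (T.1.1 e) ξ =
      ((c ^ 2 : ℝ) : ℂ) • (star (γ.rankOne m e ξ) * γ.rankOne m e ξ) +
        star (γ.rankOne m e η) * γ.rankOne m e η := by
    simp only [star_rankOne, rankOne_mul_rankOne, he]
    rw [hη, rankOne_rsmul_right, ← rankOne_smul_left, ← rankOne_add_left]
    congr 1
    ext x
    simp only [rsmul_apply, ContinuousMap.add_apply, ContinuousMap.smul_apply, smul_eq_mul,
      ContinuousMap.one_apply, ContinuousMap.star_apply, ContinuousMap.ofRealC_apply, mul_one,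
      innerX_self_apply, Complex.star_def, Complex.conj_ofReal]
    have h3 := congrArg (fun r : ℝ => (r : ℂ)) (hd (γ.h^[m] x))
    push_cast at h3 ⊢
    rw [mul_assoc (ξ x), h3]
    ring
  have h3 : π (γ.unionRankOne m e ξ) ≠ 0 := fun h => by
    refine hfξ ?_
    rw [show γ.unionRankOne m f ξ = γ.unionRankOne m f e * γ.unionRankOne m e ξ from
      Subtype.ext h1, map_mul, h, mul_zero]
  obtain ⟨v, hv⟩ : ∃ v, π (γ.unionRankOne m e ξ) v ≠ 0 := by
    by_contra! h
    exact h3 (ContinuousLinearMap.ext h)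
  set w := π (γ.unionRankOne m e ξ) v with hw
  have h4 : π T w = π (γ.unionRankOne m (T.1.1 e) ξ) v := by
    rw [hw, ← mul_apply_eq_comp, ← map_mul]
    congr 2
    exact Subtype.ext (mul_rankOne' hT e ξ)
  have h5 : ‖π T w‖ ^ 2 = c ^ 2 * ‖w‖ ^ 2 + ‖π (γ.unionRankOne m e η) v‖ ^ 2 := by
    rw [h4, hw]
    have h6 : star (γ.unionRankOne m (T.1.1 e) ξ) * γ.unionRankOne m (T.1.1 e) ξ =
        ((c ^ 2 : ℝ) : ℂ) • (star (γ.unionRankOne m e ξ) * γ.unionRankOne m e ξ) +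
          star (γ.unionRankOne m e η) * γ.unionRankOne m e η := Subtype.ext h2
    exact norm_map_sq_of_eq π h6 v
  have h6 : (c * ‖w‖) ^ 2 ≤ (‖π T‖ * ‖w‖) ^ 2 := by
    calc (c * ‖w‖) ^ 2 ≤ ‖π T w‖ ^ 2 := by
          rw [h5, mul_pow]; exact le_add_of_nonneg_right (sq_nonneg _)
      _ ≤ _ := pow_le_pow_left₀ (norm_nonneg _) (ContinuousLinearMap.le_opNorm _ _) 2
  have h7 := le_of_sq_le_sq h6 (by positivity)
  exact le_of_mul_le_mul_right h7 (norm_pos_iff.2 hv)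

lemma le_norm_sub_of_map_eq_zero {x : γ.Core} {T : γ.unionCore} {c : ℝ} (hc0 : 0 ≤ c)
    (hT : (T : γ.adjointable) ∈ γ.adjointableAt m) {e : C(K, ℂ)} (he : γ.innerX m e e = 1)
    (hce : ∀ y, c ≤ ‖γ.fibre m y (T.1.1 e)‖) (π : γ.Core →⋆ₐ[ℂ] (H →L[ℂ] H))
    (hπ : ∃ f g, π (γ.incl (γ.unionRankOne m f g)) ≠ 0) (hx : π x = 0) :
    c ≤ ‖x - γ.incl T‖ := by
  have h2 : c ≤ ‖(π.comp (toCore (γ := γ))) T‖ :=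
    le_norm_of_rankOne_ne_zero hc0 hT he hce (π.comp (toCore (γ := γ))) hπ
  have h3 : ‖π (x - γ.incl T)‖ ≤ ‖x - γ.incl T‖ := norm_rep_le π _
  have h4 : π (x - γ.incl T) = -π (γ.incl T) := by
    rw [map_sub π x (γ.incl T), hx, zero_sub]
  rw [h4, norm_neg] at h3
  exact h2.trans h3

/-- An element of the core that is annihilated by representations not annihilating `K(X^{⊗ m})`,
for infinitely many `m`, vanishes. -/
theorem eq_zero_of_frequently {x : γ.Core} (hx : ∀ m₀, ∃ m ≥ m₀, ∃ (H : Type v)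
    (_ : NormedAddCommGroup H) (_ : InnerProductSpace ℂ H) (_ : CompleteSpace H)
    (π : γ.Core →⋆ₐ[ℂ] (H →L[ℂ] H)),
    (∃ f g, π (γ.incl (γ.unionRankOne m f g)) ≠ 0) ∧ π x = 0) : x = 0 := by
  rw [← norm_le_zero_iff]
  refine le_of_forall_pos_le_add fun ε hε => ?_
  obtain ⟨T, hT⟩ := denseRange_incl.exists_dist_lt x (half_pos hε)
  rw [dist_eq_norm] at hT
  have h1 : ‖(T : γ.adjointable)‖ ≤ ε / 2 := by
    by_contra! h
    -- The constant is the midpoint of `‖x - T‖` and `ε / 2`. It lies strictly above the first and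
    -- below `‖T‖`, so it cannot be a lower bound of `‖x - T‖`.
    obtain ⟨m₀, hm₀⟩ := exists_unit_vector_le T (c := (‖x - γ.incl T‖ + ε / 2) / 2)
      (by positivity) (by linarith)
    obtain ⟨m, hm, H, _, _, _, π, hπ, hπx⟩ := hx m₀
    obtain ⟨hTm, e, he, hce⟩ := hm₀ m hm
    have h2 := le_norm_sub_of_map_eq_zero (by positivity) hTm he hce π hπ hπx
    linarith
  calc ‖x‖ = ‖(x - γ.incl T) + γ.incl T‖ := by rw [sub_add_cancel]
    _ ≤ ‖x - γ.incl T‖ + ‖γ.incl T‖ := norm_add_le _ _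
    _ ≤ 0 + ε := by rw [norm_incl]; linarith

/-! ### Extension of linear maps to the core -/

/-- A bounded linear map on the union of the finite cores extends to the core. -/
lemma exists_extension {V : Type*} [NormedAddCommGroup V] [NormedSpace ℂ V] [CompleteSpace V]
    (φ : γ.unionCore →ₗ[ℂ] V) {C : ℝ} (hC : ∀ T : γ.unionCore, ‖φ T‖ ≤ C * ‖(T : γ.adjointable)‖) :
    ∃ Φ : γ.Core →L[ℂ] V, ∀ T, Φ (γ.incl T) = φ T := by
  let e : γ.unionCore →ₗ[ℂ] γ.Core := { toFun := γ.incl, map_add' := incl_add, map_smul' := incl_smul }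
  refine ⟨φ.extendOfNorm e, fun T => ?_⟩
  refine LinearMap.extendOfNorm_eq (e := e) denseRange_incl ⟨C, fun T => ?_⟩ T
  change _ ≤ C * ‖γ.incl T‖
  rw [norm_incl]
  exact hC T

lemma exists_seq_tendsto_incl (x : γ.Core) :
    ∃ u : ℕ → γ.unionCore, Filter.Tendsto (fun k => γ.incl (u k)) Filter.atTop (𝓝 x) := by
  obtain ⟨u, hu, h⟩ := mem_closure_iff_seq_limit.1 (denseRange_incl (γ := γ) x)
  choose v hv using hu
  exact ⟨v, by simpa only [hv] using h⟩

lemma core_induction {p : γ.Core → Prop} (hp : IsClosed {x | p x}) (h : ∀ T, p (γ.incl T))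
    (x : γ.Core) : p x := denseRange_incl.induction_on x hp h

/-- A bounded positive functional on the union of the finite cores extends to a positive functional
on the core. -/
lemma exists_positive_extension (φ : γ.unionCore →ₗ[ℂ] ℂ) {C : ℝ}
    (hC : ∀ T : γ.unionCore, ‖φ T‖ ≤ C * ‖(T : γ.adjointable)‖) (hφ : ∀ T, 0 ≤ φ (star T * T)) :
    ∃ Φ : γ.Core →ₚ[ℂ] ℂ, Continuous Φ ∧ ∀ T, Φ (γ.incl T) = φ T := by
  obtain ⟨Φ, hΦ⟩ := exists_extension φ hC
  have h1 : ∀ x, 0 ≤ Φ (star x * x) := fun x => by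
    refine core_induction (p := fun x => 0 ≤ Φ (star x * x)) ?_ (fun T => ?_) x
    · exact isClosed_le continuous_const (Φ.continuous.comp (continuous_star.mul continuous_id))
    · rw [← incl_star, ← incl_mul, hΦ]
      exact hφ T
  refine ⟨PositiveLinearMap.mk₀ Φ.toLinearMap fun x hx => ?_, Φ.continuous, hΦ⟩
  obtain ⟨y, rfl⟩ := CStarAlgebra.nonneg_iff_eq_star_mul_self.1 hx
  exact h1 y

end BranchedMap

namespace BranchedMap

variable {K : Type u} [MetricSpace K] {N : ℕ} {γ : BranchedMap K N} {n m : ℕ} [CompactSpace K]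

/-! ### Products in the finite cores -/

/-- Levels multiply by taking the maximum. Arbitrary sets of levels are allowed so that one
statement covers products inside `F^(n)` and the ideal property of `tail n`. -/
lemma mul_mem_iSup_compacts {p q r : ℕ → Prop} (h : ∀ k l, p k → q l → r (max k l))
    {T S : γ.adjointable} (hT : T ∈ ⨆ (k) (_ : p k), γ.compacts k)
    (hS : S ∈ ⨆ (k) (_ : q k), γ.compacts k) : T * S ∈ ⨆ (k) (_ : r k), γ.compacts k := by
  have h1 : ∀ k, p k → ∀ T ∈ γ.compacts k, T * S ∈ ⨆ (k) (_ : r k), γ.compacts k := by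
    intro k hk T hT
    have h2 : (⨆ (k) (_ : q k), γ.compacts k) ≤
        (⨆ (k) (_ : r k), γ.compacts k).comap (LinearMap.mulLeft ℂ T) :=
      iSup₂_le fun l hl S hS => (le_iSup₂ (f := fun k (_ : r k) => γ.compacts k) _ (h k l hk hl))
        (mul_mem_compacts' hT hS)
    exact h2 hS
  have h3 : (⨆ (k) (_ : p k), γ.compacts k) ≤
      (⨆ (k) (_ : r k), γ.compacts k).comap (LinearMap.mulRight ℂ S) :=
    iSup₂_le fun k hk T hT => h1 k hk T hT
  exact h3 hT

lemma star_mem_iSup_compacts {p : ℕ → Prop} {T : γ.adjointable}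
    (hT : T ∈ ⨆ (k) (_ : p k), γ.compacts k) : star T ∈ ⨆ (k) (_ : p k), γ.compacts k := by
  let R : Submodule ℂ γ.adjointable :=
    { carrier := {T | star T ∈ ⨆ (k) (_ : p k), γ.compacts k}
      zero_mem' := by simp
      add_mem' := fun h h' => by
        simp only [Set.mem_ofPred_eq, star_add]
        exact add_mem h h'
      smul_mem' := fun c T h => by
        simp only [Set.mem_ofPred_eq, star_smul]
        exact Submodule.smul_mem _ _ h }
  have h : (⨆ (k) (_ : p k), γ.compacts k) ≤ R := iSup₂_le fun k hk S hS =>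
    (le_iSup₂ (f := fun k (_ : p k) => γ.compacts k) k hk) (star_mem_compacts hS)
  exact h hT

variable (γ) in
/-- The ideal `∑_{k > n} K(X^{⊗ k})`. -/
noncomputable def tail (n : ℕ) : Submodule ℂ γ.adjointable := ⨆ (k) (_ : n < k), γ.compacts k

lemma compacts_le_tail (h : n < m) : γ.compacts m ≤ γ.tail n :=
  le_iSup₂ (f := fun k (_ : n < k) => γ.compacts k) m h

lemma iSup_compacts_le_unionCore {p : ℕ → Prop} {T : γ.adjointable}
    (hT : T ∈ ⨆ (k) (_ : p k), γ.compacts k) : T ∈ γ.unionCore := by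
  let R : Submodule ℂ γ.adjointable :=
    { carrier := {T | T ∈ γ.unionCore}
      zero_mem' := γ.unionCore.zero_mem
      add_mem' := fun h h' => γ.unionCore.add_mem h h'
      smul_mem' := fun c T (h : T ∈ γ.unionCore) => γ.unionCore.smul_mem h c }
  have h : (⨆ (k) (_ : p k), γ.compacts k) ≤ R := iSup₂_le fun k hk S hS =>
    mem_unionCore (compacts_le le_rfl hS)
  exact h hT

lemma one_mem_finiteCore (n : ℕ) : (1 : γ.adjointable) ∈ γ.finiteCore n := by
  have h : (1 : γ.adjointable) = γ.mulOp 1 := adjointable_ext fun f x => by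
    rw [mulOp_apply, one_mul]
    rfl
  rw [h]
  exact compacts_le (Nat.zero_le n) (rankOne_mem_compacts 0 1 1)

/-- The splitting is not unique. It reduces statements about the representations of level `n` to
`F^(n)` and to compacts of higher level. -/
lemma exists_decomposition (n : ℕ) (T : γ.unionCore) : ∃ S R : γ.unionCore, T = S + R ∧
    (S : γ.adjointable) ∈ γ.finiteCore n ∧ (R : γ.adjointable) ∈ γ.tail n ∧
      ∃ m, n < m ∧ (R : γ.adjointable) ∈ ⨆ k ∈ Set.Ioc n m, γ.compacts k := by
  obtain ⟨M, hM⟩ := exists_mem_finiteCore T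
  have h1 : γ.finiteCore M ≤
      γ.finiteCore n ⊔ ⨆ k ∈ Set.Ioc n (max M (n + 1)), γ.compacts k := by
    refine iSup₂_le fun k hk => ?_
    rcases le_or_gt k n with h | h
    · exact (compacts_le h).trans le_sup_left
    · exact (le_iSup₂ (f := fun k (_ : k ∈ Set.Ioc n (max M (n + 1))) => γ.compacts k) k
        ⟨h, hk.trans (le_max_left _ _)⟩).trans le_sup_right
  obtain ⟨S, hS, R, hR, hT⟩ := Submodule.mem_sup.1 (h1 hM)
  have hR' : R ∈ γ.tail n :=
    (iSup₂_le fun k (hk : k ∈ Set.Ioc n _) => compacts_le_tail hk.1 :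
      (⨆ k ∈ Set.Ioc n (max M (n + 1)), γ.compacts k) ≤ γ.tail n) hR
  exact ⟨⟨S, mem_unionCore hS⟩, ⟨R, iSup_compacts_le_unionCore hR'⟩, Subtype.ext hT.symm, hS, hR',
    max M (n + 1), by omega, hR⟩

lemma map_eq_zero_of_mem_tail {V : Type*} [AddCommGroup V] [Module ℂ V] {φ : γ.unionCore →ₗ[ℂ] V}
    (h : ∀ m, n < m → ∀ T : γ.unionCore, (T : γ.adjointable) ∈ γ.compacts m → φ T = 0)
    {R : γ.unionCore} (hR : (R : γ.adjointable) ∈ γ.tail n) : φ R = 0 := by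
  let Q : Submodule ℂ γ.adjointable :=
    { carrier := {T | ∃ S : γ.unionCore, S.1 = T ∧ φ S = 0}
      zero_mem' := ⟨0, rfl, map_zero φ⟩
      add_mem' := by
        rintro _ _ ⟨S, rfl, hS⟩ ⟨S', rfl, hS'⟩
        exact ⟨S + S', rfl, by rw [map_add, hS, hS', add_zero]⟩
      smul_mem' := by
        rintro c _ ⟨S, rfl, hS⟩
        exact ⟨c • S, rfl, by rw [map_smul, hS, smul_zero]⟩ }
  have h1 : γ.tail n ≤ Q := iSup₂_le fun k hk S hS =>
    ⟨⟨S, mem_unionCore (compacts_le le_rfl hS)⟩, rfl, h k hk _ hS⟩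
  obtain ⟨S, hS, hφ⟩ := h1 hR
  rwa [← Subtype.ext hS]

/-! ### The finite dimensional representations attached to the branch points -/

variable (γ) in
/-- A letter `j` with `γ_j (h x) = x`. -/
noncomputable def letter (x : K) : Fin N := (exists_map_h (γ := γ) x).choose

omit [CompactSpace K] in
lemma map_letter (x : K) : γ.map (γ.letter x) (γ.h x) = x := (exists_map_h (γ := γ) x).choose_spec

variable (γ) in
/-- The word that leads from `h^(k+1) b` to `h b`, and then through `γ_i` and `γ_w`. -/
noncomputable def branchWord (b : K) (n : ℕ) :
    (k : ℕ) → Fin N → (Fin n → Fin N) → (Fin (n + 1 + k) → Fin N)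
  | 0, i, w => (Fin.cons i w : Fin (n + 1) → Fin N)
  | k + 1, i, w => (Fin.cons (γ.letter (γ.h^[k + 1] b)) (branchWord b n k i w) :
      Fin (n + 1 + k + 1) → Fin N)

omit [CompactSpace K] in
lemma map_letter_iterate (b : K) (k : ℕ) :
    γ.map (γ.letter (γ.h^[k] b)) (γ.h^[k + 1] b) = γ.h^[k] b := by
  rw [Function.iterate_succ_apply', map_letter]

omit [CompactSpace K] in
lemma word_branchWord (b : K) (n k : ℕ) (i : Fin N) (w : Fin n → Fin N) :
    γ.word (n + 1 + k) (γ.branchWord b n k i w) (γ.h^[k + 1] b) =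
      γ.word n w (γ.map i (γ.h b)) := by
  induction k with
  | zero => rfl
  | succ k ih =>
    rw [← ih]
    change γ.word (n + 1 + k) _ (γ.map (γ.letter (γ.h^[k + 1] b)) (γ.h^[k + 1 + 1] b)) = _
    rw [map_letter_iterate]
    rfl

variable (γ) in
/-- The difference of two blocks of a matrix over the orbit of a branch point. -/
noncomputable def branchBlock (b : K) (n : ℕ) (i j : Fin N) (k : ℕ) :
    Matrix (Fin (n + 1 + k) → Fin N) (Fin (n + 1 + k) → Fin N) C(K, ℂ) →ₗ[ℂ]
      ((Fin n → Fin N) → (Fin n → Fin N) → ℂ) where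
  toFun a := fun w v =>
    a (γ.branchWord b n k i w) (γ.branchWord b n k i v) (γ.h^[k + 1] b) -
      a (γ.branchWord b n k i w) (γ.branchWord b n k j v) (γ.h^[k + 1] b)
  map_add' a a' := by
    ext w v
    simp only [Matrix.add_apply, ContinuousMap.add_apply, Pi.add_apply]
    ring
  map_smul' c a := by
    ext w v
    simp only [Matrix.smul_apply, ContinuousMap.smul_apply, Pi.smul_apply, smul_eq_mul,
      RingHom.id_apply]
    ring

omit [CompactSpace K] in
lemma branchBlock_blockDiag (b : K) (n : ℕ) (i j : Fin N) (k : ℕ)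
    (a : Matrix (Fin (n + 1 + k) → Fin N) (Fin (n + 1 + k) → Fin N) C(K, ℂ)) :
    γ.branchBlock b n i j (k + 1) (γ.blockDiag (n + 1 + k) a) = γ.branchBlock b n i j k a := by
  ext w v
  change γ.blockDiag (n + 1 + k) a (Fin.cons _ _) (Fin.cons _ _) _ -
    γ.blockDiag (n + 1 + k) a (Fin.cons _ _) (Fin.cons _ _) _ = _
  rw [blockDiag_cons_cons, blockDiag_cons_cons, if_pos rfl, if_pos rfl, map_letter_iterate]
  rfl

/-- Let `γ_i` and `γ_j` send `h b` to `b`, with `i ≠ j`. For `T` in `F^(n)` the matrix of level `n +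
1` over `h b` is block diagonal, so its `(i,i)` block minus its `(i,j)` block is `Π^(n)(T)(b)`. For
compacts of level `m > n` the two blocks coincide, since their columns belong to words with the same
endpoint. Continuing the words along the orbit of `b` makes the difference independent of the level.
-/
lemma exists_unionRep (hN : 2 ≤ N) {b : K} (hb : b ∈ γ.branchSet) (n : ℕ) :
    ∃ ρ : γ.unionCore →ₗ[ℂ] ((Fin n → Fin N) → (Fin n → Fin N) → ℂ),
      (∀ T : γ.unionCore, ∀ a, γ.Represents n T a → ρ T = fun w v => a w v b) ∧
      (∀ m, n < m → ∀ T : γ.unionCore, (T : γ.adjointable) ∈ γ.compacts m → ρ T = 0) ∧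
      ∀ T : γ.unionCore, ‖ρ T‖ ≤ 2 * ‖(T : γ.adjointable)‖ := by
  obtain ⟨i, j, hij, hi, hj⟩ := mem_branchSet_iff.1 hb
  obtain ⟨ρ, hρ⟩ := exists_linearMap_of_compatible (γ := γ) hN (n + 1) (γ.branchBlock b n i j)
    (branchBlock_blockDiag b n i j)
  refine ⟨ρ, fun T a ha => ?_, fun m hm T hT => ?_, fun T => ?_⟩
  · rw [hρ 0 T _ ha.blockDiag]
    ext w v
    change γ.blockDiag n a (Fin.cons i w) (Fin.cons i v) (γ.h b) -
      γ.blockDiag n a (Fin.cons i w) (Fin.cons j v) (γ.h b) = _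
    rw [blockDiag_cons_cons, blockDiag_cons_cons, if_pos rfl, if_neg hij, hi, sub_zero]
  · obtain ⟨k, rfl⟩ : ∃ k, m = n + 1 + k := ⟨m - (n + 1), by omega⟩
    obtain ⟨a, ha, ha'⟩ := exists_represents_compacts hN hT
    rw [hρ k T a ha]
    ext w v
    refine sub_eq_zero.2 (ha' _ _ _ _ ?_)
    rw [word_branchWord, word_branchWord, hi, hj]
  · obtain ⟨M, hM⟩ := exists_mem_finiteCore T
    have hM' := finiteCore_mono (Nat.le_add_left M (n + 1)) hM
    obtain ⟨a, ha⟩ := exists_represents hN hM'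
    have hL := finiteCore_le_adjointableAt _ hM'
    rw [hρ M T a ha]
    have h0 := norm_nonneg' T.1
    refine (pi_norm_le_iff_of_nonneg (by positivity)).2 fun w =>
      (pi_norm_le_iff_of_nonneg (by positivity)).2 fun v => (norm_sub_le _ _).trans ?_
    rw [two_mul]
    exact add_le_add (ha.norm_le hN hL _ _ _) (ha.norm_le hN hL _ _ _)

/-- Multiplicativity is not visible from a difference of two blocks. It holds on `F^(n)`, where the
map is evaluation of the matrix at `b`, and the remaining products contain a factor from `tail n`,
are in `tail n` themselves, and are annihilated. -/
lemma exists_discreteRep (hN : 2 ≤ N) {b : K} (hb : b ∈ γ.branchSet) (n : ℕ) :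
    ∃ ρ : γ.Core →⋆ₐ[ℂ] Matrix (Fin n → Fin N) (Fin n → Fin N) ℂ, Continuous ρ ∧
      (∀ T : γ.unionCore, ∀ a, γ.Represents n T a →
        ρ (γ.incl T) = Matrix.of fun w v => a w v b) ∧
      ∀ m, n < m → ∀ T : γ.unionCore, (T : γ.adjointable) ∈ γ.compacts m →
        ρ (γ.incl T) = 0 := by
  obtain ⟨ρ, h1, h2, h3⟩ := exists_unionRep hN hb n
  obtain ⟨Φ, hΦ⟩ := exists_extension ρ h3
  let Ψ : γ.Core →ₗ[ℂ] Matrix (Fin n → Fin N) (Fin n → Fin N) ℂ :=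
    (Matrix.ofLinearEquiv ℂ).toLinearMap ∘ₗ Φ.toLinearMap
  have hΨc : Continuous Ψ := Φ.continuous
  have hΨ : ∀ T, Ψ (γ.incl T) = Matrix.of (ρ T) := fun T => congrArg Matrix.of (hΦ T)
  have htail : ∀ R : γ.unionCore, (R : γ.adjointable) ∈ γ.tail n → Ψ (γ.incl R) = 0 :=
    fun R hR => by rw [hΨ, map_eq_zero_of_mem_tail h2 hR]; rfl
  have hrep : ∀ T : γ.unionCore, ∀ a, γ.Represents n T a →
      Ψ (γ.incl T) = Matrix.of fun w v => a w v b := fun T a ha => by rw [hΨ, h1 T a ha]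
  have hone : Ψ 1 = 1 := by
    rw [← incl_one, hrep 1 1 represents_one]
    ext w v
    by_cases h : w = v <;> simp [Matrix.one_apply, h]
  have hmul : ∀ T T', Ψ (γ.incl T * γ.incl T') = Ψ (γ.incl T) * Ψ (γ.incl T') := by
    intro T T'
    obtain ⟨S, R, rfl, hS, hR, -⟩ := exists_decomposition n T
    obtain ⟨S', R', rfl, hS', hR', -⟩ := exists_decomposition n T'
    obtain ⟨a, ha⟩ := exists_represents hN hS
    obtain ⟨a', ha'⟩ := exists_represents hN hS'
    have e1 : Ψ (γ.incl (S * R')) = 0 := htail _ (mul_mem_iSup_compacts (p := fun k => k ≤ n)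
      (q := fun k => n < k) (fun k l _ hl => lt_max_of_lt_right hl) hS hR')
    have e2 : Ψ (γ.incl (R * S')) = 0 := htail _ (mul_mem_iSup_compacts (p := fun k => n < k)
      (q := fun k => k ≤ n) (fun k l hk _ => lt_max_of_lt_left hk) hR hS')
    have e3 : Ψ (γ.incl (R * R')) = 0 := htail _ (mul_mem_iSup_compacts (p := fun k => n < k)
      (q := fun k => n < k) (fun k l hk _ => lt_max_of_lt_left hk) hR hR')
    have e4 : Ψ (γ.incl (S * S')) = Ψ (γ.incl S) * Ψ (γ.incl S') := by
      rw [hrep (S * S') _ (ha.mul ha'), hrep S a ha, hrep S' a' ha']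
      ext w v
      simp [Matrix.mul_apply]
    rw [← incl_mul, add_mul, mul_add, mul_add, incl_add, incl_add, incl_add, map_add, map_add,
      map_add, e1, e2, e3, e4, incl_add, incl_add, map_add, map_add, htail R hR, htail R' hR']
    simp
  have hstar : ∀ T, Ψ (star (γ.incl T)) = star (Ψ (γ.incl T)) := by
    intro T
    obtain ⟨S, R, rfl, hS, hR, -⟩ := exists_decomposition n T
    obtain ⟨a, ha⟩ := exists_represents hN hS
    have hS' : (star S : γ.unionCore).1 ∈ γ.finiteCore n := star_mem_iSup_compacts hS
    obtain ⟨a', ha'⟩ := exists_represents hN hS'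
    have e1 : Ψ (γ.incl (star R)) = 0 := htail _ (star_mem_iSup_compacts hR)
    rw [← incl_star, star_add, incl_add, incl_add, map_add, map_add, e1, htail R hR,
      hrep S a ha, hrep (star S) a' ha', add_zero, add_zero]
    have h4 := ha.star hN (finiteCore_le_adjointableAt n hS) ha'
    ext w v
    rw [h4]
    rfl
  refine ⟨{ toFun := Ψ, map_one' := hone, map_mul' := fun x y => ?_, map_zero' := map_zero Ψ
            map_add' := map_add Ψ
            commutes' := fun c => by
              rw [Algebra.algebraMap_eq_smul_one, map_smul, hone, Algebra.algebraMap_eq_smul_one]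
            map_star' := fun x => ?_ }, hΨc, hrep, fun m hm T hT => htail T (compacts_le_tail hm hT)⟩
  · refine core_induction (p := fun x => Ψ (x * y) = Ψ x * Ψ y) (isClosed_eq (by fun_prop)
      (by fun_prop)) (fun T => ?_) x
    exact core_induction (p := fun y => Ψ (γ.incl T * y) = Ψ (γ.incl T) * Ψ y)
      (isClosed_eq (by fun_prop) (by fun_prop)) (fun T' => hmul T T') y
  · exact core_induction (p := fun x => Ψ (star x) = star (Ψ x)) (isClosed_eq
      (hΨc.comp continuous_star) (continuous_star.comp hΨc)) hstar x

end BranchedMap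

/-! ### The kernels of the representations of the branch points -/

namespace BranchedMap

variable {K : Type u} [MetricSpace K] {N : ℕ} {γ : BranchedMap K N} {n m : ℕ} [CompactSpace K]

/-- The representation of the core on `M_{N^n}(ℂ)` that is given by `Π^(n)(T)(b)` on `F^(n)` and
annihilates `K(X^{⊗ m})` for `m > n`. -/
noncomputable def discreteRep (hN : 2 ≤ N) {b : K} (hb : b ∈ γ.branchSet) (n : ℕ) :
    γ.Core →⋆ₐ[ℂ] Matrix (Fin n → Fin N) (Fin n → Fin N) ℂ :=
  (exists_discreteRep hN hb n).choose

section

variable (hN : 2 ≤ N) {b : K} (hb : b ∈ γ.branchSet)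
include hN hb

lemma continuous_discreteRep (n : ℕ) : Continuous (γ.discreteRep hN hb n) :=
  (exists_discreteRep hN hb n).choose_spec.1

lemma discreteRep_of_represents {T : γ.unionCore}
    {a : Matrix (Fin n → Fin N) (Fin n → Fin N) C(K, ℂ)} (ha : γ.Represents n T a) :
    γ.discreteRep hN hb n (γ.incl T) = Matrix.of fun w v => a w v b :=
  (exists_discreteRep hN hb n).choose_spec.2.1 T a ha

lemma discreteRep_of_mem_compacts (h : n < m) {T : γ.unionCore}
    (hT : (T : γ.adjointable) ∈ γ.compacts m) : γ.discreteRep hN hb n (γ.incl T) = 0 :=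
  (exists_discreteRep hN hb n).choose_spec.2.2 m h T hT

lemma discreteRep_of_mem_tail {T : γ.unionCore}
    (hT : (T : γ.adjointable) ∈ γ.tail n) : γ.discreteRep hN hb n (γ.incl T) = 0 :=
  map_eq_zero_of_mem_tail (φ := (γ.discreteRep hN hb n).toAlgHom.toLinearMap ∘ₗ
    (toCore (γ := γ)).toAlgHom.toLinearMap)
    (fun _ hm _ hT => discreteRep_of_mem_compacts hN hb hm hT) hT

lemma exists_unionRankOne_discreteRep (n : ℕ) :
    ∃ f : (Fin n → Fin N) → C(K, ℂ), ∀ w v,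
      γ.discreteRep hN hb n (γ.incl (γ.unionRankOne n (f w) (f v))) = Matrix.single w v 1 := by
  have hinj : Function.Injective fun w => γ.word n w b := by
    have := branchSet_notMem_collisionSet hb n
    simpa [collisionSet] using this
  choose f hf using fun w : Fin n → Fin N =>
    exists_interpolation hinj (Pi.single w (1 : ℂ))
  refine ⟨f, fun w v => ?_⟩
  rw [discreteRep_of_represents hN hb (represents_rankOne n (f w) (f v))]
  refine Matrix.ext fun w' v' => ?_
  have h1 : f w (γ.word n w' b) = _ := hf w w'
  have h2 : f v (γ.word n v' b) = _ := hf v v'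
  change f w (γ.word n w' b) * star (f v (γ.word n v' b)) = _
  rw [h1, h2]
  by_cases e1 : w = w' <;> by_cases e2 : v = v' <;>
    simp [e1, e2, eq_comm]

lemma surjective_discreteRep (n : ℕ) : Function.Surjective (γ.discreteRep hN hb n) := by
  intro M
  obtain ⟨f, hf⟩ := exists_unionRankOne_discreteRep hN hb n
  refine ⟨∑ w, ∑ v, M w v • γ.incl (γ.unionRankOne n (f w) (f v)), ?_⟩
  simp only [map_sum, map_smul, hf]
  conv_rhs => rw [Matrix.matrix_eq_sum_single M]
  simp [Matrix.smul_single]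

lemma exists_unionRankOne_discreteRep_ne_zero (n : ℕ) :
    ∃ f g, γ.discreteRep hN hb n (γ.incl (γ.unionRankOne n f g)) ≠ 0 := by
  obtain ⟨f, hf⟩ := exists_unionRankOne_discreteRep hN hb n
  let w : Fin n → Fin N := fun _ => ⟨0, by omega⟩
  refine ⟨f w, f w, fun h => ?_⟩
  rw [hf] at h
  simpa using congrFun (congrFun h w) w

end

/-- Elements in the kernel of a finite dimensional continuous linear map are limits of elements
of the kernel in the union of the finite cores. -/
lemma mem_closure_of_map_eq_zero {V : Type*} [AddCommGroup V] [Module ℂ V] [TopologicalSpace V]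
    [IsTopologicalAddGroup V] [ContinuousSMul ℂ V] [T2Space V] [FiniteDimensional ℂ V]
    (φ : γ.Core →ₗ[ℂ] V) (hφ : Continuous φ) {x : γ.Core} (hx : φ x = 0) :
    x ∈ closure (γ.incl '' {T | φ (γ.incl T) = 0}) := by
  let ι : γ.unionCore →ₗ[ℂ] γ.Core :=
    { toFun := γ.incl, map_add' := incl_add, map_smul' := incl_smul }
  -- A linear section over the range is continuous, the range being finite dimensional. Subtracting
  -- from an approximant `T k` the section of its image, which tends to 0, moves it into the kernel
  -- without changing the limit.
  obtain ⟨s, hs⟩ := (φ ∘ₗ ι).rangeRestrict.exists_rightInverse_of_surjective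
    (LinearMap.range_rangeRestrict _)
  have hs' : ∀ T, φ (γ.incl (s ((φ ∘ₗ ι).rangeRestrict T))) = φ (γ.incl T) := fun T =>
    congrArg Subtype.val (LinearMap.congr_fun hs ((φ ∘ₗ ι).rangeRestrict T))
  have hc : Continuous (ι ∘ₗ s) := LinearMap.continuous_of_finiteDimensional _
  obtain ⟨T, hT⟩ := exists_seq_tendsto_incl x
  have h1 : Filter.Tendsto (fun k => (φ ∘ₗ ι).rangeRestrict (T k)) Filter.atTop (𝓝 0) := by
    rw [tendsto_subtype_rng]
    have := (hφ.tendsto x).comp hT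
    rw [hx] at this
    exact this
  have h2 := (hc.tendsto 0).comp h1
  rw [map_zero] at h2
  have h3 := hT.sub h2
  rw [sub_zero] at h3
  refine mem_closure_of_tendsto h3 (Filter.Eventually.of_forall fun k => ?_)
  refine ⟨T k - s ((φ ∘ₗ ι).rangeRestrict (T k)), ?_, incl_sub _ _⟩
  rw [Set.mem_ofPred_eq, incl_sub, map_sub, hs', sub_self]

section

variable (hN : 2 ≤ N) {b : K} (hb : b ∈ γ.branchSet)

/-- Elements of the kernel are limits of elements of the kernel in `⋃ₙ F^(n)`. In a decomposition `S
+ R` of such an element, `R` is annihilated, so the matrix of `S` vanishes at `b`. -/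
lemma mem_coreIdeal_iff {x : γ.Core} : x ∈ γ.coreIdeal b n ↔ γ.discreteRep hN hb n x = 0 := by
  constructor
  · intro hx
    have hcl : IsClosed {x | γ.discreteRep hN hb n x = 0} :=
      isClosed_eq (continuous_discreteRep hN hb n) continuous_const
    refine closure_minimal ?_ hcl hx
    rintro _ ⟨T, ⟨m, hm, hT⟩, rfl⟩
    obtain ⟨S, ⟨hS, a, ha, hab⟩, R, hR, hSR⟩ := Submodule.mem_sup.1 hT
    have hR' : R ∈ γ.tail n :=
      (iSup₂_le fun k (hk : k ∈ Set.Ioc n _) => compacts_le_tail hk.1 :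
        (⨆ k ∈ Set.Ioc n m, γ.compacts k) ≤ γ.tail n) hR
    have h1 : T = (⟨S, mem_unionCore hS⟩ + ⟨R, iSup_compacts_le_unionCore hR'⟩ : γ.unionCore) :=
      Subtype.ext hSR.symm
    change γ.discreteRep hN hb n (γ.incl T) = 0
    rw [h1, incl_add, map_add, discreteRep_of_mem_tail hN hb (T := ⟨R,
        iSup_compacts_le_unionCore hR'⟩) hR', add_zero,
      discreteRep_of_represents hN hb ha]
    ext w v
    exact hab w v
  · intro hx
    refine closure_mono ?_ (mem_closure_of_map_eq_zero
      (γ.discreteRep hN hb n).toAlgHom.toLinearMap (continuous_discreteRep hN hb n) hx)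
    rintro _ ⟨T, hT, rfl⟩
    obtain ⟨S, R, rfl, hS, hR, M, hM, hR'⟩ := exists_decomposition n T
    refine ⟨_, ⟨M, hM, Submodule.mem_sup.2 ⟨S, ⟨hS, ?_⟩, R, hR', rfl⟩⟩, rfl⟩
    obtain ⟨a, ha⟩ := exists_represents hN hS
    refine ⟨a, ha, fun w v => ?_⟩
    have h1 : γ.discreteRep hN hb n (γ.incl (S + R)) = 0 := hT
    rw [incl_add, map_add, discreteRep_of_mem_tail hN hb hR, add_zero,
      discreteRep_of_represents hN hb ha] at h1
    exact congrFun (congrFun h1 w) v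

/-- The common kernel of the representations `discreteRep hN hb k`, `k ≤ n`, is the closure of
`∑_{k > n} K(X^{⊗ k})`. -/
lemma mem_closure_tail {x : γ.Core}
    (hx : ∀ b (hb : b ∈ γ.branchSet), ∀ k ≤ n, γ.discreteRep hN hb k x = 0) :
    x ∈ closure (γ.incl '' {T | (T : γ.adjointable) ∈ γ.tail n}) := by
  have := γ.finite_branchSet.fintype
  let φ : γ.Core →ₗ[ℂ] ∀ (b : γ.branchSet) (k : Fin (n + 1)),
      Matrix (Fin k.1 → Fin N) (Fin k.1 → Fin N) ℂ :=
    LinearMap.pi fun b => LinearMap.pi fun k => (γ.discreteRep hN b.2 k.1).toAlgHom.toLinearMap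
  have hφ : Continuous φ := continuous_pi fun b => continuous_pi fun k =>
    continuous_discreteRep hN b.2 k.1
  refine closure_mono ?_ (mem_closure_of_map_eq_zero φ hφ (x := x)
    (funext fun b => funext fun k => hx b.1 b.2 k.1 (Nat.lt_succ_iff.1 k.2)))
  refine Set.image_mono fun T hT => ?_
  have hT' : ∀ b (hb : b ∈ γ.branchSet), ∀ k ≤ n, γ.discreteRep hN hb k (γ.incl T) = 0 :=
    fun b hb k hk => congrFun (congrFun hT ⟨b, hb⟩) ⟨k, Nat.lt_succ_iff.2 hk⟩
  -- The levels are stripped off one at a time: the representations of level `j` annihilate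
  -- everything above `j`, so the matrix of the summand of level `j` vanishes on `B_γ`, and this
  -- summand is compact of level `j + 1`.
  have h1 : ∀ j ≤ n + 1, (T : γ.adjointable) ∈ ⨆ (k) (_ : j ≤ k), γ.compacts k := by
    intro j
    induction j with
    | zero =>
      intro _
      obtain ⟨M, hM⟩ := exists_mem_finiteCore T
      exact (iSup₂_le fun k _ => le_iSup₂ (f := fun k (_ : 0 ≤ k) => γ.compacts k) k k.zero_le :
        γ.finiteCore M ≤ _) hM
    | succ j ih =>
      intro hj
      have h2 : (⨆ (k) (_ : j ≤ k), γ.compacts k) ≤ γ.compacts j ⊔ γ.tail j :=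
        iSup₂_le fun k hk => by
          rcases hk.eq_or_lt with rfl | h
          · exact le_sup_left
          · exact (compacts_le_tail h).trans le_sup_right
      obtain ⟨S, hS, R, hR, hT⟩ := Submodule.mem_sup.1 (h2 (ih (by omega)))
      obtain ⟨a, ha⟩ := exists_represents hN (compacts_le le_rfl hS)
      have h3 : T = (⟨S, mem_unionCore (compacts_le le_rfl hS)⟩ +
        ⟨R, iSup_compacts_le_unionCore hR⟩ : γ.unionCore) := Subtype.ext hT.symm
      have h4 : S ∈ γ.compacts (j + 1) := by
        refine mem_compacts_succ_of_vanish hS ha fun b hb w v => ?_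
        have h5 := hT' b hb j (by omega)
        rw [h3, incl_add, map_add, discreteRep_of_mem_tail hN hb
          (T := ⟨R, iSup_compacts_le_unionCore hR⟩) hR, add_zero,
          discreteRep_of_represents hN hb ha] at h5
        exact congrFun (congrFun h5 w) v
      rw [← hT]
      exact add_mem (compacts_le_tail (Nat.lt_succ_self j) h4) hR
  exact h1 (n + 1) le_rfl

end

end BranchedMap

/-! ### Cyclic and irreducible representations -/

lemma BranchedMap.continuous_rep {A : Type*} [CStarAlgebra A] {H : Type*} [NormedAddCommGroup H]
    [InnerProductSpace ℂ H] [CompleteSpace H] (π : A →⋆ₐ[ℂ] (H →L[ℂ] H)) : Continuous π :=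
  AddMonoidHomClass.continuous_of_bound π 1 fun a => by
    rw [one_mul]
    exact norm_rep_le π a

namespace PositiveLinearMap

variable {A : Type u} [CStarAlgebra A] [PartialOrder A] [StarOrderedRing A] (ω : A →ₚ[ℂ] ℂ)

/-- The cyclic vector of the GNS representation. -/
noncomputable def cyclicVector : ω.GNS := (ω.toPreGNS 1 : UniformSpace.Completion ω.PreGNS)

lemma gns_cyclicVector (a : A) : ω.gnsStarAlgHom a ω.cyclicVector =
    (ω.toPreGNS a : UniformSpace.Completion ω.PreGNS) := by
  change ω.gnsNonUnitalStarAlgHom a (ω.toPreGNS 1 : UniformSpace.Completion ω.PreGNS) = _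
  rw [gnsNonUnitalStarAlgHom_apply_coe]
  simp

lemma inner_gns_cyclicVector (a b : A) :
    ⟪ω.gnsStarAlgHom a ω.cyclicVector, ω.gnsStarAlgHom b ω.cyclicVector⟫_ℂ = ω (star a * b) := by
  rw [gns_cyclicVector, gns_cyclicVector, UniformSpace.Completion.inner_coe, preGNS_inner_def]
  rfl

lemma inner_cyclicVector_gns (a : A) :
    ⟪ω.cyclicVector, ω.gnsStarAlgHom a ω.cyclicVector⟫_ℂ = ω a := by
  have := ω.inner_gns_cyclicVector 1 a
  simpa using this

lemma denseRange_gns_cyclicVector : DenseRange fun a => ω.gnsStarAlgHom a ω.cyclicVector := by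
  simp only [gns_cyclicVector]
  exact UniformSpace.Completion.denseRange_coe.comp ω.toPreGNS.surjective.denseRange
    (UniformSpace.Completion.continuous_coe _)

lemma gns_eq_self_of_apply_eq_zero {a : A} (h : ω (star (a - 1) * (a - 1)) = 0) :
    ω.gnsStarAlgHom a ω.cyclicVector = ω.cyclicVector := by
  rw [← inner_gns_cyclicVector, inner_self_eq_zero, map_sub, map_one, sub_apply,
    one_apply_eq_self, sub_eq_zero] at h
  exact h

/-- A state is pure if its restriction to a dense subspace can be excised by elements of the
algebra that fix the cyclic vector. -/
lemma isIrreducibleRep_gns (h1 : ω 1 = 1) {D : Set A} (hD : Dense D)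
    (hex : ∀ a ∈ D, ∀ ε > 0, ∃ c : A, star c = c ∧ ω (star (c - 1) * (c - 1)) = 0 ∧
      ‖c * a * c - ω a • (c * c)‖ ≤ ε) : IsIrreducibleRep ω.gnsStarAlgHom := by
  set π := ω.gnsStarAlgHom with hπ
  set Ω := ω.cyclicVector with hΩ
  have hΩ1 : ⟪Ω, Ω⟫_ℂ = 1 := by
    have := ω.inner_cyclicVector_gns 1
    rwa [map_one, one_apply_eq_self, h1] at this
  have hΩ0 : Ω ≠ 0 := fun h => by simp [h] at hΩ1
  refine ⟨⟨Ω, 0, hΩ0⟩, fun M hMc hM => ?_⟩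
  have : CompleteSpace M := hMc.completeSpace_coe
  have hMo : ∀ a, ∀ v ∈ Mᗮ, π a v ∈ Mᗮ := fun a v hv => by
    rw [Submodule.mem_orthogonal'] at hv ⊢
    intro u hu
    rw [BranchedMap.inner_map_self]
    exact hv _ (hM _ u hu)
  obtain ⟨η, hη, ζ, hζ, hηζ⟩ := M.exists_add_mem_mem_orthogonal Ω
  -- If `c` fixes `Ω = η + ζ`, then `cη - η = ζ - cζ` lies both in `M` and in its orthogonal
  -- complement.
  have hfix : ∀ c, π c Ω = Ω → π c η = η := fun c hc => by
    rw [hηζ, map_add] at hc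
    have h2 : π c η - η = ζ - π c ζ := by
      rw [sub_eq_sub_iff_add_eq_add, hc, add_comm]
    have h3 : π c η - η ∈ M := sub_mem (hM c η hη) hη
    have h4 : π c η - η ∈ Mᗮ := by
      rw [h2]
      exact sub_mem hζ (hMo c ζ hζ)
    exact sub_eq_zero.1 (inner_self_eq_zero.1 (Submodule.inner_right_of_mem_orthogonal h3 h4))
  -- Excising elements fix both `Ω` and `η`, so `a` may be replaced by `c a c`, which is close to
  -- `ω(a) c²`. It follows that `η` is a multiple of `Ω`, whence `M` is trivial.
  have h2 : ∀ a ∈ D, ⟪η, π a Ω⟫_ℂ = ω a * ⟪η, Ω⟫_ℂ := fun a ha => by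
    rw [← sub_eq_zero, ← norm_le_zero_iff]
    refine le_of_forall_pos_le_add fun ε hε => ?_
    -- The summand 1 in the denominator covers the case `η = 0`.
    obtain ⟨c, hcs, hc, hn⟩ := hex a ha (ε / (‖η‖ * ‖Ω‖ + 1)) (by positivity)
    have hcΩ : π c Ω = Ω := ω.gns_eq_self_of_apply_eq_zero hc
    have h3 : ⟪η, π a Ω⟫_ℂ - ω a * ⟪η, Ω⟫_ℂ = ⟪η, π (c * a * c - ω a • (c * c)) Ω⟫_ℂ := by
      rw [map_sub, map_smul, map_mul, map_mul, map_mul, sub_apply, smul_apply, mul_apply_eq_comp,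
        mul_apply_eq_comp, mul_apply_eq_comp, hcΩ, hcΩ, inner_sub_right, inner_smul_right]
      congr 1
      have h5 := BranchedMap.inner_map_self π c η (π a Ω)
      rwa [hfix c hcΩ, hcs] at h5
    rw [h3, zero_add]
    calc _ ≤ ‖η‖ * ‖π (c * a * c - ω a • (c * c)) Ω‖ := norm_inner_le_norm _ _
      _ ≤ ‖η‖ * (‖π (c * a * c - ω a • (c * c))‖ * ‖Ω‖) := by
          gcongr; exact ContinuousLinearMap.le_opNorm _ _
      _ ≤ ‖η‖ * (ε / (‖η‖ * ‖Ω‖ + 1) * ‖Ω‖) := by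
          gcongr
          exact (BranchedMap.norm_rep_le π _).trans hn
      _ = ε * ((‖η‖ * ‖Ω‖) / (‖η‖ * ‖Ω‖ + 1)) := by ring
      _ ≤ ε * 1 := by
          gcongr
          exact (div_le_one (by positivity)).2 (by linarith)
      _ = ε := mul_one ε
  have hπc : Continuous π := BranchedMap.continuous_rep π
  have hωc : Continuous fun a => ω a := by
    have : (fun a => ω a) = fun a => ⟪Ω, π a Ω⟫_ℂ := funext fun a => (ω.inner_cyclicVector_gns a).symm
    rw [this]
    fun_prop
  have h3 : ∀ a, ⟪η, π a Ω⟫_ℂ = ω a * ⟪η, Ω⟫_ℂ := fun a =>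
    congrFun (Continuous.ext_on hD (f := fun a => ⟪η, π a Ω⟫_ℂ) (by fun_prop)
      (hωc.mul continuous_const) h2) a
  have h4 : η = ⟪Ω, η⟫_ℂ • Ω := by
    refine ω.denseRange_gns_cyclicVector.eq_of_inner_left ℂ fun a => ?_
    change ⟪η, π a Ω⟫_ℂ = ⟪⟪Ω, η⟫_ℂ • Ω, π a Ω⟫_ℂ
    rw [inner_smul_left, inner_conj_symm, h3, mul_comm]
    congr 1
    exact (ω.inner_cyclicVector_gns a).symm
  rcases eq_or_ne ⟪Ω, η⟫_ℂ 0 with ht | ht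
  · left
    rw [ht, zero_smul] at h4
    rw [h4, zero_add] at hηζ
    rw [eq_bot_iff]
    intro v hv
    refine ω.denseRange_gns_cyclicVector.eq_zero_of_inner_left ℂ fun a => ?_
    change ⟪v, π a Ω⟫_ℂ = 0
    rw [← star_star a, ← BranchedMap.inner_map_self, hηζ]
    exact Submodule.inner_right_of_mem_orthogonal (hM _ v hv) hζ
  · right
    have h5 : Ω ∈ M := by
      have : Ω = (⟪Ω, η⟫_ℂ)⁻¹ • η := by rw [eq_inv_smul_iff₀ ht]; exact h4.symm
      rw [this]
      exact M.smul_mem _ hη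
    rw [eq_top_iff]
    intro v _
    refine hMc.closure_subset (closure_mono ?_ (ω.denseRange_gns_cyclicVector v))
    rintro _ ⟨a, rfl⟩
    exact hM a Ω h5

end PositiveLinearMap

/-! ### Representations on matrix algebras -/

section Matrix

variable {A : Type u} [CStarAlgebra A] {ι : Type u} [Fintype ι] [DecidableEq ι]

variable (ι) in
/-- The representation of a matrix algebra on the Euclidean space. -/
noncomputable def euclideanRep :
    Matrix ι ι ℂ →⋆ₐ[ℂ] (EuclideanSpace ℂ ι →L[ℂ] EuclideanSpace ℂ ι) where
  toFun := Matrix.toEuclideanCLM (n := ι) (𝕜 := ℂ)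
  map_one' := map_one _
  map_mul' := map_mul _
  map_zero' := map_zero _
  map_add' := map_add _
  commutes' := fun c => by
    rw [Algebra.algebraMap_eq_smul_one, map_smul, map_one, Algebra.algebraMap_eq_smul_one]
  map_star' := map_star _

lemma euclideanRep_injective : Function.Injective (euclideanRep ι) :=
  (Matrix.toEuclideanCLM (n := ι) (𝕜 := ℂ)).injective

/-- Surjective representations on matrix algebras are irreducible. -/
lemma isIrreducibleRep_toEuclideanCLM [Nonempty ι] {ρ : A →⋆ₐ[ℂ] Matrix ι ι ℂ}
    (hρ : Function.Surjective ρ) :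
    IsIrreducibleRep ((euclideanRep ι).comp ρ) := by
  refine ⟨inferInstance, fun M _ hM => ?_⟩
  rw [or_iff_not_imp_left]
  intro hne
  obtain ⟨v, hv, hv0⟩ := Submodule.exists_mem_ne_zero_of_ne_bot hne
  obtain ⟨i, hi⟩ : ∃ i, v i ≠ 0 := by
    by_contra! h
    exact hv0 (by ext i; exact h i)
  rw [eq_top_iff]
  intro u _
  obtain ⟨a, ha⟩ := hρ (Matrix.of fun k l => if l = i then u k * (v i)⁻¹ else 0)
  have h1 := hM a v hv
  have h2 : ((euclideanRep ι).comp ρ) a v = u := by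
    change Matrix.toEuclideanCLM (n := ι) (𝕜 := ℂ) (ρ a) v = u
    rw [ha]
    ext k
    rw [Matrix.ofLp_toEuclideanCLM]
    simp [Matrix.mulVec, dotProduct, hi]
  rwa [h2] at h1

end Matrix

/-! ### Primeness of the kernels of irreducible representations -/

section Prime

variable {A : Type u} [CStarAlgebra A] {H : Type u} [NormedAddCommGroup H] [InnerProductSpace ℂ H]
  [CompleteSpace H] {π : A →⋆ₐ[ℂ] (H →L[ℂ] H)}

/-- Kernels of irreducible representations are prime. -/
lemma IsIrreducibleRep.mul_le (hπ : IsIrreducibleRep π) {I J : Set A}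
    (hI : ∀ x ∈ I, ∀ a, x * a ∈ I) (h : ∀ x ∈ I, ∀ y ∈ J, π (x * y) = 0) :
    (∀ x ∈ I, π x = 0) ∨ ∀ y ∈ J, π y = 0 := by
  -- The vectors annihilated by `I` form a closed invariant subspace, which contains the range of `π
  -- y` for every `y ∈ J`.
  let M : Submodule ℂ H := ⨅ x ∈ I, LinearMap.ker (π x).toLinearMap
  have hMI : ∀ v, v ∈ M ↔ ∀ x ∈ I, π x v = 0 := fun v => by simp [M]
  have hMc : IsClosed (M : Set H) := by
    have : (M : Set H) = ⋂ x ∈ I, {v | π x v = 0} := by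
      ext v
      simp [hMI]
    rw [this]
    exact isClosed_biInter fun x _ => isClosed_eq (by fun_prop) continuous_const
  rcases hπ.2 M hMc (fun a v hv => (hMI _).2 fun x hx => by
      rw [← mul_apply_eq_comp, ← map_mul]
      exact (hMI v).1 hv _ (hI x hx a)) with h0 | h0
  · right
    intro y hy
    ext v
    have : π y v ∈ M := (hMI _).2 fun x hx => by
      rw [← mul_apply_eq_comp, ← map_mul, h x hx y hy]
      rfl
    rw [h0] at this
    exact this
  · left
    intro x hx
    ext v
    exact (hMI v).1 (h0 ▸ Submodule.mem_top) x hx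

lemma IsIrreducibleRep.map_one_ne_zero (hπ : IsIrreducibleRep π) : π 1 ≠ 0 := by
  have := hπ.1
  rw [map_one]
  exact one_ne_zero

/-- If the kernel of an irreducible representation contains a finite intersection of ideals, then
it contains one of them. -/
lemma IsIrreducibleRep.exists_le {ι : Type*} (hπ : IsIrreducibleRep π) (I : ι → Ideal A)
    [∀ i, (I i).IsTwoSided] (s : Finset ι) (h : ∀ x, (∀ i ∈ s, x ∈ I i) → π x = 0) :
    ∃ i ∈ s, ∀ x ∈ I i, π x = 0 := by
  classical
  induction s using Finset.induction_on with
  | empty => exact absurd (h 1 (by simp)) hπ.map_one_ne_zero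
  | insert i s _ ih =>
    rcases hπ.mul_le (I := I i) (J := {y | ∀ j ∈ s, y ∈ I j})
      (fun x hx a => Ideal.mul_mem_right a _ hx) (fun x hx y hy => h _ fun j hj => by
        rcases Finset.mem_insert.1 hj with rfl | hj
        · exact Ideal.mul_mem_right y _ hx
        · exact Ideal.mul_mem_left _ x (hy j hj)) with h1 | h1
    · exact ⟨i, Finset.mem_insert_self i s, h1⟩
    · obtain ⟨j, hj, h2⟩ := ih h1
      exact ⟨j, Finset.mem_insert_of_mem hj, h2⟩

/-- The kernels of the surjections onto matrix algebras are maximal. -/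
lemma ker_eq_of_surjective_matrix {B ι : Type*} [Ring B] [Algebra ℂ B] [Fintype ι] [DecidableEq ι]
    {ρ : A →ₐ[ℂ] Matrix ι ι ℂ} (hρ : Function.Surjective ρ) {φ : A →ₐ[ℂ] B} (h1 : φ 1 ≠ 0)
    (h : ∀ x, ρ x = 0 → φ x = 0) {x : A} (hx : φ x = 0) : ρ x = 0 := by
  by_contra hne
  obtain ⟨i, j, hij⟩ : ∃ i j, ρ x i j ≠ 0 := by
    by_contra! h
    exact hne (Matrix.ext h)
  -- With matrix units `E`, the sum of `E_{ki} x E_{jk}` over `k` is the scalar `x_{ij}`. So an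
  -- element outside the kernel of `ρ` generates a nonzero scalar modulo that kernel, which `φ`
  -- cannot annihilate.
  choose p hp using fun k => hρ (Matrix.single k i 1)
  choose q hq using fun k => hρ (Matrix.single j k 1)
  set y := ∑ k, p k * x * q k with hy
  have h2 : ρ (y - ρ x i j • 1) = 0 := by
    rw [map_sub, map_smul, map_one, hy, map_sum]
    simp only [map_mul, hp, hq, Matrix.single_mul_mul_single, one_mul, mul_one]
    rw [sub_eq_zero]
    ext k l
    simp only [Matrix.sum_apply, Matrix.single_apply, Matrix.smul_apply, Matrix.one_apply,
      smul_eq_mul]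
    by_cases e : k = l
    · subst e; simp
    · simp only [e, if_false, mul_zero]
      exact Finset.sum_eq_zero fun c _ => if_neg fun hc => e (hc.1.symm.trans hc.2)
  have h3 : φ y = 0 := by
    rw [hy, map_sum]
    exact Finset.sum_eq_zero fun k _ => by rw [map_mul, map_mul, hx, mul_zero, zero_mul]
  have h4 := h _ h2
  rw [map_sub, h3, zero_sub, neg_eq_zero, map_smul] at h4
  exact h1 ((smul_eq_zero.1 h4).resolve_left hij)

end Prime

namespace BranchedMap

variable {K : Type u} [MetricSpace K] {N : ℕ} {γ : BranchedMap K N} {n m : ℕ}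

/-! ### The pure states of the regular points -/

lemma word_eq_of_iterate_notMem {x : K} (hx : ∀ k, γ.h^[k] x ∉ γ.branchSet) {n : ℕ}
    {w v : Fin n → Fin N} {y : K} (hw : γ.word n w y = x) (hv : γ.word n v y = x) : w = v := by
  induction n generalizing y with
  | zero => exact Subsingleton.elim _ _
  | succ n ih =>
    rw [word_succ] at hw hv
    have h1 : γ.map (w 0) y = γ.h^[n] x := by rw [← hw, γ.iterate_word]
    have h2 : γ.map (v 0) y = γ.h^[n] x := by rw [← hv, γ.iterate_word]
    have h3 : w 0 = v 0 := by
      by_contra h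
      exact hx n ⟨y, w 0, v 0, h, h1, h2⟩
    have h4 : Fin.tail w = Fin.tail v := ih hw (by rw [h1, ← h2]; exact hv)
    rw [← Fin.cons_self_tail w, ← Fin.cons_self_tail v, h3, h4]

/-- The length is written `0 + k` to match `exists_linearMap_of_compatible`, where levels start at
`l`; here `l = 0`. -/
lemma iterate_word_zero_add (k : ℕ) (w : Fin (0 + k) → Fin N) (y : K) :
    γ.h^[k] (γ.word (0 + k) w y) = y :=
  (congrArg (fun j => γ.h^[j] (γ.word (0 + k) w y)) (Nat.zero_add k).symm).trans
    (γ.iterate_word (0 + k) w y)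

variable (γ) in
/-- The word of length `k` that leads from `h^k x` back to `x`. -/
noncomputable def orbitWord (x : K) : (k : ℕ) → (Fin (0 + k) → Fin N)
  | 0 => Fin.elim0
  | k + 1 => (Fin.cons (γ.letter (γ.h^[k] x)) (orbitWord x k) : Fin (0 + k + 1) → Fin N)

lemma word_orbitWord (x : K) (k : ℕ) :
    γ.word (0 + k) (γ.orbitWord x k) (γ.h^[k] x) = x := by
  induction k with
  | zero => rfl
  | succ k ih =>
    change γ.word (0 + k) (γ.orbitWord x k) (γ.map (γ.letter (γ.h^[k] x)) (γ.h^[k + 1] x)) = _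
    rw [map_letter_iterate, ih]

variable [CompactSpace K]

variable (γ) in
/-- Evaluation of a diagonal entry along the orbit of a point. -/
noncomputable def orbitEntry (x : K) (k : ℕ) :
    Matrix (Fin (0 + k) → Fin N) (Fin (0 + k) → Fin N) C(K, ℂ) →ₗ[ℂ] ℂ where
  toFun a := a (γ.orbitWord x k) (γ.orbitWord x k) (γ.h^[k] x)
  map_add' _ _ := rfl
  map_smul' _ _ := rfl

/-- A diagonal entry at the word leading from `h^k x` back to `x` does not change with `k`, because
`blockDiag` reproduces it one step further along the orbit. On `C(K)` the state is evaluation at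
`x`. -/
lemma exists_orbitState (hN : 2 ≤ N) (x : K) : ∃ ω : γ.Core →ₚ[ℂ] ℂ,
    ∀ k (T : γ.unionCore) a, γ.Represents (0 + k) T a →
      ω (γ.incl T) = a (γ.orbitWord x k) (γ.orbitWord x k) (γ.h^[k] x) := by
  obtain ⟨φ, hφ⟩ := exists_linearMap_of_compatible (γ := γ) hN 0 (γ.orbitEntry x) fun k a => by
    change γ.blockDiag (0 + k) a (Fin.cons _ _) (Fin.cons _ _) _ = _
    rw [blockDiag_cons_cons, if_pos rfl, map_letter_iterate]
    rfl
  obtain ⟨ω, -, hω⟩ := exists_positive_extension φ (C := 1) (fun T => by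
    obtain ⟨M, hM⟩ := exists_mem_finiteCore T
    have hM' := finiteCore_mono (Nat.le_add_left M 0) hM
    obtain ⟨a, ha⟩ := exists_represents hN hM'
    rw [hφ M T a ha, one_mul]
    exact ha.norm_le hN (finiteCore_le_adjointableAt _ hM') _ _ _) (fun T => by
    obtain ⟨M, hM⟩ := exists_mem_finiteCore T
    have hM' := finiteCore_mono (Nat.le_add_left M 0) hM
    obtain ⟨a, ha⟩ := exists_represents hN hM'
    have hS' : (star T : γ.unionCore).1 ∈ γ.finiteCore (0 + M) := star_mem_iSup_compacts hM'
    obtain ⟨b, hb⟩ := exists_represents hN hS'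
    have h1 := ha.star hN (finiteCore_le_adjointableAt _ hM') hb
    rw [hφ M (star T * T) _ (hb.mul ha), h1]
    change 0 ≤ (∑ v, star (a v _) * a v _) _
    rw [ContinuousMap.sum_apply]
    exact Finset.sum_nonneg fun v _ => star_mul_self_nonneg _)
  exact ⟨ω, fun k T a ha => by rw [hω, hφ k T a ha]; rfl⟩

lemma represents_mulOp (n : ℕ) (c : C(K, ℂ)) : γ.Represents n (γ.mulOp c)
    (Matrix.diagonal fun w => c.comp ⟨γ.word n w, γ.continuous_word n w⟩) := fun f y w => by
  rw [mulOp_apply]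
  simp [Matrix.diagonal_apply, apply_ite (fun g : C(K, ℂ) => g y), ite_mul]

variable (γ) in
/-- A multiplication operator as an element of the union of the finite cores. -/
noncomputable def unionMulOp (c : C(K, ℂ)) : γ.unionCore := γ.unionRankOne 0 c 1

lemma coe_unionMulOp (c : C(K, ℂ)) : (γ.unionMulOp c : γ.adjointable) = γ.mulOp c := rfl

omit [CompactSpace K] in
lemma Represents.isBound {T : γ.adjointable}
    {a : Matrix (Fin n → Fin N) (Fin n → Fin N) C(K, ℂ)} (ha : γ.Represents n T a) {ε : ℝ}
    (hε : 0 ≤ ε) (h : ∀ w v y, ‖a w v y‖ ≤ ε) : γ.IsBound n T.1 ((N : ℝ) ^ n * (N : ℝ) ^ n * ε) :=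
  ⟨by positivity, fun f y => ha.norm_fibre_le (fun w v => h w v y) f⟩

/-- Excision of the state of a point whose orbit avoids the branch set. -/
lemma exists_excision {x : K} (hx : ∀ k, γ.h^[k] x ∉ γ.branchSet) {k : ℕ} {T : γ.unionCore}
    {a : Matrix (Fin (0 + k) → Fin N) (Fin (0 + k) → Fin N) C(K, ℂ)}
    (ha : γ.Represents (0 + k) T a) {ε : ℝ} (hε : 0 < ε) :
    ∃ c : C(K, ℝ), c x = 1 ∧ ‖((γ.unionMulOp c.ofRealC * T * γ.unionMulOp c.ofRealC -
      a (γ.orbitWord x k) (γ.orbitWord x k) (γ.h^[k] x) •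
        (γ.unionMulOp c.ofRealC * γ.unionMulOp c.ofRealC) : γ.unionCore) : γ.adjointable)‖ ≤ ε := by
  set W := γ.orbitWord x k
  set t := a W W (γ.h^[k] x) with ht
  set D : ℝ := (N : ℝ) ^ (0 + k) * (N : ℝ) ^ (0 + k)
  have hD : 0 ≤ D := by positivity
  -- A function supported off `F` annihilates all rows and columns other than `W`, and is supported
  -- where the remaining entry is close to its value at `x`. The point `x` itself is not in `F`: as
  -- its orbit avoids `B_γ`, no other word of this length ends at `x`.
  let F : Set K := (⋃ w ∈ ({W}ᶜ : Set (Fin (0 + k) → Fin N)), Set.range (γ.word (0 + k) w)) ∪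
    {z | ε / (D + 1) ≤ ‖a W W (γ.h^[k] z) - t‖}
  have hF : IsClosed F := by
    refine IsClosed.union ((Set.toFinite _).isClosed_biUnion fun w _ =>
      (isCompact_range (γ.continuous_word _ w)).isClosed) (isClosed_le continuous_const ?_)
    have := γ.h.continuous.iterate k
    fun_prop
  have hxF : x ∉ F := by
    rintro (h | h)
    · obtain ⟨w, hw, y, hy⟩ := Set.mem_iUnion₂.1 h
      have hyx : y = γ.h^[k] x := by
        rw [← hy]
        exact (iterate_word_zero_add k w y).symm
      subst hyx
      exact hw (word_eq_of_iterate_notMem hx hy (word_orbitWord x k))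
    · rw [Set.mem_ofPred_eq, ht, sub_self, norm_zero] at h
      exact absurd h (not_le.2 (by positivity))
  obtain ⟨c, hc1, hc0, hcI⟩ := exists_bump hF hxF
  refine ⟨c, hc1, ?_⟩
  have hrep := ((represents_mulOp (γ := γ) (0 + k) c.ofRealC).mul ha).mul
    (represents_mulOp (0 + k) c.ofRealC) |>.sub
    (((represents_mulOp (γ := γ) (0 + k) c.ofRealC).mul
      (represents_mulOp (0 + k) c.ofRealC)).smul t)
  refine (norm_le (hrep.isBound (ε := ε / (D + 1)) (by positivity) fun w v y => ?_)).trans ?_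
  · rw [Matrix.sub_apply, Matrix.smul_apply, Matrix.mul_diagonal, Matrix.diagonal_mul,
      Matrix.diagonal_mul_diagonal, Matrix.diagonal_apply]
    have hnot : ∀ w ≠ W, c (γ.word (0 + k) w y) = 0 := fun w hw =>
      hc0 _ (Or.inl (Set.mem_iUnion₂.2 ⟨w, hw, y, rfl⟩))
    have hpos : 0 ≤ ε / (D + 1) := by positivity
    by_cases hw : w = W
    · by_cases hv : v = W
      · rw [hw, hv, if_pos rfl]
        have e : (c.ofRealC.comp ⟨γ.word (0 + k) W, γ.continuous_word (0 + k) W⟩ * a W W *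
          c.ofRealC.comp ⟨γ.word (0 + k) W, γ.continuous_word (0 + k) W⟩ - t •
          (c.ofRealC.comp ⟨γ.word (0 + k) W, γ.continuous_word (0 + k) W⟩ *
          c.ofRealC.comp ⟨γ.word (0 + k) W, γ.continuous_word (0 + k) W⟩)) y =
          (c (γ.word (0 + k) W y) : ℂ) * (c (γ.word (0 + k) W y) : ℂ) * (a W W y - t) := by
          simp only [ContinuousMap.sub_apply, ContinuousMap.mul_apply, ContinuousMap.smul_apply,
            ContinuousMap.comp_apply, ContinuousMap.coe_mk, ContinuousMap.ofRealC_apply,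
            smul_eq_mul]
          ring
        rw [e, norm_mul, norm_mul, Complex.norm_real, Real.norm_of_nonneg (hcI _).1]
        by_cases hz : γ.word (0 + k) W y ∈ F
        · rw [hc0 _ hz, zero_mul, zero_mul]
          exact hpos
        · have h1 : ‖a W W y - t‖ < ε / (D + 1) := by
            have h2 : ¬ ε / (D + 1) ≤ ‖a W W (γ.h^[k] (γ.word (0 + k) W y)) - t‖ :=
              fun h => hz (Or.inr h)
            have h3 : γ.h^[k] (γ.word (0 + k) W y) = y := iterate_word_zero_add k W y
            rw [h3] at h2
            exact not_le.1 h2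
          have h2 : c (γ.word (0 + k) W y) * c (γ.word (0 + k) W y) ≤ 1 :=
            mul_le_one₀ (hcI _).2 (hcI _).1 (hcI _).2
          calc _ ≤ 1 * ‖a W W y - t‖ := by gcongr
            _ ≤ _ := by rw [one_mul]; exact h1.le
      · rw [if_neg (by rw [hw]; exact Ne.symm hv), smul_zero, sub_zero]
        simp [hnot v hv, hpos]
    · have e1 := hnot w hw
      by_cases hwv : w = v
      · subst hwv
        simp [e1, hpos]
      · simp [e1, hpos, hwv]
  · change D * (ε / (D + 1)) ≤ ε
    rw [mul_div_assoc', div_le_iff₀ (by positivity), mul_comm]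
    gcongr
    linarith

variable (γ) in
omit [CompactSpace K] in
/-- There is a point whose forward orbit avoids the branch set. -/
lemma exists_iterate_notMem_branchSet [Nonempty K] : ∃ x, ∀ k, γ.h^[k] x ∉ γ.branchSet := by
  by_cases h : γ.branchSet.Nonempty
  · obtain ⟨b, hb⟩ := h
    exact ⟨γ.h b, fun k => iterate_notMem_branchSet hb k⟩
  · obtain ⟨x⟩ := ‹Nonempty K›
    exact ⟨x, fun k hk => h ⟨_, hk⟩⟩

/-- The zero ideal of the core is primitive. -/
theorem bot_mem_primitiveIdeals [Nonempty K] (hN : 2 ≤ N) :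
    (⊥ : Ideal γ.Core) ∈ primitiveIdeals γ.Core := by
  obtain ⟨x, hx⟩ := γ.exists_iterate_notMem_branchSet
  obtain ⟨ω, hω⟩ := exists_orbitState (γ := γ) hN x
  have hmul : ∀ c : C(K, ℂ), ω (γ.incl (γ.unionMulOp c)) = c x := fun c => by
    rw [hω 0 _ _ (represents_mulOp 0 c), Matrix.diagonal_apply_eq]
    rfl
  have h1 : ω 1 = 1 := by
    rw [← incl_one, hω 0 1 1 represents_one, Matrix.one_apply_eq]
    rfl
  refine ⟨ω.GNS, _, _, _, ω.gnsStarAlgHom, ω.isIrreducibleRep_gns h1 denseRange_incl ?_, fun a => ?_⟩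
  · rintro _ ⟨T, rfl⟩ ε hε
    obtain ⟨M, hM⟩ := exists_mem_finiteCore T
    have hM' := finiteCore_mono (Nat.le_add_left M 0) hM
    obtain ⟨a, ha⟩ := exists_represents hN hM'
    obtain ⟨c, hc, hcn⟩ := exists_excision hx ha hε
    have hstar : star (γ.unionMulOp c.ofRealC) = γ.unionMulOp c.ofRealC := by
      refine Subtype.ext (Subtype.ext (star_eq (n := 0) (T := γ.mulOp c.ofRealC) fun f g => ?_))
      ext y
      simp only [coe_unionMulOp, mulOp_apply, innerX, ContinuousMap.coe_mk,
        ContinuousMap.mul_apply, ContinuousMap.ofRealC_apply, star_mul']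
      refine Finset.sum_congr rfl fun w _ => ?_
      rw [Complex.star_def, Complex.conj_ofReal]
      ring
    refine ⟨γ.incl (γ.unionMulOp c.ofRealC), by rw [← incl_star, hstar], ?_, ?_⟩
    · have h2 : star (γ.incl (γ.unionMulOp c.ofRealC) - 1) * (γ.incl (γ.unionMulOp c.ofRealC) - 1)
          = γ.incl (γ.unionMulOp ((c.ofRealC - 1) * (c.ofRealC - 1))) := by
        have h3 : γ.incl (γ.unionMulOp c.ofRealC) - 1 = γ.incl (γ.unionMulOp c.ofRealC - 1) := by
          rw [incl_sub, incl_one]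
        rw [h3, ← incl_star, star_sub, hstar, star_one, ← incl_mul]
        congr 1
        refine Subtype.ext (adjointable_ext fun f y => ?_)
        have e : ∀ g : C(K, ℂ), (γ.unionMulOp c.ofRealC - 1 : γ.unionCore).1.1 g =
            c.ofRealC * g - g := fun g => by
          rw [← mulOp_apply (γ := γ)]
          rfl
        change (γ.unionMulOp c.ofRealC - 1 : γ.unionCore).1.1
          ((γ.unionMulOp c.ofRealC - 1 : γ.unionCore).1.1 f) y = _
        rw [e, e, coe_unionMulOp, mulOp_apply]
        simp
        ring
      rw [h2, hmul]
      simp [hc]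
    · rw [hω M T a ha, ← incl_mul, ← incl_mul, ← incl_mul, ← incl_smul, ← incl_sub, norm_incl]
      exact hcn
  · rw [Ideal.mem_bot]
    -- Faithfulness: the matrix of `θ_{1,1}` has all entries 1, so the state is 1 on this element of
    -- `K(X^{⊗ m})`, for every `m`.
    refine ⟨fun h => by rw [h, map_zero], fun h => eq_zero_of_frequently fun m₀ =>
      ⟨0 + m₀, by omega, ω.GNS, _, _, _, ω.gnsStarAlgHom, ⟨1, 1, fun h0 => ?_⟩, h⟩⟩
    have h2 := ω.inner_cyclicVector_gns (γ.incl (γ.unionRankOne (0 + m₀) 1 1))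
    rw [h0, hω m₀ _ _ (represents_rankOne (0 + m₀) 1 1)] at h2
    simp at h2

end BranchedMap

namespace BranchedMap

variable {K : Type u} [MetricSpace K] {N : ℕ} {γ : BranchedMap K N} {n m : ℕ} [CompactSpace K]

/-! ### The primitive ideal space -/

/-- The kernel of `discreteRep hN hb n`. -/
noncomputable def discreteIdeal (hN : 2 ≤ N) {b : K} (hb : b ∈ γ.branchSet) (n : ℕ) :
    Ideal γ.Core :=
  RingHom.ker (γ.discreteRep hN hb n)

instance isTwoSided_discreteIdeal (hN : 2 ≤ N) {b : K} (hb : b ∈ γ.branchSet) :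
    (γ.discreteIdeal hN hb n).IsTwoSided :=
  inferInstanceAs (RingHom.ker (γ.discreteRep hN hb n)).IsTwoSided

lemma coe_discreteIdeal (hN : 2 ≤ N) {b : K} (hb : b ∈ γ.branchSet) :
    (γ.discreteIdeal hN hb n : Set γ.Core) = γ.coreIdeal b n :=
  Set.ext fun _ => (mem_coreIdeal_iff hN hb).symm

end BranchedMap

/-- Reindexing of matrices along a bijection, as a homomorphism of `*`-algebras. -/
def Matrix.reindexStarAlgHom {ι κ : Type*} [Fintype ι] [Fintype κ] [DecidableEq ι] [DecidableEq κ]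
    (e : ι ≃ κ) : Matrix ι ι ℂ →⋆ₐ[ℂ] Matrix κ κ ℂ :=
  { (Matrix.reindexAlgEquiv ℂ ℂ e : Matrix ι ι ℂ →ₐ[ℂ] Matrix κ κ ℂ) with
    map_star' := fun M => (Matrix.conjTranspose_reindex e e M).symm }

namespace BranchedMap

variable {K : Type u} [MetricSpace K] {N : ℕ} {γ : BranchedMap K N} {n m : ℕ} [CompactSpace K]

lemma discreteIdeal_mem_primitiveIdeals (hN : 2 ≤ N) {b : K} (hb : b ∈ γ.branchSet) (n : ℕ) :
    γ.discreteIdeal hN hb n ∈ primitiveIdeals γ.Core := by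
  -- The index set is lifted because `primitiveIdeals` asks for a Hilbert space in the universe of
  -- the core.
  let e : (Fin n → Fin N) ≃ ULift.{u} (Fin n → Fin N) := Equiv.ulift.symm
  have : Nonempty (ULift.{u} (Fin n → Fin N)) := ⟨⟨fun _ => ⟨0, by omega⟩⟩⟩
  have hinj : Function.Injective (Matrix.reindexStarAlgHom e) :=
    (Matrix.reindexAlgEquiv ℂ ℂ e).injective
  have hsurj : Function.Surjective (Matrix.reindexStarAlgHom e) :=
    (Matrix.reindexAlgEquiv ℂ ℂ e).surjective
  let ρ := (Matrix.reindexStarAlgHom e).comp (γ.discreteRep hN hb n)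
  have hρ : Function.Surjective ρ := hsurj.comp (surjective_discreteRep hN hb n)
  refine ⟨_, _, _, _, _, isIrreducibleRep_toEuclideanCLM hρ, fun a => ?_⟩
  change γ.discreteRep hN hb n a = 0 ↔
    euclideanRep _ (Matrix.reindexStarAlgHom e (γ.discreteRep hN hb n a)) = 0
  rw [map_eq_zero_iff _ euclideanRep_injective, map_eq_zero_iff _ hinj]

lemma eq_discreteIdeal_of_le (hN : 2 ≤ N) {b : K} (hb : b ∈ γ.branchSet) {P : Ideal γ.Core}
    (hP : P ∈ primitiveIdeals γ.Core) (h : γ.discreteIdeal hN hb n ≤ P) :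
    P = γ.discreteIdeal hN hb n := by
  obtain ⟨H, _, _, _, π, hπ, hPπ⟩ := hP
  refine le_antisymm (fun x hx => ?_) h
  exact ker_eq_of_surjective_matrix (ρ := (γ.discreteRep hN hb n).toAlgHom)
    (surjective_discreteRep hN hb n) (φ := π.toAlgHom) hπ.map_one_ne_zero
    (fun y hy => (hPπ y).1 (h hy)) ((hPπ x).1 hx)

lemma map_eq_zero_of_mem_compacts {H : Type*} [NormedAddCommGroup H] [InnerProductSpace ℂ H]
    [CompleteSpace H] (π : γ.Core →⋆ₐ[ℂ] (H →L[ℂ] H))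
    (h : ∀ f g, π (γ.incl (γ.unionRankOne m f g)) = 0) {T : γ.unionCore}
    (hT : (T : γ.adjointable) ∈ γ.compacts m) : π (γ.incl T) = 0 := by
  have h1 : ∀ R ∈ γ.finiteRank m, ∃ S : γ.unionCore, S.1 = R ∧ π (γ.incl S) = 0 := by
    intro R hR
    induction hR using Submodule.span_induction with
    | mem x hx =>
      obtain ⟨f, g, rfl⟩ := hx
      exact ⟨γ.unionRankOne m f g, rfl, h f g⟩
    | zero => exact ⟨0, rfl, by rw [incl_zero, map_zero]⟩
    | add x y _ _ hx hy =>
      obtain ⟨S, rfl, hS⟩ := hx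
      obtain ⟨S', rfl, hS'⟩ := hy
      exact ⟨S + S', rfl, by rw [incl_add, map_add, hS, hS', add_zero]⟩
    | smul c x _ hx =>
      obtain ⟨S, rfl, hS⟩ := hx
      exact ⟨c • S, rfl, by rw [incl_smul, map_smul, hS, smul_zero]⟩
  rw [← norm_le_zero_iff]
  refine le_of_forall_pos_le_add fun ε hε => ?_
  obtain ⟨R, hR, hd⟩ := Metric.mem_closure_iff.1 hT ε hε
  obtain ⟨S, rfl, hS⟩ := h1 R hR
  have h2 : π (γ.incl T) = π (γ.incl (S - T)) * (-1) := by
    rw [incl_sub, map_sub, hS, zero_sub, mul_neg_one, neg_neg]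
  have h3 : ‖π (γ.incl (S - T))‖ ≤ ε := by
    refine (norm_rep_le π _).trans ?_
    rw [norm_incl]
    rw [dist_comm, SeminormedRing.dist_eq] at hd
    refine le_of_eq_of_le ?_ hd.le
    rw [← norm_neg']
    congr 1
    simp
    abel
  rw [h2, mul_neg_one, norm_neg, zero_add]
  exact h3

/-- A primitive ideal of the core is zero or the kernel of the representation of a branch point. -/
theorem eq_bot_or_eq_discreteIdeal (hN : 2 ≤ N) {P : Ideal γ.Core}
    (hP : P ∈ primitiveIdeals γ.Core) :
    P = ⊥ ∨ ∃ b, ∃ hb : b ∈ γ.branchSet, ∃ n, P = γ.discreteIdeal hN hb n := by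
  have hP' := hP
  obtain ⟨H, _, _, _, π, hπ, hPπ⟩ := hP'
  by_cases h : ∀ m₀, ∃ m ≥ m₀, ∃ f g, π (γ.incl (γ.unionRankOne m f g)) ≠ 0
  · left
    rw [eq_bot_iff]
    intro x hx
    refine eq_zero_of_frequently fun m₀ => ?_
    obtain ⟨m, hm, hfg⟩ := h m₀
    exact ⟨m, hm, H, _, _, _, π, hfg, (hPπ x).1 hx⟩
  · right
    -- Here `π` annihilates the compacts of all levels from `m₀` on. The closure of `tail m₀` is the
    -- intersection of finitely many kernels, so by primeness one of these is contained in the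
    -- kernel of `π`, and by maximality equals it.
    push Not at h
    obtain ⟨m₀, h⟩ := h
    have := γ.finite_branchSet.fintype
    let I : γ.branchSet × Fin (m₀ + 1) → Ideal γ.Core := fun i => γ.discreteIdeal hN i.1.2 i.2.1
    have : ∀ i, (I i).IsTwoSided := fun i => isTwoSided_discreteIdeal hN i.1.2
    obtain ⟨i, -, hi⟩ := hπ.exists_le I Finset.univ fun x hx => by
      have h1 : x ∈ closure (γ.incl '' {T | (T : γ.adjointable) ∈ γ.tail m₀}) :=
        mem_closure_tail hN fun b hb k hk =>
          hx (⟨b, hb⟩, ⟨k, Nat.lt_succ_iff.2 hk⟩) (Finset.mem_univ _)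
      refine closure_minimal ?_ (isClosed_eq (continuous_rep π) continuous_const) h1
      rintro _ ⟨T, hT, rfl⟩
      exact map_eq_zero_of_mem_tail (φ := π.toAlgHom.toLinearMap ∘ₗ
        (toCore (γ := γ)).toAlgHom.toLinearMap)
        (fun m hm T hT => map_eq_zero_of_mem_compacts π (h m hm.le) hT) hT
    exact ⟨i.1.1, i.1.2, i.2.1, eq_discreteIdeal_of_le hN i.1.2 hP fun x hx =>
      (hPπ x).2 (hi x hx)⟩

theorem image_primitiveIdeals [Nonempty K] (hN : 2 ≤ N) :
    (fun P : Ideal γ.Core => (P : Set γ.Core)) '' primitiveIdeals γ.Core =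
      insert {0} {J | ∃ b ∈ γ.branchSet, ∃ n, J = γ.coreIdeal b n} := by
  ext J
  constructor
  · rintro ⟨P, hP, rfl⟩
    rcases eq_bot_or_eq_discreteIdeal hN hP with rfl | ⟨b, hb, n, rfl⟩
    · exact Or.inl rfl
    · exact Or.inr ⟨b, hb, n, coe_discreteIdeal hN hb⟩
  · rintro (rfl | ⟨b, hb, n, rfl⟩)
    · exact ⟨⊥, bot_mem_primitiveIdeals hN, rfl⟩
    · exact ⟨_, discreteIdeal_mem_primitiveIdeals hN hb n, coe_discreteIdeal hN hb⟩

/-- A nonzero element of the core is contained in finitely many of the ideals of the branch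
points. -/
lemma exists_forall_discreteRep_ne_zero (hN : 2 ≤ N) {x : γ.Core} (hx : x ≠ 0) :
    ∃ m₀, ∀ m ≥ m₀, ∀ b (hb : b ∈ γ.branchSet), γ.discreteRep hN hb m x ≠ 0 := by
  by_contra! h
  -- The Euclidean spaces used here live in universe 0, not in that of the core.
  refine hx (eq_zero_of_frequently.{u, 0} fun m₀ => ?_)
  obtain ⟨m, hm, b, hb, hρ⟩ := h m₀
  refine ⟨m, hm, EuclideanSpace ℂ (Fin m → Fin N), _, _, inferInstance,
    (euclideanRep _).comp (γ.discreteRep hN hb m), ?_, ?_⟩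
  · obtain ⟨f, g, hfg⟩ := exists_unionRankOne_discreteRep_ne_zero hN hb m
    exact ⟨f, g, fun h0 => hfg ((map_eq_zero_iff _ euclideanRep_injective).1 h0)⟩
  · change euclideanRep _ (γ.discreteRep hN hb m x) = 0
    rw [hρ, map_zero]

lemma finite_le_of_ne_bot (hN : 2 ≤ N) {I : Ideal γ.Core} (hI : I ≠ ⊥) :
    {P : primitiveIdeals γ.Core | I ≤ (P : Ideal γ.Core)}.Finite := by
  obtain ⟨x, hx, hx0⟩ := Submodule.exists_mem_ne_zero_of_ne_bot hI
  obtain ⟨m₀, hm₀⟩ := exists_forall_discreteRep_ne_zero hN hx0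
  have := γ.finite_branchSet.fintype
  refine ((Set.finite_range fun i : γ.branchSet × Fin m₀ =>
    (⟨γ.discreteIdeal hN i.1.2 i.2.1, discreteIdeal_mem_primitiveIdeals hN i.1.2 i.2.1⟩ :
      primitiveIdeals γ.Core))).subset fun P hP => ?_
  have hxP : x ∈ (P : Ideal γ.Core) := hP hx
  rcases eq_bot_or_eq_discreteIdeal hN P.2 with h | ⟨b, hb, n, h⟩
  · rw [h] at hxP
    exact absurd hxP hx0
  · rw [h] at hxP
    have hn : n < m₀ := not_le.1 fun hn => hm₀ n hn b hb hxP
    exact ⟨(⟨b, hb⟩, ⟨n, hn⟩), Subtype.ext h.symm⟩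

/-- The open sets of the primitive ideal space are the empty set and the cofinite sets that contain
the zero ideal. -/
theorem isOpen_primitiveIdeals_iff [Nonempty K] (hN : 2 ≤ N) (U : Set (primitiveIdeals γ.Core)) :
    IsOpen[jacobsonTopology γ.Core] U ↔
      U = ∅ ∨ ((∃ P ∈ U, (P : Ideal γ.Core) = ⊥) ∧ Uᶜ.Finite) := by
  constructor
  · intro hU
    induction hU with
    | basic V hV =>
      obtain ⟨I, -, rfl⟩ := hV
      by_cases hI : I = ⊥
      · left
        ext P
        simp [hI]
      · right
        refine ⟨⟨⟨⊥, bot_mem_primitiveIdeals hN⟩, ?_, rfl⟩, ?_⟩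
        · rw [Set.mem_ofPred_eq, le_bot_iff]
          exact hI
        · convert finite_le_of_ne_bot hN hI using 1
          ext P
          simp
    | univ => exact Or.inr ⟨⟨⟨⊥, bot_mem_primitiveIdeals hN⟩, trivial, rfl⟩, by simp⟩
    | inter V W _ _ hV hW =>
      rcases hV with rfl | ⟨⟨P, hP, hP0⟩, hVf⟩
      · left; simp
      rcases hW with rfl | ⟨⟨Q, hQ, hQ0⟩, hWf⟩
      · left; simp
      right
      have hPQ : P = Q := Subtype.ext (hP0.trans hQ0.symm)
      refine ⟨⟨P, ⟨hP, hPQ ▸ hQ⟩, hP0⟩, ?_⟩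
      rw [Set.compl_inter]
      exact hVf.union hWf
    | sUnion S _ hS =>
      by_cases h : ∃ V ∈ S, V ≠ ∅
      · obtain ⟨V, hVS, hV⟩ := h
        obtain ⟨⟨P, hP, hP0⟩, hf⟩ := (hS V hVS).resolve_left hV
        exact Or.inr ⟨⟨P, ⟨V, hVS, hP⟩, hP0⟩,
          hf.subset (Set.compl_subset_compl.2 (Set.subset_sUnion_of_mem hVS))⟩
      · push Not at h
        left
        rw [Set.sUnion_eq_empty]
        exact h
  · let _ := jacobsonTopology γ.Core
    rintro (rfl | ⟨⟨P, hP, hP0⟩, hf⟩)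
    · exact isOpen_empty
    · have h1 : U = ⋂ Q ∈ Uᶜ, {P : primitiveIdeals γ.Core |
          ¬ (Q : Ideal γ.Core) ≤ (P : Ideal γ.Core)} := by
        ext R
        simp only [Set.mem_iInter, Set.mem_ofPred_eq]
        constructor
        · intro hR Q hQ hQR
          rcases eq_bot_or_eq_discreteIdeal hN Q.2 with h | ⟨b, hb, n, h⟩
          · exact hQ ((Subtype.ext (hP0.trans h.symm) : P = Q) ▸ hP)
          · have h2 := eq_discreteIdeal_of_le hN hb R.2 (h ▸ hQR)
            exact hQ ((Subtype.ext (h2.trans h.symm) : R = Q) ▸ hR)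
        · intro h
          by_contra hR
          exact h R hR le_rfl
      rw [h1]
      refine hf.isOpen_biInter fun Q hQ => TopologicalSpace.isOpen_generateFrom_of_mem
        ⟨Q, ?_, rfl⟩
      rcases eq_bot_or_eq_discreteIdeal hN Q.2 with h | ⟨b, hb, n, h⟩
      · exact absurd ((Subtype.ext (hP0.trans h.symm) : P = Q) ▸ hP) hQ
      · rw [h]
        infer_instance

end BranchedMap

/-! ### Tracial vectors -/

section TracialVector

variable {A : Type u} [CStarAlgebra A] {H : Type u} [NormedAddCommGroup H] [InnerProductSpace ℂ H]
  [CompleteSpace H] {π : A →⋆ₐ[ℂ] (H →L[ℂ] H)} {Ω : H}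

lemma BranchedMap.rep_mul_apply {A : Type*} [CStarAlgebra A] {H : Type*} [NormedAddCommGroup H]
    [InnerProductSpace ℂ H] [CompleteSpace H] (π : A →⋆ₐ[ℂ] (H →L[ℂ] H)) (a b : A) (v : H) :
    π (a * b) v = π a (π b v) := by
  rw [map_mul, mul_apply_eq_comp]

lemma mem_generatedVN {m : H →L[ℂ] H} :
    m ∈ generatedVN π ↔ ∀ s : H →L[ℂ] H, (∀ a, π a * s = s * π a) → s * m = m * s := by
  have h1 : ∀ s : H →L[ℂ] H, s ∈ StarSubalgebra.centralizer ℂ (Set.range π) ↔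
      ∀ a, π a * s = s * π a := fun s => by
    rw [StarSubalgebra.mem_centralizer_iff]
    constructor
    · exact fun h a => (h _ ⟨a, rfl⟩).1
    · rintro h _ ⟨a, rfl⟩
      rw [← map_star]
      exact ⟨h a, h _⟩
  change m ∈ StarSubalgebra.centralizer ℂ
    (StarSubalgebra.centralizer ℂ (Set.range π) : Set (H →L[ℂ] H)) ↔ _
  rw [StarSubalgebra.mem_centralizer_iff]
  constructor
  · exact fun h s hs => (h s ((h1 s).2 hs)).1
  · intro h s hs
    exact ⟨h s ((h1 s).1 hs), h _ ((h1 _).1 (star_mem hs))⟩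

lemma map_mem_generatedVN (a : A) : π a ∈ generatedVN π :=
  mem_generatedVN.2 fun _ hs => (hs a).symm

lemma mem_commutant_generatedVN {s : H →L[ℂ] H} :
    s ∈ (generatedVN π).commutant ↔ ∀ a, π a * s = s * π a := by
  rw [VonNeumannAlgebra.mem_commutant_iff]
  exact ⟨fun h a => h _ (map_mem_generatedVN a), fun h g hg => (mem_generatedVN.1 hg s h).symm⟩

variable (π Ω) in
/-- A cyclic vector of a representation whose vector state is a trace. -/
structure IsTracialVector : Prop where
  dense : DenseRange fun a => π a Ω
  trace : ∀ a b, ⟪Ω, π (a * b) Ω⟫_ℂ = ⟪Ω, π (b * a) Ω⟫_ℂ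

namespace IsTracialVector

variable (hΩ : IsTracialVector π Ω)
include hΩ

lemma norm_star (a : A) : ‖π (star a) Ω‖ = ‖π a Ω‖ := by
  have h1 : ((‖π (star a) Ω‖ ^ 2 : ℝ) : ℂ) = ((‖π a Ω‖ ^ 2 : ℝ) : ℂ) := by
    rw [BranchedMap.norm_map_sq, BranchedMap.norm_map_sq, star_star, hΩ.trace]
  have h2 : ‖π (star a) Ω‖ ^ 2 = ‖π a Ω‖ ^ 2 := by exact_mod_cast h1
  exact (pow_left_inj₀ (norm_nonneg _) (norm_nonneg _) two_ne_zero).1 h2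

lemma norm_mul_le (a x : A) : ‖π (a * x) Ω‖ ≤ ‖x‖ * ‖π a Ω‖ := by
  rw [← hΩ.norm_star, star_mul, map_mul, mul_apply_eq_comp, ← hΩ.norm_star a]
  refine (ContinuousLinearMap.le_opNorm _ _).trans ?_
  gcongr
  exact (BranchedMap.norm_rep_le π _).trans (_root_.norm_star x).le

omit hΩ in
variable (π Ω) in
/-- The right multiplication by `x`, on the space of the representation. -/
noncomputable def rightMul (x : A) : H →L[ℂ] H :=
  LinearMap.extendOfNorm
    ({ toFun := fun a => π (a * x) Ω
       map_add' := fun a b => by rw [add_mul, map_add, add_apply]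
       map_smul' := fun c a => by rw [smul_mul_assoc, map_smul]; rfl } : A →ₗ[ℂ] H)
    ({ toFun := fun a => π a Ω
       map_add' := fun a b => by rw [map_add, add_apply]
       map_smul' := fun c a => by rw [map_smul]; rfl } : A →ₗ[ℂ] H)

lemma rightMul_apply (x a : A) : rightMul π Ω x (π a Ω) = π (a * x) Ω :=
  LinearMap.extendOfNorm_eq hΩ.dense ⟨‖x‖, fun a => hΩ.norm_mul_le a x⟩ a

lemma norm_rightMul_le (x : A) : ‖rightMul π Ω x‖ ≤ ‖x‖ :=
  LinearMap.opNorm_extendOfNorm_le hΩ.dense (norm_nonneg x) fun a => hΩ.norm_mul_le a x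

lemma ext {s t : H →L[ℂ] H} (h : ∀ a, s (π a Ω) = t (π a Ω)) : s = t :=
  DFunLike.coe_injective (hΩ.dense.equalizer s.continuous t.continuous (funext h))

lemma rightMul_mul (x y : A) : rightMul π Ω (x * y) = rightMul π Ω y * rightMul π Ω x :=
  hΩ.ext fun a => by
    rw [mul_apply_eq_comp, hΩ.rightMul_apply, hΩ.rightMul_apply, hΩ.rightMul_apply, mul_assoc]

lemma rightMul_add (x y : A) : rightMul π Ω (x + y) = rightMul π Ω x + rightMul π Ω y :=
  hΩ.ext fun a => by
    rw [add_apply, hΩ.rightMul_apply, hΩ.rightMul_apply, hΩ.rightMul_apply, mul_add, map_add,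
      add_apply]

lemma rightMul_smul (c : ℂ) (x : A) : rightMul π Ω (c • x) = c • rightMul π Ω x :=
  hΩ.ext fun a => by
    rw [smul_apply, hΩ.rightMul_apply, hΩ.rightMul_apply, mul_smul_comm, map_smul, smul_apply]

lemma rightMul_vector (x : A) : rightMul π Ω x Ω = π x Ω := by
  have := hΩ.rightMul_apply x 1
  rwa [map_one, one_apply_eq_self, one_mul] at this

lemma map_mul_rightMul (x a : A) : π a * rightMul π Ω x = rightMul π Ω x * π a :=
  hΩ.ext fun b => by
    rw [mul_apply_eq_comp, mul_apply_eq_comp, hΩ.rightMul_apply, ← BranchedMap.rep_mul_apply,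
      ← BranchedMap.rep_mul_apply, hΩ.rightMul_apply, mul_assoc]

lemma inner_rightMul (x : A) (v w : H) :
    ⟪rightMul π Ω x v, w⟫_ℂ = ⟪v, rightMul π Ω (star x) w⟫_ℂ := by
  refine hΩ.dense.induction_on₂ (p := fun v w =>
    ⟪rightMul π Ω x v, w⟫_ℂ = ⟪v, rightMul π Ω (star x) w⟫_ℂ)
    (isClosed_eq (by fun_prop) (by fun_prop)) (fun a b => ?_) v w
  rw [hΩ.rightMul_apply, hΩ.rightMul_apply, BranchedMap.inner_map_self,
    BranchedMap.inner_map_self, ← mul_apply_eq_comp, ← map_mul, ← mul_apply_eq_comp, ← map_mul,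
    star_mul, mul_assoc, hΩ.trace, mul_assoc]

lemma star_rightMul (x : A) : star (rightMul π Ω x) = rightMul π Ω (star x) := by
  rw [ContinuousLinearMap.star_eq_adjoint]
  refine ((ContinuousLinearMap.eq_adjoint_iff _ _).2 fun v w => ?_).symm
  rw [hΩ.inner_rightMul, star_star]

lemma rightMul_comm {m : H →L[ℂ] H} (hm : m ∈ generatedVN π) (x : A) (v : H) :
    rightMul π Ω x (m v) = m (rightMul π Ω x v) :=
  congrArg (fun s : H →L[ℂ] H => s v) (mem_generatedVN.1 hm _ (hΩ.map_mul_rightMul x))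

/-- The hypothesis says that `η = J ξ` for the antiunitary `J` extending `aΩ ↦ a*Ω`. In this form
`J` need not be constructed. -/
lemma norm_le_of_inner {ξ η : H} (h : ∀ a, ⟪η, π a Ω⟫_ℂ = ⟪π (star a) Ω, ξ⟫_ℂ) : ‖η‖ ≤ ‖ξ‖ := by
  have h1 : ∀ v, ‖⟪η, v⟫_ℂ‖ ≤ ‖ξ‖ * ‖v‖ := fun v => by
    refine hΩ.dense.induction_on v (isClosed_le (by fun_prop) (by fun_prop)) fun a => ?_
    rw [h, mul_comm, ← hΩ.norm_star]
    exact norm_inner_le_norm _ _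
  have h2 := h1 η
  rw [BranchedMap.norm_inner_self_eq] at h2
  rcases eq_or_ne ‖η‖ 0 with h0 | h0
  · rw [h0]; exact norm_nonneg _
  · exact le_of_mul_le_mul_right h2 (lt_of_le_of_ne (norm_nonneg _) h0.symm)

lemma inner_star_vector {m : H →L[ℂ] H} (hm : m ∈ generatedVN π) (a : A) :
    ⟪star m Ω, π a Ω⟫_ℂ = ⟪π (star a) Ω, m Ω⟫_ℂ := by
  rw [ContinuousLinearMap.star_eq_adjoint, ContinuousLinearMap.adjoint_inner_left,
    ← hΩ.rightMul_vector a, ← hΩ.rightMul_comm hm, ← hΩ.rightMul_vector (star a),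
    hΩ.inner_rightMul, star_star]

lemma norm_star_vector {m : H →L[ℂ] H} (hm : m ∈ generatedVN π) : ‖star m Ω‖ = ‖m Ω‖ := by
  refine le_antisymm (hΩ.norm_le_of_inner (hΩ.inner_star_vector hm)) ?_
  have h := hΩ.norm_le_of_inner (hΩ.inner_star_vector (star_mem hm))
  rwa [star_star] at h

/-- `Ω` is separating: it is cyclic for the right multiplications, which commute with the von
Neumann algebra. -/
lemma eq_of_apply_eq {m m' : H →L[ℂ] H} (hm : m ∈ generatedVN π) (hm' : m' ∈ generatedVN π)
    (h : m Ω = m' Ω) : m = m' :=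
  hΩ.ext fun a => by
    rw [← hΩ.rightMul_vector, ← hΩ.rightMul_comm hm, ← hΩ.rightMul_comm hm', h]

/-- Isometries in the von Neumann algebra generated by a tracial representation are unitary. -/
lemma mul_star_eq_one {u : H →L[ℂ] H} (hu : u ∈ generatedVN π) (h : star u * u = 1) :
    u * star u = 1 := by
  have h1 : ‖star u Ω‖ ^ 2 = ‖Ω‖ ^ 2 := by
    rw [hΩ.norm_star_vector hu]
    have h2 : ((‖u Ω‖ ^ 2 : ℝ) : ℂ) = ((‖Ω‖ ^ 2 : ℝ) : ℂ) := by
      have h3 := congrArg (fun s : H →L[ℂ] H => ⟪Ω, s Ω⟫_ℂ) h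
      simp only [mul_apply_eq_comp, one_apply_eq_self, ContinuousLinearMap.star_eq_adjoint,
        ContinuousLinearMap.adjoint_inner_right, inner_self_eq_norm_sq_to_K] at h3
      exact_mod_cast h3
    exact_mod_cast h2
  -- As `Ω` is separating, it suffices that `u u* Ω = Ω`. The square of the distance is `‖u*Ω‖² -
  -- 2‖u*Ω‖² + ‖Ω‖²`, which vanishes since `‖u*Ω‖ = ‖uΩ‖ = ‖Ω‖`.
  refine hΩ.eq_of_apply_eq (mul_mem hu (star_mem hu)) (one_mem _) ?_
  have h3 : ‖u (star u Ω)‖ = ‖star u Ω‖ := by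
    have h4 : ((‖u (star u Ω)‖ ^ 2 : ℝ) : ℂ) = ((‖star u Ω‖ ^ 2 : ℝ) : ℂ) := by
      have h5 := congrArg (fun s : H →L[ℂ] H => ⟪star u Ω, s (star u Ω)⟫_ℂ) h
      simp only [mul_apply_eq_comp, one_apply_eq_self] at h5
      rw [ContinuousLinearMap.star_eq_adjoint u] at h5 ⊢
      rw [ContinuousLinearMap.adjoint_inner_right, inner_self_eq_norm_sq_to_K,
        inner_self_eq_norm_sq_to_K] at h5
      exact_mod_cast h5
    have h6 : ‖u (star u Ω)‖ ^ 2 = ‖star u Ω‖ ^ 2 := by exact_mod_cast h4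
    exact (pow_left_inj₀ (norm_nonneg _) (norm_nonneg _) two_ne_zero).1 h6
  rw [mul_apply_eq_comp, one_apply_eq_self, ← sub_eq_zero, ← norm_eq_zero,
    ← sq_eq_zero_iff, norm_sub_sq (𝕜 := ℂ), h3, h1]
  have h7 : ⟪u (star u Ω), Ω⟫_ℂ = ((‖star u Ω‖ ^ 2 : ℝ) : ℂ) := by
    rw [ContinuousLinearMap.star_eq_adjoint, ← ContinuousLinearMap.adjoint_inner_right,
      inner_self_eq_norm_sq_to_K]
    simp
  rw [h7, h1, RCLike.re_eq_complex_re, Complex.ofReal_re]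
  ring

/-- The commutation theorem for the right multiplications of a tracial representation. -/
theorem mem_generatedVN_of_commute {x : H →L[ℂ] H}
    (hx : ∀ a, rightMul π Ω a * x = x * rightMul π Ω a) : x ∈ generatedVN π := by
  have hx' : ∀ a v, rightMul π Ω a (x v) = x (rightMul π Ω a v) := fun a v =>
    congrArg (fun s : H →L[ℂ] H => s v) (hx a)
  have hxs : ∀ a v, rightMul π Ω a (star x v) = star x (rightMul π Ω a v) := fun a v => by
    have h1 := congrArg star (hx (star a))
    rw [star_mul, star_mul, hΩ.star_rightMul, star_star] at h1
    exact (congrArg (fun s : H →L[ℂ] H => s v) h1).symm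
  have hxJ : ∀ a, ⟪star x Ω, π a Ω⟫_ℂ = ⟪π (star a) Ω, x Ω⟫_ℂ := fun a => by
    rw [ContinuousLinearMap.star_eq_adjoint, ContinuousLinearMap.adjoint_inner_left,
      ← hΩ.rightMul_vector a, ← hx', ← hΩ.rightMul_vector (star a), hΩ.inner_rightMul, star_star]
  refine mem_generatedVN.2 fun s hs => ?_
  have hs' : ∀ a v, π a (s v) = s (π a v) := fun a v =>
    congrArg (fun s : H →L[ℂ] H => s v) (hs a)
  have hss : ∀ a v, π a (star s v) = star s (π a v) := fun a v => by
    have h1 := congrArg star (hs (star a))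
    rw [star_mul, star_mul, ← map_star, star_star] at h1
    exact (congrArg (fun s : H →L[ℂ] H => s v) h1).symm
  have hsJ : ∀ a, ⟪star s Ω, π a Ω⟫_ℂ = ⟪π (star a) Ω, s Ω⟫_ℂ := fun a => by
    rw [ContinuousLinearMap.star_eq_adjoint, ContinuousLinearMap.adjoint_inner_left, ← hs',
      BranchedMap.inner_map_self, star_star]
  -- The vector `sΩ` is approximated by `y_k Ω` with `y_k ∈ A`; then `y_k* Ω` tends to `s*Ω`,
  -- because taking adjoints is isometric on these vectors.
  obtain ⟨y, hy⟩ : ∃ y : ℕ → A, Filter.Tendsto (fun k => π (y k) Ω) Filter.atTop (𝓝 (s Ω)) := by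
    obtain ⟨v, hv, h⟩ := mem_closure_iff_seq_limit.1 (hΩ.dense (s Ω))
    choose y hy using hv
    exact ⟨y, by simpa only [hy] using h⟩
  have hys : Filter.Tendsto (fun k => π (star (y k)) Ω) Filter.atTop (𝓝 (star s Ω)) := by
    rw [tendsto_iff_norm_sub_tendsto_zero] at hy ⊢
    refine squeeze_zero (fun _ => norm_nonneg _) (fun k => hΩ.norm_le_of_inner fun a => ?_) hy
    rw [inner_sub_left, inner_sub_right, hsJ, BranchedMap.inner_map_self, star_star,
      ← BranchedMap.rep_mul_apply, hΩ.trace, BranchedMap.rep_mul_apply,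
      BranchedMap.inner_map_self π (star a) Ω (π (y k) Ω), star_star]
  refine hΩ.ext fun a => hΩ.dense.eq_of_inner_left ℂ fun b => ?_
  -- Matrix coefficients of `x s` and `s x` are expressed through `sΩ` and `s*Ω` alone. With `y_k`
  -- in place of `s` the two expressions agree by `hxJ` for the element `a y_k b*`, and the equality
  -- passes to the limit.
  have e1 : ⟪(x * s) (π a Ω), π b Ω⟫_ℂ = ⟪rightMul π Ω (star b) (π a (s Ω)), star x Ω⟫_ℂ := by
    rw [mul_apply_eq_comp, ← hs', hΩ.inner_rightMul, star_star, hxs, hΩ.rightMul_vector,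
      ContinuousLinearMap.star_eq_adjoint, ContinuousLinearMap.adjoint_inner_right]
  have e2 : ⟪(s * x) (π a Ω), π b Ω⟫_ℂ = ⟪x Ω, rightMul π Ω (star a) (π b (star s Ω))⟫_ℂ := by
    rw [mul_apply_eq_comp, hss, ← hΩ.inner_rightMul, hx', hΩ.rightMul_vector,
      ContinuousLinearMap.star_eq_adjoint, ContinuousLinearMap.adjoint_inner_right]
  rw [e1, e2]
  have l1 : Filter.Tendsto (fun k => ⟪rightMul π Ω (star b) (π a (π (y k) Ω)), star x Ω⟫_ℂ)
      Filter.atTop (𝓝 ⟪rightMul π Ω (star b) (π a (s Ω)), star x Ω⟫_ℂ) :=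
    ((by fun_prop : Continuous fun v => ⟪rightMul π Ω (star b) (π a v), star x Ω⟫_ℂ).tendsto _).comp
      hy
  have l2 : Filter.Tendsto (fun k => ⟪x Ω, rightMul π Ω (star a) (π b (π (star (y k)) Ω))⟫_ℂ)
      Filter.atTop (𝓝 ⟪x Ω, rightMul π Ω (star a) (π b (star s Ω))⟫_ℂ) :=
    ((by fun_prop : Continuous fun v => ⟪x Ω, rightMul π Ω (star a) (π b v)⟫_ℂ).tendsto _).comp
      hys
  refine tendsto_nhds_unique_of_eventuallyEq l2 l1 (Filter.Eventually.of_forall fun k => ?_)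
  simp only
  rw [← BranchedMap.rep_mul_apply, ← BranchedMap.rep_mul_apply, hΩ.rightMul_apply,
      hΩ.rightMul_apply, ← inner_conj_symm, ← inner_conj_symm _ (star x Ω), hxJ]
  simp [mul_assoc]

end IsTracialVector

end TracialVector

/-! ### Tracial states -/

namespace PositiveLinearMap

variable {A : Type u} [CStarAlgebra A] [PartialOrder A] [StarOrderedRing A] {τ : A →ₚ[ℂ] ℂ}

lemma isTracialVector (hτ : ∀ x y, τ (x * y) = τ (y * x)) :
    IsTracialVector τ.gnsStarAlgHom τ.cyclicVector where
  dense := τ.denseRange_gns_cyclicVector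
  trace a b := by rw [inner_cyclicVector_gns, inner_cyclicVector_gns, hτ]

variable (τ) in
lemma continuous_complex : Continuous fun a => τ a := by
  have h : (fun a => τ a) = fun a => ⟪τ.cyclicVector, τ.gnsStarAlgHom a τ.cyclicVector⟫_ℂ :=
    funext fun a => (τ.inner_cyclicVector_gns a).symm
  have := BranchedMap.continuous_rep τ.gnsStarAlgHom
  rw [h]
  fun_prop

/-- If `xΩ = 0`, then `x a Ω` is the right multiplication by `a` applied to `xΩ`, hence 0 for all
`a`. -/
lemma gns_apply_eq_zero_iff (hτ : ∀ x y, τ (x * y) = τ (y * x)) {x : A} :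
    τ.gnsStarAlgHom x = 0 ↔ τ (star x * x) = 0 := by
  rw [← inner_gns_cyclicVector, inner_self_eq_zero]
  refine ⟨fun h => by rw [h]; rfl, fun h => (isTracialVector hτ).ext fun a => ?_⟩
  rw [← (isTracialVector hτ).rightMul_vector, ← mul_apply_eq_comp,
    (isTracialVector hτ).map_mul_rightMul, mul_apply_eq_comp, h, map_zero]
  rfl

lemma nontrivial_gns (h1 : τ 1 = 1) : Nontrivial τ.GNS := by
  refine ⟨τ.cyclicVector, 0, fun h => ?_⟩
  have h2 := τ.inner_cyclicVector_gns 1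
  rw [h, inner_zero_left, h1] at h2
  exact zero_ne_one h2

section Matrix

variable {ι : Type*} [Fintype ι] [DecidableEq ι] {ρ : A →⋆ₐ[ℂ] Matrix ι ι ℂ} {c : ℂ}
  (hc : c ≠ 0) (hτ : ∀ x, τ x = c * (ρ x).trace)
include hτ

omit [StarOrderedRing A] in
lemma mul_comm_of_matrix (x y : A) : τ (x * y) = τ (y * x) := by
  rw [hτ, hτ, map_mul, map_mul, Matrix.trace_mul_comm]

include hc

omit [StarOrderedRing A] in
lemma apply_star_mul_self_eq_zero_iff {x : A} : τ (star x * x) = 0 ↔ ρ x = 0 := by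
  rw [hτ, map_mul, map_star, mul_eq_zero, or_iff_right hc, Matrix.star_eq_conjTranspose,
    Matrix.trace_conjTranspose_mul_self_eq_zero_iff]

lemma gns_eq_zero_iff {x : A} : τ.gnsStarAlgHom x = 0 ↔ ρ x = 0 := by
  rw [gns_apply_eq_zero_iff (mul_comm_of_matrix hτ), apply_star_mul_self_eq_zero_iff hc hτ]

lemma gns_eq_gns_iff {x y : A} : τ.gnsStarAlgHom x = τ.gnsStarAlgHom y ↔ ρ x = ρ y := by
  rw [← sub_eq_zero, ← map_sub, gns_eq_zero_iff hc hτ, map_sub, sub_eq_zero]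

variable (hρ : Function.Surjective ρ)
include hρ

/-- The GNS representation factors through the matrix algebra, so the dense orbit of the cyclic
vector is finite dimensional, hence closed. -/
lemma exists_gns_apply_eq (v : τ.GNS) : ∃ a, τ.gnsStarAlgHom a τ.cyclicVector = v := by
  let e : A →ₗ[ℂ] τ.GNS :=
    { toFun := fun a => τ.gnsStarAlgHom a τ.cyclicVector
      map_add' := fun a b => by rw [map_add]; rfl
      map_smul' := fun c a => by rw [map_smul]; rfl }
  obtain ⟨s, hs⟩ := ρ.toAlgHom.toLinearMap.exists_rightInverse_of_surjective
    (LinearMap.range_eq_top.2 hρ)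
  have h1 : LinearMap.range e = LinearMap.range (e ∘ₗ s) := by
    refine le_antisymm ?_ (LinearMap.range_comp_le_range _ _)
    rintro _ ⟨a, rfl⟩
    refine ⟨ρ a, ?_⟩
    change τ.gnsStarAlgHom (s (ρ a)) _ = τ.gnsStarAlgHom a _
    rw [(gns_eq_gns_iff hc hτ).2 (LinearMap.congr_fun hs (ρ a))]
  have h2 : IsClosed (LinearMap.range e : Set τ.GNS) := by
    rw [h1]
    exact Submodule.closed_of_finiteDimensional _
  have h3 := h2.closure_subset (τ.denseRange_gns_cyclicVector v)
  exact h3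

lemma exists_eq_gns_of_mem {m : τ.GNS →L[ℂ] τ.GNS} (hm : m ∈ gnsVN τ) :
    ∃ a, m = τ.gnsStarAlgHom a := by
  obtain ⟨a, ha⟩ := exists_gns_apply_eq hc hτ hρ (m τ.cyclicVector)
  exact ⟨a, (isTracialVector (mul_comm_of_matrix hτ)).eq_of_apply_eq hm
    (map_mem_generatedVN a) ha.symm⟩

lemma nonempty_gnsVN_equiv :
    Nonempty ((gnsVN τ).toStarSubalgebra ≃⋆ₐ[ℂ] Matrix ι ι ℂ) := by
  have hs : ∀ M, ρ (Function.surjInv hρ M) = M := Function.surjInv_eq hρ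
  -- Arbitrary lifts are allowed, since elements with the same image under `ρ` have the same image
  -- in the GNS representation.
  let σ : Matrix ι ι ℂ →⋆ₐ[ℂ] (gnsVN τ).toStarSubalgebra :=
    { toFun := fun M => ⟨τ.gnsStarAlgHom (Function.surjInv hρ M), map_mem_generatedVN _⟩
      map_one' := Subtype.ext (by
        change _ = (1 : τ.GNS →L[ℂ] τ.GNS)
        rw [← map_one τ.gnsStarAlgHom, gns_eq_gns_iff hc hτ, hs, map_one])
      map_mul' := fun M M' => Subtype.ext (by
        change _ = τ.gnsStarAlgHom _ * τ.gnsStarAlgHom _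
        rw [← map_mul τ.gnsStarAlgHom, gns_eq_gns_iff hc hτ, hs, map_mul, hs, hs])
      map_zero' := Subtype.ext (by
        change _ = (0 : τ.GNS →L[ℂ] τ.GNS)
        rw [← map_zero τ.gnsStarAlgHom, gns_eq_gns_iff hc hτ, hs, map_zero])
      map_add' := fun M M' => Subtype.ext (by
        change _ = τ.gnsStarAlgHom _ + τ.gnsStarAlgHom _
        rw [← map_add τ.gnsStarAlgHom, gns_eq_gns_iff hc hτ, hs, map_add, hs, hs])
      commutes' := fun z => Subtype.ext (by
        change _ = algebraMap ℂ (τ.GNS →L[ℂ] τ.GNS) z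
        rw [← AlgHomClass.commutes τ.gnsStarAlgHom, gns_eq_gns_iff hc hτ, hs,
          AlgHomClass.commutes])
      map_star' := fun M => Subtype.ext (by
        change _ = star (τ.gnsStarAlgHom _)
        rw [← map_star τ.gnsStarAlgHom, gns_eq_gns_iff hc hτ, hs, map_star, hs]) }
  refine ⟨(StarAlgEquiv.ofBijective σ ⟨fun M M' h => ?_, fun m => ?_⟩).symm⟩
  · have h1 := (gns_eq_gns_iff hc hτ).1 (congrArg Subtype.val h)
    rwa [hs, hs] at h1
  · obtain ⟨a, ha⟩ := exists_eq_gns_of_mem hc hτ hρ m.2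
    refine ⟨ρ a, Subtype.ext ?_⟩
    rw [ha]
    exact (gns_eq_gns_iff hc hτ).2 (hs _)

lemma isFactor_gnsVN_of_matrix (h1 : τ 1 = 1) : (gnsVN τ).IsFactor := by
  refine ⟨nontrivial_gns h1, fun x hx hx' => ?_⟩
  obtain ⟨a, rfl⟩ := exists_eq_gns_of_mem hc hτ hρ hx
  have h2 : ρ a ∈ Set.range (Matrix.scalar ι) := by
    rw [Matrix.mem_range_scalar_iff_commute_single']
    intro i j
    obtain ⟨b, hb⟩ := hρ (Matrix.single i j 1)
    have h3 := mem_commutant_generatedVN.1 hx' b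
    rw [← map_mul, ← map_mul, gns_eq_gns_iff hc hτ, map_mul, map_mul, hb] at h3
    exact h3
  obtain ⟨z, hz⟩ := h2
  refine ⟨z, ?_⟩
  rw [← map_one τ.gnsStarAlgHom, ← map_smul, gns_eq_gns_iff hc hτ, map_smul, map_one, ← hz,
    Matrix.scalar_apply, Matrix.smul_one_eq_diagonal]

end Matrix

end PositiveLinearMap

namespace BranchedMap

variable {K : Type u} [MetricSpace K] {N : ℕ} {γ : BranchedMap K N} {n m : ℕ} [CompactSpace K]

/-! ### The discrete traces -/

variable (hN : 2 ≤ N) {b : K} (hb : b ∈ γ.branchSet)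

include hN in
lemma pow_ne_zero_complex (n : ℕ) : ((N : ℂ) ^ n) ≠ 0 :=
  pow_ne_zero _ (Nat.cast_ne_zero.2 (by omega))

include hN in
-- The defining conditions fix the values on `F^(n)` and on `tail n`, whose sum is dense. Existence,
-- uniqueness and the kernel all follow from this formula.
lemma isDiscreteTrace_iff {τ : γ.Core →ₚ[ℂ] ℂ} : γ.IsDiscreteTrace b n τ ↔
    ∀ x, τ x = ((N : ℂ) ^ n)⁻¹ * (γ.discreteRep hN hb n x).trace := by
  constructor
  · rintro ⟨-, h1, h2⟩ x
    have hρ := continuous_discreteRep hN hb n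
    have hτ := τ.continuous_complex
    refine core_induction (p := fun x => τ x = ((N : ℂ) ^ n)⁻¹ * (γ.discreteRep hN hb n x).trace)
      (isClosed_eq hτ (continuous_const.mul (Continuous.matrix_trace hρ))) (fun T => ?_) x
    obtain ⟨S, R, rfl, hS, hR, -⟩ := exists_decomposition n T
    obtain ⟨a, ha⟩ := exists_represents hN hS
    have h3 : τ (γ.incl R) = 0 := map_eq_zero_of_mem_tail (φ := τ.toLinearMap ∘ₗ
      (toCore (γ := γ)).toAlgHom.toLinearMap) (fun m hm T hT => h2 m hm T hT) hR
    rw [incl_add, map_add, map_add, h3, discreteRep_of_mem_tail hN hb hR,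
      discreteRep_of_represents hN hb ha, add_zero, add_zero]
    exact h1 S hS a ha
  · intro h
    refine ⟨⟨?_, PositiveLinearMap.mul_comm_of_matrix h⟩, fun T hT a ha => ?_, fun m hm T hT => ?_⟩
    · rw [h, map_one, Matrix.trace_one]
      simp [inv_mul_cancel₀ (pow_ne_zero_complex hN n)]
    · change τ (γ.incl T) = _
      rw [h, discreteRep_of_represents hN hb ha]
      rfl
    · change τ (γ.incl T) = 0
      rw [h, discreteRep_of_mem_compacts hN hb hm hT, Matrix.trace_zero, mul_zero]

include hN hb in
theorem existsUnique_isDiscreteTrace (n : ℕ) : ∃! τ, γ.IsDiscreteTrace b n τ := by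
  let φ : γ.Core →ₗ[ℂ] ℂ := ((N : ℂ) ^ n)⁻¹ • (Matrix.traceLinearMap (Fin n → Fin N) ℂ ℂ ∘ₗ
    (γ.discreteRep hN hb n).toAlgHom.toLinearMap)
  have hφ : ∀ x, 0 ≤ x → 0 ≤ φ x := fun x hx => by
    obtain ⟨y, rfl⟩ := CStarAlgebra.nonneg_iff_eq_star_mul_self.1 hx
    change 0 ≤ ((N : ℂ) ^ n)⁻¹ * (γ.discreteRep hN hb n (star y * y)).trace
    rw [map_mul, map_star]
    refine mul_nonneg ?_ (Matrix.posSemidef_conjTranspose_mul_self _).trace_nonneg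
    simp
  refine ⟨PositiveLinearMap.mk₀ φ hφ, (isDiscreteTrace_iff hN hb).2 fun x => rfl, fun τ hτ => ?_⟩
  ext x
  exact (isDiscreteTrace_iff hN hb).1 hτ x

include hN hb in
theorem isDiscreteTrace_properties {τ : γ.Core →ₚ[ℂ] ℂ} (hτ : γ.IsDiscreteTrace b n τ) :
    traceKernel τ = γ.coreIdeal b n ∧ (gnsVN τ).IsFactor ∧
      Nonempty ((gnsVN τ).toStarSubalgebra ≃⋆ₐ[ℂ]
        Matrix (Fin n → Fin N) (Fin n → Fin N) ℂ) ∧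
      ∃ (J : Ideal γ.Core) (_ : J.IsTwoSided), (J : Set γ.Core) = γ.coreIdeal b n ∧
        ∃ e : (γ.Core ⧸ J) ≃ₐ[ℂ] Matrix (Fin n → Fin N) (Fin n → Fin N) ℂ,
          ∀ x, e (Ideal.Quotient.mk J (star x)) = star (e (Ideal.Quotient.mk J x)) := by
  have h1 := (isDiscreteTrace_iff hN hb).1 hτ
  have hc : ((N : ℂ) ^ n)⁻¹ ≠ 0 := inv_ne_zero (pow_ne_zero_complex hN n)
  have hρ := surjective_discreteRep hN hb n
  refine ⟨?_, PositiveLinearMap.isFactor_gnsVN_of_matrix hc h1 hρ hτ.1.1,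
    PositiveLinearMap.nonempty_gnsVN_equiv hc h1 hρ, γ.discreteIdeal hN hb n, inferInstance,
    coe_discreteIdeal hN hb, ?_⟩
  · ext x
    rw [mem_coreIdeal_iff hN hb]
    exact PositiveLinearMap.apply_star_mul_self_eq_zero_iff hc h1
  · exact ⟨Ideal.quotientKerAlgEquivOfSurjective (f := (γ.discreteRep hN hb n).toAlgHom) hρ,
      fun x => map_star (γ.discreteRep hN hb n) x⟩

end BranchedMap

namespace BranchedMap

variable {K : Type u} [MetricSpace K] {N : ℕ} {γ : BranchedMap K N} {n m : ℕ}

/-! ### The Hutchinson measure -/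

open MeasureTheory

section WordSum

variable {E : Type*} [NormedAddCommGroup E]

variable (γ) in
/-- The sum of a function over the words of length `n`. -/
def wordSum (n : ℕ) (f : C(K, E)) : C(K, E) where
  toFun y := ∑ w : Fin n → Fin N, f (γ.word n w y)
  continuous_toFun := continuous_finsetSum _ fun w _ => f.continuous.comp (γ.continuous_word n w)

lemma wordSum_apply (n : ℕ) (f : C(K, E)) (y : K) :
    γ.wordSum n f y = ∑ w, f (γ.word n w y) := rfl

lemma wordSum_succ (n : ℕ) (f : C(K, E)) (y : K) :
    γ.wordSum (n + 1) f y = ∑ j, γ.wordSum n f (γ.map j y) := by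
  rw [wordSum_apply, sum_words_succ]
  rfl

lemma wordSum_zero (f : C(K, E)) (y : K) : γ.wordSum 0 f y = f y := by
  simp [wordSum_apply]

lemma wordSum_wordSum_one (n : ℕ) (f : C(K, E)) :
    γ.wordSum n (γ.wordSum 1 f) = γ.wordSum (n + 1) f := by
  induction n with
  | zero => ext y; rw [wordSum_zero]
  | succ n ih =>
    ext y
    rw [wordSum_succ, wordSum_succ, ih]

variable [CompactSpace K] [NormedSpace ℝ E]

omit [NormedSpace ℝ E] in
-- Long words have small range and `f` is uniformly continuous, so the averages of `f` over words of
-- length `n` become independent of the base point.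
lemma exists_norm_wordSum_sub_le (γ : BranchedMap K N) (f : C(K, E)) {ε : ℝ} (hε : 0 < ε) :
    ∃ n₀, ∀ n ≥ n₀, ∀ y z, ‖γ.wordSum n f y - γ.wordSum n f z‖ ≤ (N : ℝ) ^ n * ε := by
  obtain ⟨δ, hδ, h⟩ := Metric.uniformContinuous_iff.1
    (CompactSpace.uniformContinuous_of_continuous f.continuous) ε hε
  obtain ⟨n₀, hn₀⟩ := γ.exists_dist_word_lt hδ
  refine ⟨n₀, fun n hn y z => ?_⟩
  rw [wordSum_apply, wordSum_apply, ← Finset.sum_sub_distrib]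
  refine (norm_sum_le_of_le _ fun w _ => ?_ : _ ≤ ∑ w : Fin n → Fin N, ε).trans ?_
  · rw [← dist_eq_norm]
    exact (h (hn₀ n hn w y z)).le
  · simp

end WordSum

variable [CompactSpace K] [MeasurableSpace K] [BorelSpace K] {E : Type*} [NormedAddCommGroup E]
  [NormedSpace ℝ E]

omit [NormedSpace ℝ E] in
lemma integrable_of_continuous {μ : Measure K} [IsFiniteMeasure μ] {f : K → E}
    (hf : Continuous f) : Integrable f μ :=
  hf.integrable_of_hasCompactSupport (HasCompactSupport.of_compactSpace f)

/-- Two measures are allowed so that the formula applies to the right hand side of the invariance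
equation before invariance is known. -/
lemma integral_eq_sum_of_eq (hN : 2 ≤ N) {μ ν : Measure K} [IsFiniteMeasure ν]
    (h : μ = (N : ℝ≥0∞)⁻¹ • ∑ j, ν.map (γ.map j)) (f : C(K, E)) :
    (N : ℝ) • ∫ x, f x ∂μ = ∫ x, γ.wordSum 1 f x ∂ν := by
  have hN' : (N : ℝ) ≠ 0 := Nat.cast_ne_zero.2 (by omega)
  have h1 : ∀ j, ∫ x, f x ∂(ν.map (γ.map j)) = ∫ x, f (γ.map j x) ∂ν := fun j =>
    integral_map (γ.continuous_map j).aemeasurable f.continuous.aestronglyMeasurable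
  have : ∀ j, IsFiniteMeasure (ν.map (γ.map j)) := fun j => inferInstance
  rw [h, integral_smul_measure, integral_finsetSum_measure fun j _ =>
    integrable_of_continuous f.continuous]
  simp only [h1]
  rw [← integral_finsetSum (f := fun j x => f (γ.map j x)) _ fun j _ =>
    integrable_of_continuous (f.continuous.comp (γ.continuous_map j)), smul_smul]
  have h2 : (N : ℝ) * ((N : ℝ≥0∞)⁻¹).toReal = 1 := by
    rw [ENNReal.toReal_inv, ENNReal.toReal_natCast, mul_inv_cancel₀ hN']
  rw [h2, one_smul]
  simp only [wordSum_succ, wordSum_zero]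

lemma IsHutchinsonMeasure.integral_wordSum (hN : 2 ≤ N) {μ : Measure K}
    (hμ : γ.IsHutchinsonMeasure μ) (n : ℕ) (f : C(K, E)) :
    ∫ x, γ.wordSum n f x ∂μ = ((N : ℝ) ^ n) • ∫ x, f x ∂μ := by
  have := hμ.1
  induction n with
  | zero => simp [wordSum_zero]
  | succ n ih =>
    rw [pow_succ', mul_smul, ← ih, integral_eq_sum_of_eq hN hμ.2]
    simp only [wordSum_succ, wordSum_zero]

lemma IsHutchinsonMeasure.exists_norm_sub_le (hN : 2 ≤ N) {μ : Measure K}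
    (hμ : γ.IsHutchinsonMeasure μ) [CompleteSpace E] (f : C(K, E)) {ε : ℝ} (hε : 0 < ε) :
    ∃ n₀, ∀ n ≥ n₀, ∀ y, ‖γ.wordSum n f y - ((N : ℝ) ^ n) • ∫ x, f x ∂μ‖ ≤ (N : ℝ) ^ n * ε := by
  have := hμ.1
  obtain ⟨n₀, hn₀⟩ := γ.exists_norm_wordSum_sub_le f hε
  refine ⟨n₀, fun n hn y => ?_⟩
  have h1 : γ.wordSum n f y - ((N : ℝ) ^ n) • ∫ x, f x ∂μ =
      ∫ z, (γ.wordSum n f y - γ.wordSum n f z) ∂μ := by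
    rw [integral_sub (integrable_const _)
      (integrable_of_continuous (γ.wordSum n f).continuous), hμ.integral_wordSum hN]
    simp
  rw [h1]
  refine (norm_integral_le_of_norm_le_const
    (Filter.Eventually.of_forall fun z => hn₀ n hn y z)).trans ?_
  simp

/-- Both integrals of `f` are the limit of the averages of `f` over the words of length `n` at one
point. -/
theorem IsHutchinsonMeasure.unique [Nonempty K] (hN : 2 ≤ N) {μ ν : Measure K}
    (hμ : γ.IsHutchinsonMeasure μ) (hν : γ.IsHutchinsonMeasure ν) : μ = ν := by
  have := hμ.1
  have := hν.1
  obtain ⟨y⟩ := ‹Nonempty K›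
  refine ext_of_forall_integral_eq_of_IsFiniteMeasure fun f => ?_
  rw [← sub_eq_zero, ← norm_le_zero_iff]
  refine le_of_forall_pos_le_add fun ε hε => ?_
  obtain ⟨n₁, h₁⟩ := hμ.exists_norm_sub_le hN f.toContinuousMap (half_pos hε)
  obtain ⟨n₂, h₂⟩ := hν.exists_norm_sub_le hN f.toContinuousMap (half_pos hε)
  have e1 := h₁ (max n₁ n₂) (le_max_left _ _) y
  have e2 := h₂ (max n₁ n₂) (le_max_right _ _) y
  set n := max n₁ n₂
  have hpos : (0 : ℝ) < (N : ℝ) ^ n := by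
    have : (0 : ℝ) < N := by exact_mod_cast (by omega : 0 < N)
    positivity
  have e3 : (N : ℝ) ^ n * ‖∫ x, f x ∂μ - ∫ x, f x ∂ν‖ ≤ (N : ℝ) ^ n * ε := by
    calc _ = ‖((N : ℝ) ^ n) • (∫ x, f x ∂μ - ∫ x, f x ∂ν)‖ := by
          rw [norm_smul, Real.norm_of_nonneg hpos.le]
      _ = ‖(γ.wordSum n f.toContinuousMap y - ((N : ℝ) ^ n) • ∫ x, f x ∂ν) -
          (γ.wordSum n f.toContinuousMap y - ((N : ℝ) ^ n) • ∫ x, f x ∂μ)‖ := by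
          congr 1
          rw [smul_sub]
          abel
      _ ≤ (N : ℝ) ^ n * (ε / 2) + (N : ℝ) ^ n * (ε / 2) :=
          (norm_sub_le _ _).trans (add_le_add e2 e1)
      _ = _ := by ring
  rw [zero_add]
  exact le_of_mul_le_mul_left e3 hpos

variable (γ) in
/-- The uniform distribution on the points `γ_w y`, `w` a word of length `n`. -/
noncomputable def wordMeasure (n : ℕ) (y : K) : Measure K :=
  ((N : ℝ≥0∞) ^ n)⁻¹ • ∑ w : Fin n → Fin N, Measure.dirac (γ.word n w y)

omit [CompactSpace K] [BorelSpace K] in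
lemma isProbabilityMeasure_wordMeasure (hN : 2 ≤ N) (n : ℕ) (y : K) :
    IsProbabilityMeasure (γ.wordMeasure n y) := by
  refine ⟨?_⟩
  simp only [wordMeasure, Measure.smul_apply, Measure.finsetSum_apply, measure_univ,
    Finset.sum_const, Finset.card_univ, Fintype.card_fun, Fintype.card_fin, smul_eq_mul,
    nsmul_eq_mul, mul_one]
  push_cast
  refine ENNReal.inv_mul_cancel (pow_ne_zero _ (Nat.cast_ne_zero.2 (by omega))) ?_
  exact ENNReal.pow_ne_top (ENNReal.natCast_ne_top N)

lemma integral_wordMeasure (n : ℕ) (y : K) (f : C(K, ℝ)) :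
    ∫ x, f x ∂(γ.wordMeasure n y) = ((N : ℝ) ^ n)⁻¹ * γ.wordSum n f y := by
  rw [wordMeasure, integral_smul_measure, integral_finsetSum_measure fun j _ =>
    integrable_of_continuous f.continuous]
  simp [integral_dirac, wordSum_apply]

/-- The uniform distributions on the points `γ_w y` are asymptotically invariant. Probability
measures on `K` form a compact space, and a limit along an ultrafilter is invariant. -/
theorem exists_isHutchinsonMeasure [Nonempty K] (hN : 2 ≤ N) (γ : BranchedMap K N) :
    ∃ μ : Measure K, γ.IsHutchinsonMeasure μ := by
  obtain ⟨y⟩ := ‹Nonempty K›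
  let ν : ℕ → ProbabilityMeasure K := fun n =>
    ⟨γ.wordMeasure n y, isProbabilityMeasure_wordMeasure hN n y⟩
  let F : Ultrafilter ℕ := Filter.hyperfilter ℕ
  let μ := (F.map ν).lim
  have hlim : Filter.Tendsto ν F (𝓝 μ) := (F.map ν).le_nhds_lim
  have hN' : (N : ℝ) ≠ 0 := Nat.cast_ne_zero.2 (by omega)
  have hpos : (0 : ℝ) < N := by exact_mod_cast (by omega : 0 < N)
  have hint : ∀ f : C(K, ℝ), Filter.Tendsto (fun n => ((N : ℝ) ^ n)⁻¹ * γ.wordSum n f y) F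
      (𝓝 (∫ x, f x ∂(μ : Measure K))) := fun f => by
    have h1 := ProbabilityMeasure.tendsto_iff_forall_integral_tendsto.1 hlim
      (BoundedContinuousFunction.mkOfCompact f)
    refine h1.congr fun n => ?_
    exact integral_wordMeasure n y f
  have hinv : ∀ f : C(K, ℝ), ∫ x, γ.wordSum 1 f x ∂(μ : Measure K) =
      N * ∫ x, f x ∂(μ : Measure K) := fun f => by
    have h1 := (hint f).const_mul (N : ℝ)
    refine tendsto_nhds_unique (hint (γ.wordSum 1 f)) ?_
    have h2 : Filter.Tendsto (fun n => ((N : ℝ) ^ n)⁻¹ * γ.wordSum n (γ.wordSum 1 f) y -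
        N * (((N : ℝ) ^ n)⁻¹ * γ.wordSum n f y)) Filter.atTop (𝓝 0) := by
      rw [Metric.tendsto_atTop]
      intro ε hε
      -- The `N` letters contribute at most `ε / (2N)` each after normalisation, in total `ε / 2`.
      obtain ⟨n₀, hn₀⟩ := γ.exists_norm_wordSum_sub_le f (ε := ε / (2 * N)) (by positivity)
      refine ⟨n₀, fun n hn => ?_⟩
      rw [dist_zero_right, wordSum_wordSum_one, wordSum_succ]
      have h3 : ((N : ℝ) ^ n)⁻¹ * ∑ j, γ.wordSum n f (γ.map j y) -
          N * (((N : ℝ) ^ n)⁻¹ * γ.wordSum n f y) =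
          ((N : ℝ) ^ n)⁻¹ * ∑ j : Fin N, (γ.wordSum n f (γ.map j y) - γ.wordSum n f y) := by
        rw [Finset.sum_sub_distrib, Finset.sum_const, Finset.card_univ, Fintype.card_fin,
          nsmul_eq_mul]
        ring
      rw [h3, norm_mul, Real.norm_of_nonneg (by positivity)]
      calc _ ≤ ((N : ℝ) ^ n)⁻¹ * ∑ j : Fin N, ((N : ℝ) ^ n * (ε / (2 * N))) := by
            gcongr
            exact norm_sum_le_of_le _ fun j _ => hn₀ n hn _ _
        _ = ε / 2 := by
            rw [Finset.sum_const, Finset.card_univ, Fintype.card_fin, nsmul_eq_mul]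
            field_simp
        _ < ε := half_lt_self hε
    have h4 := (h2.mono_left (Nat.hyperfilter_le_atTop)).add h1
    rw [zero_add] at h4
    refine h4.congr fun n => ?_
    ring
  refine ⟨μ, inferInstance, ?_⟩
  have hfin : IsFiniteMeasure ((N : ℝ≥0∞)⁻¹ • ∑ j, (μ : Measure K).map (γ.map j)) := by
    have : IsFiniteMeasure (∑ j, (μ : Measure K).map (γ.map j)) := inferInstance
    exact Measure.smul_finite _ (ENNReal.inv_ne_top.2 (Nat.cast_ne_zero.2 (by omega)))
  refine ext_of_forall_integral_eq_of_IsFiniteMeasure fun f => ?_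
  have h1 := integral_eq_sum_of_eq (γ := γ) hN (ν := (μ : Measure K)) rfl f.toContinuousMap
  rw [hinv, smul_eq_mul] at h1
  exact (mul_left_cancel₀ hN' h1).symm

/-- Off the branch set only one letter reaches `x`, so a single term of the invariance equation is
nonzero. -/
lemma IsHutchinsonMeasure.measure_singleton_le {μ : Measure K} (hμ : γ.IsHutchinsonMeasure μ)
    {x : K} (hx : x ∉ γ.branchSet) : μ {x} ≤ (N : ℝ≥0∞)⁻¹ * μ {γ.h x} := by
  have h1 : μ {x} = (N : ℝ≥0∞)⁻¹ * ∑ j, μ (γ.map j ⁻¹' {x}) := by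
    conv_lhs => rw [hμ.2]
    rw [Measure.smul_apply, Measure.finsetSum_apply, smul_eq_mul]
    congr 1
    exact Finset.sum_congr rfl fun j _ =>
      Measure.map_apply (γ.continuous_map j).measurable (measurableSet_singleton x)
  obtain ⟨i, hi⟩ := exists_map_h (γ := γ) x
  have h2 : ∀ j ≠ i, γ.map j ⁻¹' {x} = ∅ := fun j hj => by
    ext z
    simp only [Set.mem_preimage, Set.mem_singleton_iff, Set.mem_empty_iff_false, iff_false]
    intro hz
    refine hx (mem_branchSet_iff.2 ⟨j, i, hj, ?_, hi⟩)
    rw [← hz, γ.h_map]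
  rw [h1, Finset.sum_eq_single i (fun j _ hj => by rw [h2 j hj, measure_empty]) (by simp)]
  gcongr
  intro z hz
  rw [Set.mem_singleton_iff, ← (show γ.map i z = x from hz), γ.h_map]

/-- The points `h^(k+1) b` never return to `B_γ`, so the mass of such a point is at most `N^{-m}`
times that of a later point of the orbit, for every `m`. -/
lemma IsHutchinsonMeasure.measure_collisionSet (hN : 2 ≤ N) {μ : Measure K}
    (hμ : γ.IsHutchinsonMeasure μ) (n : ℕ) : μ (γ.collisionSet n) = 0 := by
  have := hμ.1
  refine (measure_null_iff_singleton (finite_collisionSet n).countable).2 fun x hx => ?_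
  obtain ⟨b, hb, k, rfl⟩ := mem_collisionSet hx
  have h1 : ∀ m, μ {γ.h^[k + 1] b} ≤ (N : ℝ≥0∞)⁻¹ ^ m * μ {γ.h^[k + m + 1] b} := fun m => by
    induction m with
    | zero => simp
    | succ m ih =>
      refine ih.trans ?_
      rw [pow_succ, mul_assoc]
      gcongr
      have := hμ.measure_singleton_le (iterate_notMem_branchSet hb (k + m))
      rwa [← Function.iterate_succ_apply' γ.h] at this
  have h2 : Filter.Tendsto (fun m => (N : ℝ≥0∞)⁻¹ ^ m) Filter.atTop (𝓝 0) := by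
    refine ENNReal.tendsto_pow_atTop_nhds_zero_of_lt_one ?_
    rw [ENNReal.inv_lt_one]
    exact_mod_cast (by omega : 1 < N)
  refine le_antisymm (ge_of_tendsto h2 (Filter.Eventually.of_forall fun m => ?_)) zero_le
  refine (h1 m).trans ?_
  calc _ ≤ (N : ℝ≥0∞)⁻¹ ^ m * 1 := by gcongr; exact prob_le_one
    _ = _ := mul_one _

end BranchedMap

namespace BranchedMap

variable {K : Type u} [MetricSpace K] {N : ℕ} {γ : BranchedMap K N} {n m : ℕ} [CompactSpace K]

/-! ### The trace of the Hutchinson measure -/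

open MeasureTheory

omit [CompactSpace K] in
lemma trace_apply {ι : Type*} [Fintype ι] (a : Matrix ι ι C(K, ℂ)) (x : K) :
    a.trace x = ∑ w, a w w x := by
  simp [Matrix.trace, ContinuousMap.sum_apply]

omit [CompactSpace K] in
lemma trace_blockDiag (a : Matrix (Fin n → Fin N) (Fin n → Fin N) C(K, ℂ)) :
    (γ.blockDiag n a).trace = γ.wordSum 1 a.trace := by
  ext y
  rw [trace_apply, sum_words_succ, wordSum_succ]
  refine Finset.sum_congr rfl fun j _ => ?_
  simp only [blockDiag_cons_cons, if_true, wordSum_zero, trace_apply]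

variable [MeasurableSpace K] [BorelSpace K]

omit [CompactSpace K] [BorelSpace K] in
lemma integral_nonneg_complex {μ : Measure K} {f : C(K, ℂ)} (hf : ∀ x, 0 ≤ f x) :
    0 ≤ ∫ x, f x ∂μ := by
  have h1 : ∀ x, f x = ((f x).re : ℂ) := fun x => Complex.eq_re_of_ofReal_le (hf x)
  rw [show (∫ x, f x ∂μ) = ∫ x, ((f x).re : ℂ) ∂μ from integral_congr_ae
    (Filter.Eventually.of_forall h1), integral_complex_ofReal]
  exact_mod_cast integral_nonneg fun x => (Complex.nonneg_iff.1 (hf x)).1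

/-- Passing to the next level replaces the trace `t` of the matrix by the sum of `t(γ_j y)` over
`j`, whose integral is `N` times that of `t`; the normalisation absorbs the factor. -/
lemma IsHutchinsonMeasure.exists_state (hN : 2 ≤ N) {μ : Measure K}
    (hμ : γ.IsHutchinsonMeasure μ) : ∃ τ : γ.Core →ₚ[ℂ] ℂ, ∀ n (T : γ.unionCore) a,
      γ.Represents n T a → τ (γ.incl T) = ((N : ℂ) ^ n)⁻¹ * ∫ x, a.trace x ∂μ := by
  have := hμ.1
  have hN' : (N : ℂ) ≠ 0 := Nat.cast_ne_zero.2 (by omega)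
  have hN'' : (N : ℝ) ≠ 0 := Nat.cast_ne_zero.2 (by omega)
  let L : ∀ k, Matrix (Fin (0 + k) → Fin N) (Fin (0 + k) → Fin N) C(K, ℂ) →ₗ[ℂ] ℂ := fun k =>
    { toFun := fun a => ((N : ℂ) ^ (0 + k))⁻¹ * ∫ x, a.trace x ∂μ
      map_add' := fun a b => by
        rw [Matrix.trace_add, ← mul_add, ← integral_add (integrable_of_continuous a.trace.continuous)
          (integrable_of_continuous b.trace.continuous)]
        rfl
      map_smul' := fun c a => by
        rw [Matrix.trace_smul, RingHom.id_apply, smul_eq_mul, mul_left_comm, ← smul_eq_mul c,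
          ← integral_smul]
        rfl }
  obtain ⟨φ, hφ⟩ := exists_linearMap_of_compatible (γ := γ) hN 0 L fun k a => by
    change ((N : ℂ) ^ (0 + k + 1))⁻¹ * ∫ x, (γ.blockDiag (0 + k) a).trace x ∂μ =
      ((N : ℂ) ^ (0 + k))⁻¹ * ∫ x, a.trace x ∂μ
    rw [trace_blockDiag, hμ.integral_wordSum hN, pow_one, Complex.real_smul, pow_succ]
    push_cast
    field_simp
  have hφ' : ∀ n (T : γ.unionCore) a, γ.Represents n T a →
      φ T = ((N : ℂ) ^ n)⁻¹ * ∫ x, a.trace x ∂μ := by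
    intro n
    obtain ⟨k, rfl⟩ : ∃ k, n = 0 + k := ⟨n, (Nat.zero_add n).symm⟩
    exact hφ k
  obtain ⟨τ, -, hτ⟩ := exists_positive_extension φ (C := 1) (fun T => by
    obtain ⟨M, hM⟩ := exists_mem_finiteCore T
    obtain ⟨a, ha⟩ := exists_represents hN hM
    have h1 : ∀ x, ‖a.trace x‖ ≤ (N : ℝ) ^ M * ‖(T : γ.adjointable)‖ := fun x => by
      rw [trace_apply]
      refine (norm_sum_le_of_le _ fun w _ => ha.norm_le hN (finiteCore_le_adjointableAt M hM)
        w w x).trans ?_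
      simp
    rw [hφ' M T a ha, norm_mul, norm_inv, norm_pow, Complex.norm_natCast, one_mul,
      inv_mul_le_iff₀ (by positivity)]
    refine (norm_integral_le_of_norm_le_const (Filter.Eventually.of_forall h1)).trans ?_
    simp) (fun T => by
    obtain ⟨M, hM⟩ := exists_mem_finiteCore T
    obtain ⟨a, ha⟩ := exists_represents hN hM
    have hS' : (star T : γ.unionCore).1 ∈ γ.finiteCore M := star_mem_iSup_compacts hM
    obtain ⟨b, hb⟩ := exists_represents hN hS'
    have h1 := ha.star hN (finiteCore_le_adjointableAt _ hM) hb
    rw [hφ' M (star T * T) _ (hb.mul ha), h1]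
    refine mul_nonneg (by simp) (integral_nonneg_complex fun x => ?_)
    rw [trace_apply]
    refine Finset.sum_nonneg fun w _ => ?_
    change 0 ≤ (∑ v, star (a v _) * a v _) _
    rw [ContinuousMap.sum_apply]
    exact Finset.sum_nonneg fun v _ => star_mul_self_nonneg _)
  exact ⟨τ, fun n T a ha => by rw [hτ, hφ' n T a ha]⟩

omit [MeasurableSpace K] [BorelSpace K] in
lemma exists_common_level (T S : γ.unionCore) : ∃ n, (T : γ.adjointable) ∈ γ.finiteCore n ∧
    (S : γ.adjointable) ∈ γ.finiteCore n := by
  obtain ⟨n, hn⟩ := exists_mem_finiteCore T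
  obtain ⟨m, hm⟩ := exists_mem_finiteCore S
  exact ⟨max n m, finiteCore_mono (le_max_left n m) hn, finiteCore_mono (le_max_right n m) hm⟩

lemma exists_isContinuousTrace [Nonempty K] (hN : 2 ≤ N) : ∃ τ, γ.IsContinuousTrace τ := by
  obtain ⟨μ, hμ⟩ := exists_isHutchinsonMeasure hN γ
  have := hμ.1
  obtain ⟨τ, hτ⟩ := hμ.exists_state hN
  have hc := τ.continuous_complex
  have htr : ∀ T S : γ.unionCore, τ (γ.incl T * γ.incl S) = τ (γ.incl S * γ.incl T) :=
    fun T S => by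
      obtain ⟨n, hT, hS⟩ := exists_common_level T S
      obtain ⟨a, ha⟩ := exists_represents hN hT
      obtain ⟨b, hb⟩ := exists_represents hN hS
      rw [← incl_mul, ← incl_mul, hτ n (T * S) _ (ha.mul hb), hτ n (S * T) _ (hb.mul ha),
        Matrix.trace_mul_comm]
  refine ⟨τ, ⟨?_, fun x y => ?_⟩, μ, hμ, fun n T hT a ha => ?_⟩
  · rw [← incl_one, hτ 0 1 1 represents_one]
    simp [Matrix.trace_one]
  · refine core_induction (p := fun x => τ (x * y) = τ (y * x)) (isClosed_eq
      (hc.comp (continuous_id.mul continuous_const))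
      (hc.comp (continuous_const.mul continuous_id))) (fun T => ?_) x
    exact core_induction (p := fun y => τ (γ.incl T * y) = τ (y * γ.incl T)) (isClosed_eq
      (hc.comp (continuous_const.mul continuous_id))
      (hc.comp (continuous_id.mul continuous_const))) (fun S => htr T S) y
  · change τ (γ.incl T) = _
    rw [hτ n T a ha]
    simp only [trace_apply]

/-- The defining formula is assumed only for `T` in `F^(n)`. Comparison with the state of
`exists_state` extends it to every representing matrix of `T`, of whatever level. -/
lemma IsContinuousTrace.apply_incl {τ : γ.Core →ₚ[ℂ] ℂ} (hN : 2 ≤ N)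
    (hτ : γ.IsContinuousTrace τ) : ∃ μ, γ.IsHutchinsonMeasure μ ∧ ∀ n (T : γ.unionCore) a,
      γ.Represents n T a → τ (γ.incl T) = ((N : ℂ) ^ n)⁻¹ * ∫ x, a.trace x ∂μ := by
  obtain ⟨-, μ, hμ, h⟩ := hτ
  obtain ⟨τ', hτ'⟩ := hμ.exists_state hN
  refine ⟨μ, hμ, fun n T a ha => ?_⟩
  obtain ⟨M, hM⟩ := exists_mem_finiteCore T
  obtain ⟨b, hb⟩ := exists_represents hN hM
  have h1 := h M T hM b hb
  simp only [← trace_apply] at h1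
  rw [← hτ' n T a ha, hτ' M T b hb]
  exact h1

theorem existsUnique_isContinuousTrace [Nonempty K] (hN : 2 ≤ N) :
    ∃! τ, γ.IsContinuousTrace τ := by
  obtain ⟨τ, hτ⟩ := exists_isContinuousTrace (γ := γ) hN
  refine ⟨τ, hτ, fun τ' hτ' => ?_⟩
  obtain ⟨μ, hμ, h⟩ := hτ.apply_incl hN
  obtain ⟨μ', hμ', h'⟩ := hτ'.apply_incl hN
  obtain rfl := hμ.unique hN hμ'
  ext x
  refine core_induction (p := fun x => τ' x = τ x)
    (isClosed_eq τ'.continuous_complex τ.continuous_complex) (fun T => ?_) x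
  obtain ⟨M, hM⟩ := exists_mem_finiteCore T
  obtain ⟨a, ha⟩ := exists_represents hN hM
  rw [h M T a ha, h' M T a ha]

/-- The trace is 1 on `θ_{1,1}` at every level, so the GNS representation annihilates no `K(X^{⊗
m})` and is faithful. -/
theorem IsContinuousTrace.traceKernel_eq {τ : γ.Core →ₚ[ℂ] ℂ} (hN : 2 ≤ N)
    (hτ : γ.IsContinuousTrace τ) : traceKernel τ = {0} := by
  obtain ⟨μ, hμ, h⟩ := hτ.apply_incl hN
  have := hμ.1
  ext x
  rw [Set.mem_singleton_iff]
  change τ (star x * x) = 0 ↔ _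
  refine ⟨fun hx => ?_, fun hx => by rw [hx, mul_zero, map_zero]⟩
  rw [← PositiveLinearMap.gns_apply_eq_zero_iff hτ.1.2] at hx
  refine eq_zero_of_frequently fun m₀ => ⟨m₀, le_rfl, τ.GNS, _, _, _, τ.gnsStarAlgHom,
    ⟨1, 1, fun h0 => ?_⟩, hx⟩
  have h2 := τ.inner_cyclicVector_gns (γ.incl (γ.unionRankOne m₀ 1 1))
  obtain ⟨a, ha, ha'⟩ : ∃ a : Matrix (Fin m₀ → Fin N) (Fin m₀ → Fin N) C(K, ℂ),
      γ.Represents m₀ (γ.rankOne m₀ 1 1) a ∧ ∀ w x, a w w x = 1 :=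
    ⟨_, represents_rankOne m₀ 1 1, fun w x => by simp⟩
  have h3 : ∀ x, a.trace x = (N : ℂ) ^ m₀ := fun x => by
    rw [trace_apply]
    simp [ha']
  rw [h0, h m₀ _ a ha] at h2
  simp only [h3, integral_const, probReal_univ, one_smul] at h2
  rw [inv_mul_cancel₀ (pow_ne_zero_complex hN m₀)] at h2
  exact zero_ne_one ((inner_zero_right _).symm.trans h2)

end BranchedMap

/-! ### Approximate matrix units -/

/-- A system of elements `e w v` of a C*-algebra which multiply like the matrix units,
up to a factor which is close to a central contraction. -/
structure MatrixSystem (A : Type u) [CStarAlgebra A] (ι : Type) [Fintype ι] where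
  e : ι → ι → A
  star_e : ∀ w v, star (e w v) = e v w
  mul_of_ne : ∀ {v v'}, v ≠ v' → ∀ w u, e w v * e v' u = 0
  mul_eq : ∀ w v v' u, e w v * e v u = e w v' * e v' u
  norm_unit_le : ‖∑ w, e w w * e w w‖ ≤ 1

namespace MatrixSystem

variable {A : Type u} [CStarAlgebra A] {ι : Type} [Fintype ι] (s : MatrixSystem A ι)

/-- The element `∑ e w w * e w w` which replaces the identity matrix. -/
def unit : A := ∑ w, s.e w w * s.e w w

/-- The failure of `T` to act as the scalar matrix `α`. -/
def defect (T : A) (α : Matrix ι ι ℂ) (p : ι × ι) : A :=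
  s.e p.1 p.2 * T - ∑ u, α p.2 u • s.e p.1 u

/-- `T` is approximated by the scalar matrix `α`, up to `ε`. -/
def IsApprox (T : A) (α : Matrix ι ι ℂ) (ε : ℝ) : Prop :=
  ‖∑ p, star (s.defect T α p) * s.defect T α p‖ ≤ Fintype.card ι * ε ^ 2

lemma star_unit : star s.unit = s.unit := by
  simp [unit, star_sum, s.star_e]

lemma sum_star_mul : ∑ p : ι × ι, star (s.e p.1 p.2) * s.e p.1 p.2 =
    (Fintype.card ι : ℂ) • s.unit := by
  rw [Fintype.sum_prod_type]
  simp only [s.star_e]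
  rw [Finset.sum_congr rfl fun w _ => Finset.sum_congr rfl fun v _ => s.mul_eq v w v v,
    Finset.sum_const, Finset.card_univ, unit, Nat.cast_smul_eq_nsmul]

lemma norm_sum_star_mul_le :
    ‖∑ p : ι × ι, star (s.e p.1 p.2) * s.e p.1 p.2‖ ≤ Fintype.card ι * 1 ^ 2 := by
  rw [sum_star_mul, norm_smul, Complex.norm_natCast, one_pow]
  exact mul_le_mul_of_nonneg_left s.norm_unit_le (Nat.cast_nonneg _)

end MatrixSystem

/-! ### Matrix approximation and the factor property -/

section

variable {A : Type u} [CStarAlgebra A] {H : Type u} [NormedAddCommGroup H] [InnerProductSpace ℂ H]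
  [CompleteSpace H] {π : A →⋆ₐ[ℂ] (H →L[ℂ] H)} {Ω : H}

variable (π Ω) in
/-- The elements of `D` are approximated by scalar matrices, with respect to systems of
approximate matrix units of arbitrarily large size. -/
def HasMatrixApproximation (D : Set A) : Prop :=
  ∀ F : Finset A, (F : Set A) ⊆ D → ∀ ε : ℝ, 0 < ε → ∀ k : ℕ,
    ∃ (ι : Type) (_ : Fintype ι) (s : MatrixSystem A ι), k ≤ Fintype.card ι ∧
      0 < Fintype.card ι ∧ ‖π s.unit Ω - Ω‖ ≤ ε ∧ ∀ T ∈ F, ∃ α : Matrix ι ι ℂ,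
        s.IsApprox T α ε ∧ s.IsApprox (star T) α.conjTranspose ε

omit [CompleteSpace H] in
lemma norm_sum_inner_le {κ : Type*} [Fintype κ] (t : H →L[ℂ] H) {x y : κ → H} {a b : ℝ}
    (ha : 0 ≤ a) (hb : 0 ≤ b) (hx : ∑ i, ‖x i‖ ^ 2 ≤ a ^ 2) (hy : ∑ i, ‖y i‖ ^ 2 ≤ b ^ 2) :
    ‖∑ i, ⟪x i, t (y i)⟫_ℂ‖ ≤ ‖t‖ * (a * b) := by
  have h1 : ∑ i, ‖x i‖ * ‖y i‖ ≤ a * b := by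
    refine le_of_sq_le_sq ?_ (mul_nonneg ha hb)
    refine (Finset.sum_mul_sq_le_sq_mul_sq _ _ _).trans ?_
    rw [mul_pow]
    exact mul_le_mul hx hy (Finset.sum_nonneg fun _ _ => sq_nonneg _) (sq_nonneg _)
  calc ‖∑ i, ⟪x i, t (y i)⟫_ℂ‖ ≤ ∑ i, ‖t‖ * (‖x i‖ * ‖y i‖) :=
        norm_sum_le_of_le _ fun i _ => (norm_inner_le_norm _ _).trans (by
          rw [mul_left_comm]
          exact mul_le_mul_of_nonneg_left (t.le_opNorm _) (norm_nonneg _))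
    _ ≤ _ := by
        rw [← Finset.mul_sum]
        exact mul_le_mul_of_nonneg_left h1 (norm_nonneg _)

lemma sum_norm_map_sq_le {κ : Type*} [Fintype κ] (a : κ → A) (v : H) :
    ∑ i, ‖π (a i) v‖ ^ 2 ≤ ‖∑ i, star (a i) * a i‖ * ‖v‖ ^ 2 := by
  have h1 : ((∑ i, ‖π (a i) v‖ ^ 2 : ℝ) : ℂ) = ⟪v, π (∑ i, star (a i) * a i) v⟫_ℂ := by
    rw [map_sum, sum_apply, inner_sum, Complex.ofReal_sum]
    exact Finset.sum_congr rfl fun i _ => BranchedMap.norm_map_sq (π := π) (a i) v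
  have h2 := congrArg norm h1
  rw [Complex.norm_real, Real.norm_of_nonneg (Finset.sum_nonneg fun _ _ => sq_nonneg _)] at h2
  rw [h2, sq, mul_left_comm]
  refine (norm_inner_le_norm _ _).trans (mul_le_mul_of_nonneg_left ?_ (norm_nonneg _))
  refine (ContinuousLinearMap.le_opNorm _ _).trans ?_
  gcongr
  exact BranchedMap.norm_rep_le π _

namespace IsTracialVector

variable (hΩ : IsTracialVector π Ω)
include hΩ

lemma sum_norm_rightMul_sq_le {κ : Type*} [Fintype κ] (a : κ → A) (v : H) :
    ∑ i, ‖rightMul π Ω (star (a i)) v‖ ^ 2 ≤ ‖∑ i, star (a i) * a i‖ * ‖v‖ ^ 2 := by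
  have h0 : rightMul π Ω (∑ i, star (a i) * a i) =
      ∑ i, rightMul π Ω (a i) * rightMul π Ω (star (a i)) := by
    refine hΩ.ext fun b => ?_
    simp only [sum_apply, mul_apply_eq_comp, hΩ.rightMul_apply, Finset.mul_sum,
      map_sum, mul_assoc]
  have h1 : ((∑ i, ‖rightMul π Ω (star (a i)) v‖ ^ 2 : ℝ) : ℂ) =
      ⟪v, rightMul π Ω (∑ i, star (a i) * a i) v⟫_ℂ := by
    rw [h0, sum_apply, inner_sum, Complex.ofReal_sum]
    refine Finset.sum_congr rfl fun i _ => ?_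
    have h2 := hΩ.inner_rightMul (star (a i)) v (rightMul π Ω (star (a i)) v)
    rw [star_star, inner_self_eq_norm_sq_to_K] at h2
    rw [mul_apply_eq_comp, ← h2]
    simp
  have h2 := congrArg norm h1
  rw [Complex.norm_real, Real.norm_of_nonneg (Finset.sum_nonneg fun _ _ => sq_nonneg _)] at h2
  rw [h2, sq, mul_left_comm]
  refine (norm_inner_le_norm _ _).trans (mul_le_mul_of_nonneg_left ?_ (norm_nonneg _))
  refine (ContinuousLinearMap.le_opNorm _ _).trans ?_
  gcongr
  exact hΩ.norm_rightMul_le _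

/-- The functional `x ↦ ⟪Ω, z π(x) Ω⟫` of a central element `z` is a trace. -/
lemma inner_central_comm {z : H →L[ℂ] H} (hz : z ∈ generatedVN π)
    (hz' : z ∈ (generatedVN π).commutant) (a b : A) :
    ⟪Ω, z (π (a * b) Ω)⟫_ℂ = ⟪Ω, z (π (b * a) Ω)⟫_ℂ := by
  have hc : ∀ a v, π a (z v) = z (π a v) := fun a v =>
    congrArg (fun s : H →L[ℂ] H => s v) (mem_commutant_generatedVN.1 hz' a)
  rw [← hΩ.rightMul_apply, ← hΩ.rightMul_comm hz, ← star_star b, ← hΩ.inner_rightMul,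
    hΩ.rightMul_vector, BranchedMap.inner_map_self, hc, star_star, BranchedMap.rep_mul_apply]

/-- The trace property of `z`, tested on the matrix approximation of `T`. -/
lemma norm_inner_central_sub_le {z : H →L[ℂ] H} (hz : z ∈ generatedVN π)
    (hz' : z ∈ (generatedVN π).commutant) (h1 : ‖Ω‖ = 1) {ι : Type} [Fintype ι]
    (s : MatrixSystem A ι) (hι : 0 < Fintype.card ι) {T : A} {α : Matrix ι ι ℂ} {ε : ℝ}
    (hε : 0 ≤ ε) (h : s.IsApprox T α ε) :
    ‖⟪Ω, z (π (s.unit * T) Ω)⟫_ℂ -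
      (Fintype.card ι : ℂ)⁻¹ * α.trace * ⟪Ω, z (π s.unit Ω)⟫_ℂ‖ ≤ ‖z‖ * ε := by
  classical
  have hc : ∀ a v, π a (z v) = z (π a v) := fun a v =>
    congrArg (fun s : H →L[ℂ] H => s v) (mem_commutant_generatedVN.1 hz' a)
  have hι' : (Fintype.card ι : ℂ) ≠ 0 := by exact_mod_cast hι.ne'
  let φ : A →ₗ[ℂ] ℂ :=
    { toFun := fun a => ⟪Ω, z (π a Ω)⟫_ℂ
      map_add' := fun a b => by rw [map_add, add_apply, map_add, inner_add_right]
      map_smul' := fun c a => by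
        rw [map_smul, smul_apply, map_smul, inner_smul_right]; rfl }
  have hφ : ∀ a b, φ (a * b) = φ (b * a) := hΩ.inner_central_comm hz hz'
  -- In `e_{vw} e_{wv} T` the factor `e_{wv} T` is replaced by `∑ α_{vu} e_{wu}` plus the defect.
  -- The trace property and orthogonality leave only the diagonal entries of `α`.
  have e1 : (Fintype.card ι : ℂ) * φ (s.unit * T) =
      ∑ p, φ (s.e p.2 p.1 * s.defect T α p) + α.trace * φ s.unit := by
    have e2 : ∀ p : ι × ι, φ (s.e p.2 p.1 * s.e p.1 p.2 * T) =
        φ (s.e p.2 p.1 * s.defect T α p) + α p.2 p.2 * φ (s.e p.1 p.1 * s.e p.1 p.1) :=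
      fun p => by
        have e3 : φ (s.e p.2 p.1 * ∑ u, α p.2 u • s.e p.1 u) =
            α p.2 p.2 * φ (s.e p.1 p.1 * s.e p.1 p.1) := by
          rw [Finset.mul_sum, map_sum, Finset.sum_eq_single p.2]
          · rw [mul_smul_comm, map_smul, smul_eq_mul, hφ, s.mul_eq _ _ p.1]
          · intro u _ hu
            rw [mul_smul_comm, map_smul, hφ, s.mul_of_ne hu, map_zero, smul_zero]
          · simp
        rw [← e3, ← map_add, ← mul_add, MatrixSystem.defect, sub_add_cancel, mul_assoc]
    have e4 : (Fintype.card ι : ℂ) * φ (s.unit * T) =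
        ∑ p : ι × ι, φ (s.e p.2 p.1 * s.e p.1 p.2 * T) := by
      rw [← smul_eq_mul, ← map_smul, ← smul_mul_assoc, ← s.sum_star_mul, Finset.sum_mul, map_sum]
      simp only [s.star_e]
    rw [e4, Finset.sum_congr rfl fun p _ => e2 p, Finset.sum_add_distrib]
    congr 1
    rw [Fintype.sum_prod_type]
    simp only [← Finset.sum_mul, ← Finset.mul_sum, MatrixSystem.unit, map_sum, Matrix.trace,
      Matrix.diag_apply]
  have e5 : φ (s.unit * T) - (Fintype.card ι : ℂ)⁻¹ * α.trace * φ s.unit =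
      (Fintype.card ι : ℂ)⁻¹ * ∑ p, φ (s.e p.2 p.1 * s.defect T α p) := by
    rw [eq_sub_of_add_eq e1.symm]
    field_simp
  change ‖φ (s.unit * T) - (Fintype.card ι : ℂ)⁻¹ * α.trace * φ s.unit‖ ≤ _
  rw [e5, norm_mul, norm_inv, Complex.norm_natCast, inv_mul_le_iff₀ (by exact_mod_cast hι)]
  have e6 : ∀ p, φ (s.e p.2 p.1 * s.defect T α p) =
      ⟪π (s.e p.1 p.2) Ω, z (π (s.defect T α p) Ω)⟫_ℂ := fun p => by
    rw [BranchedMap.inner_map_self, s.star_e, hc, ← BranchedMap.rep_mul_apply]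
    rfl
  have hsq : √(Fintype.card ι : ℝ) ^ 2 = Fintype.card ι := Real.sq_sqrt (Nat.cast_nonneg _)
  rw [Finset.sum_congr rfl fun p _ => e6 p]
  refine (norm_sum_inner_le z (a := √(Fintype.card ι)) (b := √(Fintype.card ι) * ε)
    (Real.sqrt_nonneg _) (by positivity) ?_ ?_).trans_eq (by rw [← mul_assoc √_, ← sq, hsq]; ring)
  · refine (sum_norm_map_sq_le _ _).trans ?_
    rw [h1, one_pow, mul_one, hsq]
    simpa using s.norm_sum_star_mul_le
  · refine (sum_norm_map_sq_le _ _).trans ?_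
    rw [h1, one_pow, mul_one, mul_pow, hsq]
    exact h

/-- The trace property applied to a central `z` and to 1 produces the same scalar, the normalised
trace of `α`. Eliminating it gives `⟪Ω, zTΩ⟫ = ⟪Ω, zΩ⟫ ⟪Ω, TΩ⟫`. Then `z*Ω` is a multiple of `Ω`,
and `z` is scalar because `Ω` is separating. -/
theorem isFactor_generatedVN {D : Set A} (hD : Dense D) (h1 : ‖Ω‖ = 1)
    (h : HasMatrixApproximation π Ω D) : (generatedVN π).IsFactor := by
  refine ⟨⟨Ω, 0, fun h0 => by simp [h0] at h1⟩, fun z hz hz' => ?_⟩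
  have hone : (1 : H →L[ℂ] H) ∈ generatedVN π := one_mem _
  have hone' : (1 : H →L[ℂ] H) ∈ (generatedVN π).commutant := one_mem _
  have hπ := BranchedMap.continuous_rep π
  have key : ∀ T, ⟪Ω, z (π T Ω)⟫_ℂ = ⟪Ω, z Ω⟫_ℂ * ⟪Ω, π T Ω⟫_ℂ := fun T => by
    refine hD.induction (P := fun T => ⟪Ω, z (π T Ω)⟫_ℂ = ⟪Ω, z Ω⟫_ℂ * ⟪Ω, π T Ω⟫_ℂ)
      (fun T hT => ?_) (isClosed_eq (by fun_prop) (by fun_prop)) T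
    have hε : ∀ k : ℕ, (0 : ℝ) < 1 / (k + 1) := fun k => by positivity
    choose ι hι s _ hpos hs hα using fun k : ℕ => h {T} (by simpa using hT) (1 / (k + 1)) (hε k) 0
    choose α hα _ using fun k => hα k T (by simp)
    have hlim : Filter.Tendsto (fun k : ℕ => π (s k).unit Ω) Filter.atTop (𝓝 Ω) := by
      rw [tendsto_iff_norm_sub_tendsto_zero]
      exact squeeze_zero (fun _ => norm_nonneg _) hs tendsto_one_div_add_atTop_nhds_zero_nat
    have hl : ∀ z : H →L[ℂ] H, z ∈ generatedVN π → z ∈ (generatedVN π).commutant →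
        Filter.Tendsto (fun k => ⟪Ω, z (π (s k).unit Ω)⟫_ℂ) Filter.atTop (𝓝 ⟪Ω, z Ω⟫_ℂ) ∧
        Filter.Tendsto (fun k => ⟪Ω, z (π ((s k).unit * T) Ω)⟫_ℂ) Filter.atTop
          (𝓝 ⟪Ω, z (π T Ω)⟫_ℂ) ∧
        Filter.Tendsto (fun k => ⟪Ω, z (π ((s k).unit * T) Ω)⟫_ℂ -
          (Fintype.card (ι k) : ℂ)⁻¹ * (α k).trace * ⟪Ω, z (π (s k).unit Ω)⟫_ℂ)
          Filter.atTop (𝓝 0) := by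
      intro z hz hz'
      refine ⟨((by fun_prop : Continuous fun v => ⟪Ω, z v⟫_ℂ).tendsto Ω).comp hlim, ?_, ?_⟩
      · refine Filter.Tendsto.congr (fun k => (hΩ.inner_central_comm hz hz' _ _).symm) ?_
        simp only [BranchedMap.rep_mul_apply]
        exact ((by fun_prop : Continuous fun v => ⟪Ω, z (π T v)⟫_ℂ).tendsto Ω).comp hlim
      · refine squeeze_zero_norm (fun k => hΩ.norm_inner_central_sub_le hz hz' h1 (s k) (hpos k)
          (hε k).le (hα k)) ?_
        simpa using tendsto_one_div_add_atTop_nhds_zero_nat.const_mul ‖z‖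
    obtain ⟨a1, a2, a3⟩ := hl z hz hz'
    obtain ⟨b1, b2, b3⟩ := hl 1 hone hone'
    have hΩΩ : ⟪Ω, (1 : H →L[ℂ] H) Ω⟫_ℂ = 1 := by
      rw [one_apply_eq_self, inner_self_eq_norm_sq_to_K, h1]; simp
    -- The normalised traces of the matrices `α k` are not known to converge; this combination
    -- cancels them.
    have l1 := (a3.mul b1).sub (b3.mul a1)
    have l2 := (a2.mul b1).sub (b2.mul a1)
    have h2 := tendsto_nhds_unique (l1.congr fun k => by ring) l2
    rw [hΩΩ, mul_one, mul_one, zero_mul, sub_zero, one_apply_eq_self] at h2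
    linear_combination -h2
  have h2 : star z Ω = (starRingEnd ℂ) ⟪Ω, z Ω⟫_ℂ • Ω := by
    refine hΩ.dense.eq_of_inner_left ℂ fun a => ?_
    rw [ContinuousLinearMap.star_eq_adjoint, ContinuousLinearMap.adjoint_inner_left, key,
      inner_smul_left, Complex.conj_conj]
  refine ⟨⟪Ω, z Ω⟫_ℂ, ?_⟩
  have h3 := hΩ.eq_of_apply_eq (m' := (starRingEnd ℂ) ⟪Ω, z Ω⟫_ℂ • 1) (star_mem hz)
    ((generatedVN π).toStarSubalgebra.smul_mem hone _) h2
  have h4 := congrArg star h3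
  rw [star_star, star_smul, star_one] at h4
  simpa using h4

end IsTracialVector

end

/-! ### Absence of minimal projections -/

namespace VonNeumannAlgebra

variable {H : Type u} [NormedAddCommGroup H] [InnerProductSpace ℂ H] [CompleteSpace H]
  {M : VonNeumannAlgebra H}

/-- The range projection of an element of a von Neumann algebra belongs to it. -/
lemma exists_rangeProjection {b : H →L[ℂ] H} (hb : b ∈ M) : ∃ q ∈ M, IsStarProjection q ∧
    q * b = b ∧ ∀ c : H →L[ℂ] H, c * b = 0 → c * q = 0 := by
  let V := b.range.topologicalClosure
  have hbV : ∀ v, b v ∈ V := fun v => subset_closure ⟨v, rfl⟩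
  have : CompleteSpace V := (Submodule.isClosed_topologicalClosure _).completeSpace_coe
  refine ⟨V.starProjection, ?_, isStarProjection_starProjection, ?_, fun c hc => ?_⟩
  · rw [IsStarProjection.mem_iff isStarProjection_starProjection]
    intro y hy v hv
    have hv' : v ∈ V := by simpa using hv
    have h1 : y v ∈ V := by
      refine map_mem_closure y.continuous hv' ?_
      rintro _ ⟨u, rfl⟩
      refine ⟨y u, ?_⟩
      exact congrArg (fun s : H →L[ℂ] H => s u) (mem_commutant_iff.1 hy b hb)
    simpa using h1
  · ext v
    rw [mul_apply_eq_comp]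
    exact Submodule.starProjection_eq_self_iff.2 (hbV v)
  · ext v
    have h1 : V ≤ c.ker := Submodule.topologicalClosure_minimal _ (by
      rintro _ ⟨u, rfl⟩
      exact congrArg (fun s : H →L[ℂ] H => s u) hc) c.isClosed_ker
    exact h1 (Submodule.starProjection_apply_mem V v)

/-- Below a minimal projection, self-adjoint elements are semi-definite. -/
lemma posPart_eq_zero_or_negPart_eq_zero {p : H →L[ℂ] H} (hp : IsStarProjection p)
    (hmin : ∀ q ∈ M, IsStarProjection q → q ≠ 0 → p * q = q → q = p) {a : H →L[ℂ] H} (ha : a ∈ M)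
    (hsa : IsSelfAdjoint a) (hpa : p * a = a) : a⁺ = 0 ∨ a⁻ = 0 := by
  have hps : star p = p := hp.isSelfAdjoint
  have hposM : a⁺ ∈ M := by
    rw [← M.commutant_commutant]
    refine mem_commutant_iff.2 fun g hg => ?_
    have h1 : Commute a g := mem_commutant_iff.1 hg a ha
    exact (hsa.commute_cfcₙ h1 _).symm
  have hpos : IsSelfAdjoint a⁺ := (CFC.posPart_nonneg a).isSelfAdjoint
  have hneg : IsSelfAdjoint a⁻ := (CFC.negPart_nonneg a).isSelfAdjoint
  have h0 : (1 - p) * a⁺ = (1 - p) * a⁻ := by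
    rw [← sub_eq_zero, ← mul_sub, CFC.posPart_sub_negPart a hsa, sub_mul, one_mul, hpa, sub_self]
  -- Since `(1 - p) a = 0`, the element `(1 - p) a⁺` equals `(1 - p) a⁻`; its product with its
  -- adjoint contains `a⁻ a⁺ = 0`.
  have h1 : (1 - p) * a⁺ = 0 := by
    have h2 : ((1 - p) * a⁺) * star ((1 - p) * a⁺) = 0 := by
      rw [star_mul, hpos.star_eq, h0, mul_assoc, ← mul_assoc a⁻, CFC.negPart_mul_posPart,
        zero_mul, mul_zero]
    exact CStarRing.mul_star_self_eq_zero_iff _ |>.1 h2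
  have h2 : (1 - p) * a⁻ = 0 := by rw [← h0, h1]
  -- The range projection of `a⁺` lies below `p`. If it is nonzero it equals `p` by minimality, and
  -- as `a⁻` annihilates it, `a⁻ = a⁻ p = 0`.
  obtain ⟨q, hqM, hq, hqa, hqc⟩ := exists_rangeProjection hposM
  by_cases hq0 : q = 0
  · left
    rw [← hqa, hq0, zero_mul]
  · right
    have h3 : p * q = q := by
      have := hqc _ h1
      rw [sub_mul, one_mul, sub_eq_zero] at this
      exact this.symm
    have h4 := hqc _ (CFC.negPart_mul_posPart a)
    rw [hmin q hqM hq hq0 h3] at h4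
    rw [sub_mul, one_mul, sub_eq_zero] at h2
    have h5 := congrArg star h4
    rw [star_mul, hps, hneg.star_eq, star_zero] at h5
    rw [h2, h5]

end VonNeumannAlgebra

section

variable {H : Type u} [NormedAddCommGroup H] [InnerProductSpace ℂ H] [CompleteSpace H]

lemma ContinuousLinearMap.apply_eq_zero_of_inner_eq_zero {a : H →L[ℂ] H} (ha : 0 ≤ a) {v : H}
    (h : ⟪v, a v⟫_ℂ = 0) : a v = 0 := by
  obtain ⟨b, rfl⟩ := CStarAlgebra.nonneg_iff_eq_star_mul_self.1 ha
  rw [mul_apply_eq_comp, ContinuousLinearMap.star_eq_adjoint,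
    ContinuousLinearMap.adjoint_inner_right, inner_self_eq_zero] at h
  rw [mul_apply_eq_comp, h, map_zero]

variable {A : Type u} [CStarAlgebra A] {π : A →⋆ₐ[ℂ] (H →L[ℂ] H)} {Ω : H}

namespace IsTracialVector

variable (hΩ : IsTracialVector π Ω)
include hΩ

/-- Below a minimal projection, self-adjoint elements are scalar. -/
lemma eq_smul_of_minimal {p : H →L[ℂ] H} (hpM : p ∈ generatedVN π) (hp : IsStarProjection p)
    (hp0 : p ≠ 0)
    (hmin : ∀ q ∈ generatedVN π, IsStarProjection q → q ≠ 0 → p * q = q → q = p)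
    {y : H →L[ℂ] H} (hy : y ∈ generatedVN π) (hsa : IsSelfAdjoint y) (hpy : p * y = y) :
    ∃ c : ℂ, y = c • p := by
  have hpΩ : p Ω ≠ 0 := fun h => hp0 (hΩ.eq_of_apply_eq hpM (zero_mem _) h)
  have hps : star p = p := hp.isSelfAdjoint
  have hpp : p * p = p := hp.isIdempotentElem
  have hin : ⟪Ω, p Ω⟫_ℂ = ((‖p Ω‖ ^ 2 : ℝ) : ℂ) := by
    nth_rw 1 [← hpp]
    rw [mul_apply_eq_comp]
    nth_rw 1 [← hps]
    rw [ContinuousLinearMap.star_eq_adjoint, ContinuousLinearMap.adjoint_inner_right,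
      inner_self_eq_norm_sq_to_K]
    simp
  have hreal : (starRingEnd ℂ) ⟪Ω, y Ω⟫_ℂ = ⟪Ω, y Ω⟫_ℂ := by
    rw [inner_conj_symm]
    nth_rw 1 [← hsa.star_eq]
    rw [ContinuousLinearMap.star_eq_adjoint, ContinuousLinearMap.adjoint_inner_left]
  obtain ⟨r, hr⟩ := Complex.conj_eq_iff_real.1 hreal
  -- With this `c` the vector state is 0 on `a = y - c p`; being semidefinite, `a` then annihilates
  -- `Ω` and vanishes.
  set c : ℝ := r / ‖p Ω‖ ^ 2 with hc
  set a := y - (c : ℂ) • p with ha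
  have haM : a ∈ generatedVN π := sub_mem hy ((generatedVN π).toStarSubalgebra.smul_mem hpM _)
  have hasa : IsSelfAdjoint a := hsa.sub (by
    rw [isSelfAdjoint_iff, star_smul, hps, Complex.star_def, Complex.conj_ofReal])
  have haΩ : ⟪Ω, a Ω⟫_ℂ = 0 := by
    rw [ha, sub_apply, smul_apply, inner_sub_right, inner_smul_right, hin, hr, hc,
      ← Complex.ofReal_mul, div_mul_cancel₀ _ (by simpa using hpΩ), sub_self]
  have h0 : a Ω = 0 := by
    have hd := CFC.posPart_sub_negPart a hasa
    rcases VonNeumannAlgebra.posPart_eq_zero_or_negPart_eq_zero hp hmin haM hasa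
      (by rw [ha, mul_sub, hpy, mul_smul_comm, hpp]) with h | h
    · rw [h, zero_sub] at hd
      rw [← hd, neg_apply] at haΩ ⊢
      rw [inner_neg_right, neg_eq_zero] at haΩ
      rw [ContinuousLinearMap.apply_eq_zero_of_inner_eq_zero (CFC.negPart_nonneg a) haΩ, neg_zero]
    · rw [h, sub_zero] at hd
      rw [← hd] at haΩ ⊢
      exact ContinuousLinearMap.apply_eq_zero_of_inner_eq_zero (CFC.posPart_nonneg a) haΩ
  exact ⟨c, sub_eq_zero.1 (hΩ.eq_of_apply_eq haM (zero_mem _) h0)⟩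

/-- The von Neumann algebra has no minimal projections. -/
theorem exists_subprojection {D : Set A} (h1 : ‖Ω‖ = 1) (h : HasMatrixApproximation π Ω D)
    {p : H →L[ℂ] H} (hpM : p ∈ generatedVN π) (hp : IsStarProjection p) (hp0 : p ≠ 0) :
    ∃ q ∈ generatedVN π, IsStarProjection q ∧ q ≠ 0 ∧ q ≠ p ∧ p * q = q := by
  by_contra! hmin
  replace hmin : ∀ q ∈ generatedVN π, IsStarProjection q → q ≠ 0 → p * q = q → q = p :=
    fun q hq hq' hq0 hpq => by
      by_contra hne
      exact hmin q hq hq' hq0 hne hpq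
  have hpΩ : p Ω ≠ 0 := fun h => hp0 (hΩ.eq_of_apply_eq hpM (zero_mem _) h)
  have hps : star p = p := hp.isSelfAdjoint
  have hpp : p * p = p := hp.isIdempotentElem
  have hpp' : ∀ x : H →L[ℂ] H, p * (p * x) = p * x := fun x => by rw [← mul_assoc, hpp]
  have hpn : 0 < ‖p Ω‖ := norm_pos_iff.2 hpΩ
  -- More than `1 / ‖pΩ‖²` orthogonal copies of `p` cannot fit under a normalised trace.
  obtain ⟨k, hk⟩ := exists_nat_gt (1 / ‖p Ω‖ ^ 2)
  obtain ⟨ι, _, s, hkι, hpos, hs, -⟩ := h ∅ (by simp) (‖p Ω‖ / 2) (by positivity) k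
  have hnormp : ‖p‖ ≤ 1 := hp.norm_le
  have he : ∀ w v, star (π (s.e w v)) = π (s.e v w) := fun w v => by rw [← map_star, s.star_e]
  -- Otherwise `p` would annihilate `s.unit Ω`, which is closer to `Ω` than `‖pΩ‖`.
  obtain ⟨w, hw⟩ : ∃ w, π (s.e w w) * p ≠ 0 := by
    by_contra! hcon
    have h2 : π s.unit * p = 0 := by
      simp only [MatrixSystem.unit, map_sum, map_mul, Finset.sum_mul, mul_assoc, hcon, mul_zero,
        Finset.sum_const_zero]
    have h3 := congrArg star h2
    rw [star_mul, hps, ← map_star, s.star_unit, star_zero] at h3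
    have h4 : ‖p Ω‖ ≤ 1 * (‖p Ω‖ / 2) := by
      have h5 : p (π s.unit Ω - Ω) = - p Ω := by
        rw [map_sub, ← mul_apply_eq_comp, h3, zero_apply, zero_sub]
      have h6 : ‖p Ω‖ = ‖p (π s.unit Ω - Ω)‖ := by rw [h5, norm_neg]
      exact h6.trans_le ((p.le_opNorm _).trans (mul_le_mul hnormp hs (norm_nonneg _) zero_le_one))
    linarith
  have hy : ∀ v, p * π (s.e w v) * π (s.e v w) * p = p * π (s.e w w) * π (s.e w w) * p := fun v => by
    rw [mul_assoc p, ← map_mul, s.mul_eq w v w w, map_mul, ← mul_assoc]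
  obtain ⟨L, hL⟩ := hΩ.eq_smul_of_minimal hpM hp hp0 hmin
    (y := p * π (s.e w w) * π (s.e w w) * p)
    (mul_mem (mul_mem (mul_mem hpM (map_mem_generatedVN _)) (map_mem_generatedVN _)) hpM)
    (by simp only [isSelfAdjoint_iff, star_mul, he, hps, mul_assoc])
    (by simp only [← mul_assoc, hpp])
  have hL0 : L ≠ 0 := fun h0 => by
    rw [h0, zero_smul] at hL
    refine hw (CStarRing.star_mul_self_eq_zero_iff _ |>.1 ?_)
    rw [star_mul, he, hps, ← mul_assoc]
    exact hL
  -- Up to the scalar `L`, the `σ v` are partial isometries from `p` onto orthogonal ranges. Their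
  -- sum `Q` satisfies `Q² = L Q`, so its trace is at most `‖L‖` in absolute value. It equals `card
  -- ι` times `L ‖pΩ‖²`, which is too large.
  let σ : ι → H →L[ℂ] H := fun v => π (s.e v w) * p
  have hσM : ∀ v, σ v ∈ generatedVN π := fun v => mul_mem (map_mem_generatedVN _) hpM
  have hσs : ∀ v, star (σ v) = p * π (s.e w v) := fun v => by
    simp only [σ, star_mul, he, hps]
  have hσσ : ∀ v, star (σ v) * σ v = L • p := fun v => by
    rw [hσs, ← hL, ← hy v]
    simp only [σ, mul_assoc]
  have hσ0 : ∀ v u, v ≠ u → star (σ v) * σ u = 0 := fun v u hvu => by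
    rw [hσs]
    simp only [σ]
    rw [mul_assoc, ← mul_assoc (π _), ← map_mul, s.mul_of_ne hvu, map_zero, zero_mul, mul_zero]
  set Q := ∑ v, σ v * star (σ v) with hQ
  have hQs : star Q = Q := by simp [hQ, star_sum]
  have hQQ : Q * Q = L • Q := by
    rw [hQ, Finset.sum_mul_sum, Finset.smul_sum]
    refine Finset.sum_congr rfl fun v _ => ?_
    rw [Finset.sum_eq_single v]
    · rw [mul_assoc, ← mul_assoc (star _), hσσ, smul_mul_assoc, mul_smul_comm, hσs, hpp']
    · intro u _ hu
      rw [mul_assoc, ← mul_assoc (star _), hσ0 v u hu.symm, zero_mul, mul_zero]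
    · simp
  have hn : ∀ t : H →L[ℂ] H, ∀ v, ⟪v, (star t * t) v⟫_ℂ = ((‖t v‖ ^ 2 : ℝ) : ℂ) := fun t v => by
    rw [mul_apply_eq_comp, ContinuousLinearMap.star_eq_adjoint,
      ContinuousLinearMap.adjoint_inner_right, inner_self_eq_norm_sq_to_K]
    simp
  have e1 : ∀ v, ((‖σ v Ω‖ ^ 2 : ℝ) : ℂ) = L * ((‖p Ω‖ ^ 2 : ℝ) : ℂ) := fun v => by
    rw [← hn, ← hn, hσσ, hps, hpp, smul_apply, inner_smul_right]
  have e2 : ⟪Ω, Q Ω⟫_ℂ = Fintype.card ι * (L * ((‖p Ω‖ ^ 2 : ℝ) : ℂ)) := by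
    rw [hQ, sum_apply, inner_sum, Finset.sum_congr rfl fun v _ => ?_, Finset.sum_const,
      Finset.card_univ, nsmul_eq_mul]
    rw [← e1 v, ← hΩ.norm_star_vector (hσM v), ← hn, star_star]
  have e3 : ((‖Q Ω‖ ^ 2 : ℝ) : ℂ) = L * ⟪Ω, Q Ω⟫_ℂ := by
    rw [← hn, hQs, hQQ, smul_apply, inner_smul_right]
  have hLpos : 0 < ‖L‖ := norm_pos_iff.2 hL0
  have e4 : ‖Q Ω‖ ^ 2 ≤ ‖L‖ * ‖Q Ω‖ := by
    have := congrArg norm e3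
    rw [Complex.norm_real, Real.norm_of_nonneg (sq_nonneg _), norm_mul] at this
    rw [this]
    refine mul_le_mul_of_nonneg_left ((norm_inner_le_norm _ _).trans ?_) hLpos.le
    rw [h1, one_mul]
  have e5 : ‖Q Ω‖ ≤ ‖L‖ := by
    rcases eq_or_ne ‖Q Ω‖ 0 with h0 | h0
    · rw [h0]; exact hLpos.le
    · rw [sq] at e4
      exact le_of_mul_le_mul_right e4 (lt_of_le_of_ne (norm_nonneg _) h0.symm)
  have e6 : (Fintype.card ι : ℝ) * (‖L‖ * ‖p Ω‖ ^ 2) ≤ ‖Q Ω‖ := by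
    have := congrArg norm e2
    rw [norm_mul, norm_mul, Complex.norm_real, Real.norm_of_nonneg (sq_nonneg _),
      Complex.norm_natCast] at this
    rw [← this]
    refine (norm_inner_le_norm _ _).trans ?_
    rw [h1, one_mul]
  have e7 : (Fintype.card ι : ℝ) * ‖p Ω‖ ^ 2 ≤ 1 := by
    have : ‖L‖ * ((Fintype.card ι : ℝ) * ‖p Ω‖ ^ 2) ≤ ‖L‖ * 1 := by linarith
    exact le_of_mul_le_mul_left this hLpos
  rw [div_lt_iff₀ (by positivity)] at hk
  have e8 : (k : ℝ) ≤ Fintype.card ι := by exact_mod_cast hkι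
  nlinarith [sq_nonneg ‖p Ω‖]

theorem isTypeII1Factor_generatedVN {D : Set A} (hD : Dense D) (h1 : ‖Ω‖ = 1)
    (h : HasMatrixApproximation π Ω D) : (generatedVN π).IsTypeII1Factor :=
  ⟨hΩ.isFactor_generatedVN hD h1 h, fun _ hu hu' => hΩ.mul_star_eq_one hu hu', fun _ hp hp' hp0 =>
    hΩ.exists_subprojection h1 h hp hp' hp0⟩

end IsTracialVector

end

/-! ### Injectivity: averaging over the commutant and weak limits -/

section

variable {H : Type u} [NormedAddCommGroup H] [InnerProductSpace ℂ H] [CompleteSpace H]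

/-- Contractions of `B(H)` have limits along ultrafilters in the topology of pointwise weak
convergence. -/
lemma exists_weak_limit {I : Type*} (l : Ultrafilter I)
    (Φ : I → (H →L[ℂ] H) →ₗ[ℂ] (H →L[ℂ] H)) (hΦ : ∀ i x, ‖Φ i x‖ ≤ ‖x‖) :
    ∃ E : (H →L[ℂ] H) →ₗ[ℂ] (H →L[ℂ] H), (∀ x, ‖E x‖ ≤ ‖x‖) ∧ ∀ x v w,
      Filter.Tendsto (fun i => ⟪v, Φ i x w⟫_ℂ) l (𝓝 ⟪v, E x w⟫_ℂ) := by
  have hb : ∀ x v w i, ‖⟪Φ i x w, v⟫_ℂ‖ ≤ ‖x‖ * ‖w‖ * ‖v‖ := fun x v w i =>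
    (norm_inner_le_norm _ _).trans (mul_le_mul_of_nonneg_right (((Φ i x).le_opNorm w).trans
      (mul_le_mul_of_nonneg_right (hΦ i x) (norm_nonneg _))) (norm_nonneg _))
  have hlim : ∀ x w v, ∃ c, Filter.Tendsto (fun i => ⟪Φ i x w, v⟫_ℂ) l (𝓝 c) := fun x w v => by
    obtain ⟨c, -, hc⟩ := (isCompact_closedBall (0 : ℂ) (‖x‖ * ‖w‖ * ‖v‖)).ultrafilter_le_nhds
      (l.map fun i => ⟪Φ i x w, v⟫_ℂ) (by
        rw [Filter.le_principal_iff]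
        exact Filter.Eventually.of_forall (f := (l : Filter I))
          fun i => mem_closedBall_zero_iff.2 (hb x v w i))
    exact ⟨c, hc⟩
  choose B hB using hlim
  have hBn : ∀ x w v, ‖B x w v‖ ≤ ‖x‖ * ‖w‖ * ‖v‖ := fun x w v =>
    le_of_tendsto (hB x w v).norm (Filter.Eventually.of_forall (hb x v w))
  -- The limits of the matrix coefficients form a bounded sesquilinear form, which the Riesz theorem
  -- turns into an operator.
  let F : (H →L[ℂ] H) → H → StrongDual ℂ H := fun x w => LinearMap.mkContinuous
    { toFun := B x w
      map_add' := fun v v' => tendsto_nhds_unique (hB x w (v + v'))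
        (((hB x w v).add (hB x w v')).congr fun i => (inner_add_right _ _ _).symm)
      map_smul' := fun c v => tendsto_nhds_unique (hB x w (c • v))
        (((hB x w v).const_mul c).congr fun i => (inner_smul_right _ _ _).symm) }
    (‖x‖ * ‖w‖) (hBn x w)
  let R : (H →L[ℂ] H) → H → H := fun x w => (InnerProductSpace.toDual ℂ H).symm (F x w)
  have hR : ∀ x w v, Filter.Tendsto (fun i => ⟪Φ i x w, v⟫_ℂ) l (𝓝 ⟪R x w, v⟫_ℂ) :=
    fun x w v => by
      have : ⟪R x w, v⟫_ℂ = B x w v := InnerProductSpace.toDual_symm_apply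
      rw [this]
      exact hB x w v
  have hRn : ∀ x w, ‖R x w‖ ≤ ‖x‖ * ‖w‖ := fun x w => by
    simp only [R, LinearIsometryEquiv.norm_map]
    exact LinearMap.mkContinuous_norm_le _ (by positivity) _
  have hext : ∀ {a b : H}, (∀ v, ⟪a, v⟫_ℂ = ⟪b, v⟫_ℂ) → a = b := fun h => ext_inner_right ℂ h
  let S : (H →L[ℂ] H) → H →L[ℂ] H := fun x => LinearMap.mkContinuous
    { toFun := R x
      map_add' := fun w w' => hext fun v => by
        refine tendsto_nhds_unique (hR x (w + w') v) ?_
        rw [inner_add_left]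
        exact ((hR x w v).add (hR x w' v)).congr fun i => by rw [map_add, inner_add_left]
      map_smul' := fun c w => hext fun v => by
        refine tendsto_nhds_unique (hR x (c • w) v) ?_
        rw [RingHom.id_apply, inner_smul_left]
        exact ((hR x w v).const_mul _).congr fun i => by rw [map_smul, inner_smul_left] }
    ‖x‖ (hRn x)
  refine ⟨{ toFun := S
            map_add' := fun x x' => ContinuousLinearMap.ext fun w => hext fun v => by
              refine tendsto_nhds_unique (hR (x + x') w v) ?_
              rw [add_apply, inner_add_left]
              exact ((hR x w v).add (hR x' w v)).congr fun i => by
                rw [map_add, add_apply, inner_add_left]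
            map_smul' := fun c x => ContinuousLinearMap.ext fun w => hext fun v => by
              refine tendsto_nhds_unique (hR (c • x) w v) ?_
              rw [RingHom.id_apply, smul_apply, inner_smul_left]
              exact ((hR x w v).const_mul _).congr fun i => by
                rw [map_smul, smul_apply, inner_smul_left] },
    fun x => LinearMap.mkContinuous_norm_le _ (norm_nonneg _) (hRn x), fun x v w => ?_⟩
  have h1 := (Complex.continuous_conj.tendsto _).comp (hR x w v)
  rw [inner_conj_symm] at h1
  exact h1.congr fun i => inner_conj_symm _ _

variable {A : Type u} [CStarAlgebra A] {π : A →⋆ₐ[ℂ] (H →L[ℂ] H)} {Ω : H}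

namespace IsTracialVector

variable {ι : Type} [Fintype ι] (s : MatrixSystem A ι)

variable (π Ω) in
/-- The average of `x` over a system of approximate matrix units of the commutant. -/
noncomputable def average : (H →L[ℂ] H) →ₗ[ℂ] (H →L[ℂ] H) :=
  (Fintype.card ι : ℂ)⁻¹ • ∑ p : ι × ι,
    LinearMap.mulLeft ℂ (rightMul π Ω (s.e p.1 p.2)) ∘ₗ
      LinearMap.mulRight ℂ (rightMul π Ω (star (s.e p.1 p.2)))

lemma average_apply (x : H →L[ℂ] H) : average π Ω s x = (Fintype.card ι : ℂ)⁻¹ • ∑ p : ι × ι,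
    rightMul π Ω (s.e p.1 p.2) * (x * rightMul π Ω (star (s.e p.1 p.2))) := by
  simp [average, LinearMap.sum_apply]

variable (hΩ : IsTracialVector π Ω)
include hΩ

lemma inner_average (x : H →L[ℂ] H) (v w : H) :
    ⟪v, average π Ω s x w⟫_ℂ = (Fintype.card ι : ℂ)⁻¹ * ∑ p : ι × ι,
      ⟪rightMul π Ω (star (s.e p.1 p.2)) v, x (rightMul π Ω (star (s.e p.1 p.2)) w)⟫_ℂ := by
  rw [average_apply, smul_apply, inner_smul_right, sum_apply, inner_sum]
  congr 1
  refine Finset.sum_congr rfl fun p _ => ?_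
  rw [mul_apply_eq_comp, mul_apply_eq_comp, hΩ.inner_rightMul, star_star]

/-- The Cauchy–Schwarz estimate for averages. -/
lemma norm_inv_card_mul_sum_le (hι : 0 < Fintype.card ι) (x : H →L[ℂ] H) {a b : ι × ι → A}
    {ε δ : ℝ} (hε : 0 ≤ ε) (hδ : 0 ≤ δ)
    (ha : ‖∑ p, star (a p) * a p‖ ≤ Fintype.card ι * ε ^ 2)
    (hb : ‖∑ p, star (b p) * b p‖ ≤ Fintype.card ι * δ ^ 2) (v w : H) :
    ‖(Fintype.card ι : ℂ)⁻¹ * ∑ p, ⟪rightMul π Ω (star (a p)) v,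
      x (rightMul π Ω (star (b p)) w)⟫_ℂ‖ ≤ ‖x‖ * (ε * ‖v‖) * (δ * ‖w‖) := by
  have hsq : √(Fintype.card ι : ℝ) ^ 2 = Fintype.card ι := Real.sq_sqrt (Nat.cast_nonneg _)
  rw [norm_mul, norm_inv, Complex.norm_natCast, inv_mul_le_iff₀ (by exact_mod_cast hι)]
  refine (norm_sum_inner_le x (a := √(Fintype.card ι) * (ε * ‖v‖))
    (b := √(Fintype.card ι) * (δ * ‖w‖)) (by positivity) (by positivity) ?_ ?_).trans_eq ?_
  · refine (hΩ.sum_norm_rightMul_sq_le _ _).trans ?_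
    rw [mul_pow, hsq, mul_pow, ← mul_assoc]
    exact mul_le_mul_of_nonneg_right ha (sq_nonneg _)
  · refine (hΩ.sum_norm_rightMul_sq_le _ _).trans ?_
    rw [mul_pow, hsq, mul_pow, ← mul_assoc]
    exact mul_le_mul_of_nonneg_right hb (sq_nonneg _)
  · rw [show ‖x‖ * (√(Fintype.card ι) * (ε * ‖v‖) * (√(Fintype.card ι) * (δ * ‖w‖))) =
      √(Fintype.card ι) ^ 2 * (‖x‖ * (ε * ‖v‖) * (δ * ‖w‖)) by ring, hsq]

/-- Cauchy–Schwarz with both families equal to the matrix units, whose sum of `e* e` has norm at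
most `card ι`. -/
lemma norm_average_le (hι : 0 < Fintype.card ι) (x : H →L[ℂ] H) : ‖average π Ω s x‖ ≤ ‖x‖ := by
  refine ContinuousLinearMap.opNorm_le_bound _ (norm_nonneg _) fun w => ?_
  have h1 := hΩ.norm_inv_card_mul_sum_le hι x zero_le_one zero_le_one s.norm_sum_star_mul_le
    s.norm_sum_star_mul_le (average π Ω s x w) w
  rw [← hΩ.inner_average, BranchedMap.norm_inner_self_eq] at h1
  rcases eq_or_ne ‖average π Ω s x w‖ 0 with h0 | h0
  · rw [h0]; positivity
  · refine le_of_mul_le_mul_right ?_ (lt_of_le_of_ne (norm_nonneg _) h0.symm)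
    linarith

/-- Elements of the von Neumann algebra commute with right multiplications, so averaging only
inserts `s.unit` in front of `Ω`, where it is almost the identity. -/
lemma average_of_mem (hι : 0 < Fintype.card ι) {x : H →L[ℂ] H} (hx : x ∈ generatedVN π) (a : A) :
    average π Ω s x (π a Ω) = x (π a (π s.unit Ω)) := by
  have hι' : (Fintype.card ι : ℂ) ≠ 0 := by exact_mod_cast hι.ne'
  rw [average_apply, smul_apply, sum_apply]
  have h1 : ∀ p : ι × ι, (rightMul π Ω (s.e p.1 p.2) *
      (x * rightMul π Ω (star (s.e p.1 p.2)))) (π a Ω) =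
      x (π a (π (star (s.e p.1 p.2) * s.e p.1 p.2) Ω)) := fun p => by
    rw [mul_apply_eq_comp, mul_apply_eq_comp, hΩ.rightMul_comm hx, hΩ.rightMul_apply,
      hΩ.rightMul_apply, mul_assoc, BranchedMap.rep_mul_apply]
  rw [Finset.sum_congr rfl fun p _ => h1 p, ← map_sum, ← map_sum, ← sum_apply, ← map_sum,
    s.sum_star_mul, map_smul, smul_apply, map_smul, map_smul, inv_smul_smul₀ hι']

/-- Averages approximately commute with the right multiplications. -/
lemma norm_inner_average_sub_le (hι : 0 < Fintype.card ι) (x : H →L[ℂ] H) {T : A}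
    {α : Matrix ι ι ℂ} {ε : ℝ} (hε : 0 ≤ ε) (h : s.IsApprox T α ε)
    (h' : s.IsApprox (star T) α.conjTranspose ε) (v w : H) :
    ‖⟪v, (rightMul π Ω T * average π Ω s x) w⟫_ℂ -
      ⟪v, (average π Ω s x * rightMul π Ω T) w⟫_ℂ‖ ≤ 2 * ‖x‖ * ‖v‖ * ‖w‖ * ε := by
  set e : ι × ι → A := fun p => s.e p.1 p.2 with he
  set r := rightMul π Ω with hr
  have hadd : ∀ a b : A, r (a + b) = r a + r b := hΩ.rightMul_add
  have hsum : ∀ a : ι → A, r (∑ u, a u) = ∑ u, r (a u) := fun a =>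
    map_sum (AddMonoidHom.mk' r hadd) a _
  have hdec : ∀ (T : A) (α : Matrix ι ι ℂ) (p : ι × ι) (v : H), r (star (e p * T)) v =
      r (star (s.defect T α p)) v + ∑ u, star (α p.2 u) • r (star (s.e p.1 u)) v := by
    intro T α p v
    have h1 : e p * T = s.defect T α p + ∑ u, α p.2 u • s.e p.1 u := by
      rw [MatrixSystem.defect, sub_add_cancel]
    rw [h1, star_add, hadd, add_apply, star_sum, hsum, sum_apply]
    congr 1
    refine Finset.sum_congr rfl fun u _ => ?_
    rw [star_smul, hr, hΩ.rightMul_smul, smul_apply]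
  have hcomb : ∀ p u v, r (star (e p)) (r (star u) v) = r (star (e p * star (star u))) v := by
    intro p u v
    rw [star_star, star_mul, hr, hΩ.rightMul_mul, mul_apply_eq_comp]
  have e1 : ⟪v, (r T * average π Ω s x) w⟫_ℂ = (Fintype.card ι : ℂ)⁻¹ *
      (∑ p, ⟪r (star (s.defect T α p)) v, x (r (star (e p)) w)⟫_ℂ +
        ∑ p : ι × ι, ∑ u, α p.2 u * ⟪r (star (s.e p.1 u)) v, x (r (star (e p)) w)⟫_ℂ) := by
    have h1 : ⟪v, (r T * average π Ω s x) w⟫_ℂ = ⟪r (star T) v, average π Ω s x w⟫_ℂ := by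
      rw [mul_apply_eq_comp, hΩ.inner_rightMul, star_star]
    rw [h1, hΩ.inner_average, ← Finset.sum_add_distrib]
    congr 1
    refine Finset.sum_congr rfl fun p _ => ?_
    change ⟪r (star (e p)) (r (star T) v), _⟫_ℂ = _
    rw [hcomb, star_star, hdec T α, inner_add_left, sum_inner]
    congr 1
    refine Finset.sum_congr rfl fun u _ => ?_
    rw [inner_smul_left, Complex.star_def, Complex.conj_conj]
  have e2 : ⟪v, (average π Ω s x * r T) w⟫_ℂ = (Fintype.card ι : ℂ)⁻¹ *
      (∑ p, ⟪r (star (e p)) v, x (r (star (s.defect (star T) α.conjTranspose p)) w)⟫_ℂ +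
        ∑ p : ι × ι, ∑ u, α u p.2 * ⟪r (star (e p)) v, x (r (star (s.e p.1 u)) w)⟫_ℂ) := by
    rw [mul_apply_eq_comp, hΩ.inner_average, ← Finset.sum_add_distrib]
    congr 1
    refine Finset.sum_congr rfl fun p _ => ?_
    change ⟪_, x (r (star (e p)) (r T w))⟫_ℂ = _
    have h1 := hcomb p (star T) w
    rw [star_star] at h1
    rw [h1, hdec (star T) α.conjTranspose, map_add, inner_add_right, map_sum, inner_sum]
    congr 1
    refine Finset.sum_congr rfl fun u _ => ?_
    rw [map_smul, inner_smul_right, Matrix.conjTranspose_apply, star_star]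
  -- The contributions of `α` on the two sides agree after exchange of the summation indices; only
  -- the defects of `T` and of `star T` remain.
  have e3 : ∑ p : ι × ι, ∑ u, α p.2 u * ⟪r (star (s.e p.1 u)) v, x (r (star (e p)) w)⟫_ℂ =
      ∑ p : ι × ι, ∑ u, α u p.2 * ⟪r (star (e p)) v, x (r (star (s.e p.1 u)) w)⟫_ℂ := by
    rw [Fintype.sum_prod_type, Fintype.sum_prod_type]
    exact Finset.sum_congr rfl fun i _ => Finset.sum_comm
  rw [e1, e2, e3, ← mul_sub, add_sub_add_right_eq_sub, mul_sub]
  have b1 := hΩ.norm_inv_card_mul_sum_le hι x hε zero_le_one h s.norm_sum_star_mul_le v w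
  have b2 := hΩ.norm_inv_card_mul_sum_le hι x zero_le_one hε s.norm_sum_star_mul_le h' v w
  refine (norm_sub_le _ _).trans ((add_le_add b1 b2).trans_eq ?_)
  ring

/-- The averages are contractions, almost fix the von Neumann algebra, and almost commute with more
and more right multiplications. A weak limit along an ultrafilter finer than the order on pairs
(finite subset of `D`, accuracy) does so exactly, and the commutation theorem places its values in
the algebra. -/
theorem isInjective_generatedVN {D : Set A} (hD : Dense D)
    (h : HasMatrixApproximation π Ω D) : (generatedVN π).IsInjective := by
  classical
  let I := Finset D × ℕ
  have hε : ∀ i : I, (0 : ℝ) < 1 / (i.2 + 1) := fun i => by positivity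
  choose ι hι s _ hpos hs hα using fun i : I =>
    h (i.1.image Subtype.val) (by simp) (1 / (i.2 + 1)) (hε i) 0
  let l : Ultrafilter I := Ultrafilter.of Filter.atTop
  have hl : (l : Filter I) ≤ Filter.atTop := Ultrafilter.of_le _
  have hε0 : Filter.Tendsto (fun i : I => (1 : ℝ) / (i.2 + 1)) l (𝓝 0) := by
    refine (tendsto_one_div_add_atTop_nhds_zero_nat.comp ?_).mono_left hl
    rw [← Filter.prod_atTop_atTop_eq]
    exact Filter.tendsto_snd
  obtain ⟨E, hE, hlim⟩ := exists_weak_limit l (fun i => average π Ω (s i))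
    fun i x => hΩ.norm_average_le (s i) (hpos i) x
  have hΩlim : Filter.Tendsto (fun i => π (s i).unit Ω) l (𝓝 Ω) := by
    rw [tendsto_iff_norm_sub_tendsto_zero]
    exact squeeze_zero (fun _ => norm_nonneg _) hs hε0
  refine ⟨E, fun x => hΩ.mem_generatedVN_of_commute fun a => ?_, fun x hx => ?_, hE⟩
  · refine ContinuousLinearMap.ext fun w => ext_inner_left ℂ fun v => ?_
    refine hD.induction (P := fun a => ⟪v, (rightMul π Ω a * E x) w⟫_ℂ =
      ⟪v, (E x * rightMul π Ω a) w⟫_ℂ) (fun T hT => ?_) ?_ a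
    · have l1 : Filter.Tendsto (fun i => ⟪v, (rightMul π Ω T * average π Ω (s i) x) w⟫_ℂ) l
          (𝓝 ⟪v, (rightMul π Ω T * E x) w⟫_ℂ) := by
        have h1 : ∀ y : H →L[ℂ] H, ⟪v, (rightMul π Ω T * y) w⟫_ℂ =
            ⟪rightMul π Ω (star T) v, y w⟫_ℂ := fun y => by
          rw [mul_apply_eq_comp, hΩ.inner_rightMul, star_star]
        simp only [h1]
        exact hlim x _ w
      have l2 : Filter.Tendsto (fun i => ⟪v, (average π Ω (s i) x * rightMul π Ω T) w⟫_ℂ) l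
          (𝓝 ⟪v, (E x * rightMul π Ω T) w⟫_ℂ) := hlim x v _
      have l3 : Filter.Tendsto (fun i => ⟪v, (rightMul π Ω T * average π Ω (s i) x) w⟫_ℂ -
          ⟪v, (average π Ω (s i) x * rightMul π Ω T) w⟫_ℂ) l (𝓝 0) := by
        have h1 : Filter.Tendsto (fun i : I => 2 * ‖x‖ * ‖v‖ * ‖w‖ * (1 / ((i.2 : ℝ) + 1))) l
            (𝓝 0) := by
          simpa using hε0.const_mul (2 * ‖x‖ * ‖v‖ * ‖w‖)
        refine squeeze_zero_norm' ?_ h1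
        have h2 : ∀ᶠ i : I in Filter.atTop, (⟨T, hT⟩ : D) ∈ i.1 := by
          filter_upwards [Filter.eventually_ge_atTop (({⟨T, hT⟩}, 0) : I)] with i hi
          exact hi.1 (Finset.mem_singleton_self _)
        filter_upwards [hl h2] with i hi
        obtain ⟨α, hα1, hα2⟩ := hα i T (Finset.mem_image_of_mem _ hi)
        exact hΩ.norm_inner_average_sub_le (s i) (hpos i) x (hε i).le hα1 hα2 v w
      exact sub_eq_zero.1 (tendsto_nhds_unique (l1.sub l2) l3)
    · have hc : Continuous (rightMul π Ω) := by
        let R : A →ₗ[ℂ] (H →L[ℂ] H) :=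
          { toFun := rightMul π Ω, map_add' := hΩ.rightMul_add, map_smul' := hΩ.rightMul_smul }
        exact (R.mkContinuous 1 fun x => by
          rw [one_mul]; exact hΩ.norm_rightMul_le x).continuous
      simp only [mul_apply_eq_comp]
      exact isClosed_eq (by fun_prop) (by fun_prop)
  · refine hΩ.ext fun a => ext_inner_left ℂ fun v => ?_
    refine tendsto_nhds_unique (hlim x v (π a Ω)) ?_
    simp only [fun i => hΩ.average_of_mem (s i) (hpos i) hx a]
    exact ((by fun_prop : Continuous fun u => ⟪v, x (π a u)⟫_ℂ).tendsto Ω).comp hΩlim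

end IsTracialVector

end

/-! ### Bounds for matrices acting on square summable families -/

/-- The matrix `M` is bounded by `C` on `ℓ²`. -/
def IsSquareBound {ι : Type*} [Fintype ι] (M : ι → ι → ℂ) (C : ℝ) : Prop :=
  ∀ ξ : ι → ℂ, ∑ w, ‖∑ v, M w v * ξ v‖ ^ 2 ≤ C ^ 2 * ∑ v, ‖ξ v‖ ^ 2

lemma isSquareBound_of_norm_le {ι : Type*} [Fintype ι] {M : ι → ι → ℂ} {δ : ℝ}
    (h : ∀ w v, ‖M w v‖ ≤ δ) : IsSquareBound M (Fintype.card ι * δ) := fun ξ => by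
  have h1 : ∀ w, ‖∑ v, M w v * ξ v‖ ^ 2 ≤ δ ^ 2 * (Fintype.card ι * ∑ v, ‖ξ v‖ ^ 2) := fun w => by
    have h2 : ‖∑ v, M w v * ξ v‖ ≤ δ * ∑ v, ‖ξ v‖ := by
      rw [Finset.mul_sum]
      refine norm_sum_le_of_le _ fun v _ => ?_
      rw [norm_mul]
      exact mul_le_mul_of_nonneg_right (h w v) (norm_nonneg _)
    calc _ ≤ (δ * ∑ v, ‖ξ v‖) ^ 2 := pow_le_pow_left₀ (norm_nonneg _) h2 2
      _ ≤ _ := by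
        rw [mul_pow]
        exact mul_le_mul_of_nonneg_left (sq_sum_le_card_mul_sum_sq) (sq_nonneg _)
  refine (Finset.sum_le_sum fun w _ => h1 w).trans_eq ?_
  rw [Finset.sum_const, Finset.card_univ, nsmul_eq_mul]
  ring

namespace BranchedMap

variable {K : Type u} [MetricSpace K] {N : ℕ} {γ : BranchedMap K N} {n m : ℕ}

lemma isSquareBound_blockDiag {b : Matrix (Fin n → Fin N) (Fin n → Fin N) C(K, ℂ)} {y z : K}
    {C : ℝ} (h : ∀ j, IsSquareBound (fun w v => b w v (γ.map j y) - b w v (γ.map j z)) C) :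
    IsSquareBound (fun w v => γ.blockDiag n b w v y - γ.blockDiag n b w v z) C := fun ξ => by
  rw [sum_words_succ, sum_words_succ, Finset.mul_sum]
  refine Finset.sum_le_sum fun i _ => ?_
  refine le_trans (Finset.sum_le_sum fun w _ => le_of_eq ?_) (h i fun v => ξ (Fin.cons i v))
  rw [sum_words_succ, Finset.sum_eq_single i]
  · simp only [blockDiag_cons_cons, if_true]
  · intro j _ hj
    simp [blockDiag_cons_cons, hj.symm]
  · simp

variable [CompactSpace K]

omit [CompactSpace K] in
-- At level `m + k` the matrix over `y` is the direct sum of the blocks `a(γ_c y)` over words `c` of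
-- length `k`, so its oscillation is that of `a` on the small sets `γ_c(K)`.
lemma Represents.exists_add {T : γ.adjointable}
    {a : Matrix (Fin m → Fin N) (Fin m → Fin N) C(K, ℂ)} (ha : γ.Represents m T a) (C : ℝ) (k : ℕ) :
    ∃ b, γ.Represents (m + k) T b ∧ ∀ y z,
      (∀ c : Fin k → Fin N,
        IsSquareBound (fun w v => a w v (γ.word k c y) - a w v (γ.word k c z)) C) →
      IsSquareBound (fun w v => b w v y - b w v z) C := by
  induction k with
  | zero => exact ⟨a, ha, fun y z h => h Fin.elim0⟩
  | succ k ih =>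
    obtain ⟨b, hb, hb'⟩ := ih
    exact ⟨_, hb.blockDiag, fun y z h => isSquareBound_blockDiag fun j => hb' _ _ fun c =>
      h (Fin.cons j c)⟩

/-- The oscillation of the matrices representing `T` tends to zero. -/
lemma exists_isSquareBound_sub (hN : 2 ≤ N) (T : γ.unionCore) {ε : ℝ} (hε : 0 < ε) :
    ∃ n₀, ∀ n ≥ n₀, (T : γ.adjointable) ∈ γ.finiteCore n ∧ ∃ b, γ.Represents n T b ∧
      ∀ y z, IsSquareBound (fun w v => b w v y - b w v z) ε := by
  obtain ⟨m, hm⟩ := exists_mem_finiteCore T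
  obtain ⟨a, ha⟩ := exists_represents hN hm
  have hNp : (0 : ℝ) < Fintype.card (Fin m → Fin N) := by
    have : NeZero N := ⟨by omega⟩
    exact_mod_cast Fintype.card_pos
  have hF : Continuous fun y w v => a w v y := by fun_prop
  obtain ⟨δ, hδ, h⟩ := Metric.uniformContinuous_iff.1
    (CompactSpace.uniformContinuous_of_continuous hF) (ε / Fintype.card (Fin m → Fin N))
    (by positivity)
  obtain ⟨k₀, hk₀⟩ := γ.exists_dist_word_lt hδ
  refine ⟨m + k₀, fun n hn => ?_⟩
  obtain ⟨k, rfl⟩ := Nat.exists_eq_add_of_le ((Nat.le_add_right m k₀).trans hn)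
  obtain ⟨b, hb, hb'⟩ := ha.exists_add ε k
  refine ⟨finiteCore_mono (Nat.le_add_right m k) hm, b, hb, fun y z => hb' y z fun c => ?_⟩
  have h1 := h (hk₀ k (by omega) c y z)
  have h2 := isSquareBound_of_norm_le (M := fun w v => a w v (γ.word k c y) - a w v (γ.word k c z))
    (δ := ε / Fintype.card (Fin m → Fin N)) fun w v => by
      rw [← dist_eq_norm]
      exact (dist_le_pi_dist _ _ v).trans ((dist_le_pi_dist (fun w v => a w v (γ.word k c y))
        (fun w v => a w v (γ.word k c z)) w).trans h1.le)
  rwa [mul_div_cancel₀ _ hNp.ne'] at h2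

/-! ### Matrices of the elements of the finite cores -/

variable (γ) in
/-- `T` is an element of the `n`-th finite core with the matrix `a`. -/
def HasMatrix (n : ℕ) (T : γ.unionCore) (a : Matrix (Fin n → Fin N) (Fin n → Fin N) C(K, ℂ)) :
    Prop :=
  (T : γ.adjointable) ∈ γ.finiteCore n ∧ γ.Represents n T a

namespace HasMatrix

variable {T S : γ.unionCore} {a b : Matrix (Fin n → Fin N) (Fin n → Fin N) C(K, ℂ)}

lemma add (hT : γ.HasMatrix n T a) (hS : γ.HasMatrix n S b) : γ.HasMatrix n (T + S) (a + b) :=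
  ⟨add_mem hT.1 hS.1, hT.2.add hS.2⟩

lemma sub (hT : γ.HasMatrix n T a) (hS : γ.HasMatrix n S b) : γ.HasMatrix n (T - S) (a - b) :=
  ⟨sub_mem hT.1 hS.1, hT.2.sub hS.2⟩

lemma smul (hT : γ.HasMatrix n T a) (c : ℂ) : γ.HasMatrix n (c • T) (c • a) :=
  ⟨Submodule.smul_mem _ c hT.1, hT.2.smul c⟩

lemma mul (hT : γ.HasMatrix n T a) (hS : γ.HasMatrix n S b) : γ.HasMatrix n (T * S) (a * b) :=
  ⟨mul_mem_iSup_compacts (fun _ _ => max_le) hT.1 hS.1, hT.2.mul hS.2⟩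

lemma zero : γ.HasMatrix n 0 0 := ⟨zero_mem _, fun f y w => by
  simp only [Matrix.zero_apply, ContinuousMap.zero_apply, zero_mul, Finset.sum_const_zero]
  rfl⟩

lemma one : γ.HasMatrix n 1 1 := ⟨one_mem_finiteCore n, represents_one⟩

lemma sum {κ : Type*} (s : Finset κ) {T : κ → γ.unionCore}
    {a : κ → Matrix (Fin n → Fin N) (Fin n → Fin N) C(K, ℂ)}
    (h : ∀ i, γ.HasMatrix n (T i) (a i)) : γ.HasMatrix n (∑ i ∈ s, T i) (∑ i ∈ s, a i) := by
  classical
  induction s using Finset.induction_on with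
  | empty => simpa using zero
  | insert i s hi ih => rw [Finset.sum_insert hi, Finset.sum_insert hi]; exact (h i).add ih

lemma conjTranspose (hN : 2 ≤ N) (hT : γ.HasMatrix n T a) :
    γ.HasMatrix n (star T) a.conjTranspose := by
  have hS : (star T : γ.unionCore).1 ∈ γ.finiteCore n := star_mem_iSup_compacts hT.1
  obtain ⟨b, hb⟩ := exists_represents hN hS
  have h1 := hT.2.star hN (finiteCore_le_adjointableAt _ hT.1) hb
  exact ⟨hS, h1 ▸ hb⟩

lemma ext (hT : γ.HasMatrix n T a) (hS : γ.HasMatrix n S a) : T = S :=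
  Subtype.ext (adjointable_ext fun f x => by
    obtain ⟨w, y, rfl⟩ := γ.exists_word n x
    rw [hT.2, hS.2])

lemma norm_incl_le (hT : γ.HasMatrix n T a) {C : ℝ} (hC : 0 ≤ C)
    (h : ∀ y, IsSquareBound (fun w v => a w v y) C) : ‖γ.incl T‖ ≤ C := by
  rw [norm_incl]
  refine norm_le (n := n) ⟨hC, fun f y => ?_⟩
  refine le_of_sq_le_sq ?_ (mul_nonneg hC (norm_nonneg _))
  rw [mul_pow, EuclideanSpace.norm_sq_eq, EuclideanSpace.norm_sq_eq]
  refine le_of_eq_of_le (Finset.sum_congr rfl fun w _ => ?_) (h y fun v => f (γ.word n v y))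
  rw [fibre_apply, hT.2]

end HasMatrix

/-! ### Approximate matrix units -/

omit [CompactSpace K] in
-- `f w` is `ψ ∘ h^n` on the branch `γ_w(K)` and 0 elsewhere; it is continuous because `ψ` vanishes
-- where words collide.
lemma exists_sections {ψ : C(K, ℝ)} (hψ : ∀ y ∈ γ.collisionSet n, ψ y = 0) :
    ∃ f : (Fin n → Fin N) → C(K, ℂ), ∀ w v y,
      f w (γ.word n v y) = if w = v then (ψ y : ℂ) else 0 := by
  classical
  refine ⟨fun w => ⟨fun x => if γ.word n w (γ.h^[n] x) = x then (ψ (γ.h^[n] x) : ℂ) else 0,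
    continuous_ite_fixed (σ := fun w x => γ.word n w (γ.h^[n] x))
      (fun w => (γ.continuous_word n w).comp (γ.h.continuous.iterate n))
      (fun x => γ.exists_word_iterate n x)
      (Complex.continuous_ofReal.comp (ψ.continuous.comp (γ.h.continuous.iterate n)))
      (fun x w v hwv hw hv => ?_) w⟩, fun w v y => ?_⟩
  · change ((ψ (γ.h^[n] x) : ℝ) : ℂ) = 0
    rw [hψ _ fun hinj => hwv (hinj (hw.trans hv.symm)), Complex.ofReal_zero]
  · simp only [ContinuousMap.coe_mk, γ.iterate_word]
    by_cases hwv : w = v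
    · simp [hwv]
    · rw [if_neg hwv]
      split_ifs with h
      · rw [hψ y fun hinj => hwv (hinj h), Complex.ofReal_zero]
      · rfl

lemma exists_hasMatrix_single {ψ : C(K, ℝ)} (hψ : ∀ y ∈ γ.collisionSet n, ψ y = 0) :
    ∃ E : (Fin n → Fin N) → (Fin n → Fin N) → γ.unionCore,
      ∀ w v, γ.HasMatrix n (E w v) (Matrix.single w v (ψ * ψ).ofRealC) := by
  obtain ⟨f, hf⟩ := exists_sections hψ
  refine ⟨fun w v => γ.unionRankOne n (f w) (f v), fun w v => ⟨compacts_le le_rfl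
    (rankOne_mem_compacts n _ _), ?_⟩⟩
  obtain ⟨a, ha, ha'⟩ : ∃ a : Matrix (Fin n → Fin N) (Fin n → Fin N) C(K, ℂ),
      γ.Represents n (γ.rankOne n (f w) (f v)) a ∧ ∀ w' v' y,
        a w' v' y = f w (γ.word n w' y) * star (f v (γ.word n v' y)) :=
    ⟨_, represents_rankOne n (f w) (f v), fun _ _ _ => rfl⟩
  have h1 : a = Matrix.single w v (ψ * ψ).ofRealC :=
    Matrix.ext fun w' v' => ContinuousMap.ext fun y => by
      rw [ha', hf, hf, Matrix.single_apply]
      by_cases h1 : w = w' <;> by_cases h2 : v = v' <;> simp [h1, h2]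
  rw [← h1]
  exact ha

end BranchedMap

namespace BranchedMap

variable {K : Type u} [MetricSpace K] {N : ℕ} {γ : BranchedMap K N} {n m : ℕ} [CompactSpace K]

lemma incl_sum {κ : Type*} (s : Finset κ) (T : κ → γ.unionCore) :
    γ.incl (∑ i ∈ s, T i) = ∑ i ∈ s, γ.incl (T i) := map_sum (toCore (γ := γ)) T s

section

variable {ψ : C(K, ℝ)} {E : (Fin n → Fin N) → (Fin n → Fin N) → γ.unionCore}
  (hE : ∀ w v, γ.HasMatrix n (E w v) (Matrix.single w v (ψ * ψ).ofRealC))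
include hE

lemma hasMatrix_sum_single : γ.HasMatrix n (∑ w, E w w * E w w)
    (Matrix.diagonal fun _ => ((ψ * ψ) * (ψ * ψ)).ofRealC) := by
  have h1 := HasMatrix.sum Finset.univ fun w => (hE w w).mul (hE w w)
  have h2 : ∑ w : Fin n → Fin N, Matrix.single w w (ψ * ψ).ofRealC *
      Matrix.single w w (ψ * ψ).ofRealC = Matrix.diagonal fun _ => ((ψ * ψ) * (ψ * ψ)).ofRealC := by
    simp only [Matrix.single_mul_single_same]
    refine Matrix.ext fun w v => ContinuousMap.ext fun y => ?_
    rw [Matrix.sum_apply, Finset.sum_eq_single w]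
    · by_cases h : w = v
      · subst h; simp
      · simp [h]
    · intro u _ hu
      simp [hu]
    · simp
  rwa [h2] at h1

/-- The approximate matrix units of the core. -/
noncomputable def matrixSystem (hN : 2 ≤ N) (hψ1 : ∀ y, ψ y ∈ Set.Icc (0 : ℝ) 1) :
    MatrixSystem γ.Core (Fin n → Fin N) where
  e w v := γ.incl (E w v)
  star_e w v := by
    rw [← incl_star]
    congr 1
    refine ((hE w v).conjTranspose hN).ext ?_
    have h1 : (Matrix.single w v (ψ * ψ).ofRealC).conjTranspose =
        Matrix.single v w (ψ * ψ).ofRealC := by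
      rw [Matrix.conjTranspose_single]
      congr 1
      ext y
      simp
    rw [h1]
    exact hE v w
  mul_of_ne {v v'} hvv' w u := by
    rw [← incl_mul, ← incl_zero]
    congr 1
    refine ((hE w v).mul (hE v' u)).ext ?_
    rw [Matrix.single_mul_single_of_ne _ _ _ _ hvv']
    exact HasMatrix.zero
  mul_eq w v v' u := by
    rw [← incl_mul, ← incl_mul]
    congr 1
    refine ((hE w v).mul (hE v u)).ext ?_
    have h1 := (hE w v').mul (hE v' u)
    rw [Matrix.single_mul_single_same] at h1 ⊢
    exact h1
  norm_unit_le := by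
    simp only [← incl_mul]
    rw [← incl_sum]
    refine (hasMatrix_sum_single hE).norm_incl_le zero_le_one fun y ξ => ?_
    rw [one_pow, one_mul]
    refine Finset.sum_le_sum fun w _ => ?_
    have h1 : ∑ v, (Matrix.diagonal (fun _ : Fin n → Fin N =>
        ((ψ * ψ) * (ψ * ψ)).ofRealC)) w v y * ξ v = ((ψ y * ψ y * (ψ y * ψ y) : ℝ) : ℂ) * ξ w := by
      rw [Finset.sum_eq_single w]
      · simp
      · intro v _ hv
        simp [Matrix.diagonal_apply_ne _ hv.symm]
      · simp
    rw [h1, norm_mul, Complex.norm_real]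
    refine pow_le_pow_left₀ (by positivity) (mul_le_of_le_one_left (norm_nonneg _) ?_) 2
    have h2 := hψ1 y
    rw [Real.norm_of_nonneg (by have := h2.1; positivity)]
    exact mul_le_one₀ (mul_le_one₀ h2.2 h2.1 h2.2) (mul_nonneg h2.1 h2.1)
      (mul_le_one₀ h2.2 h2.1 h2.2)

/-- The defect at `(w, v)` has the matrix `ψ² E_{wv} (b - α)`, where `E_{wv}` is a matrix unit. The
sum of all `defect* defect` is `card` times `Z* Z`, where `Z` has the matrix `ψ² (b - α)` and norm
at most `ε`. This accounts for the cardinality in `IsApprox`. -/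
lemma isApprox_matrixSystem (hN : 2 ≤ N) (hψ1 : ∀ y, ψ y ∈ Set.Icc (0 : ℝ) 1) {T : γ.unionCore}
    {b : Matrix (Fin n → Fin N) (Fin n → Fin N) C(K, ℂ)} (hT : γ.HasMatrix n T b) {ε : ℝ}
    (hε : 0 ≤ ε) {α : Matrix (Fin n → Fin N) (Fin n → Fin N) ℂ}
    (h : ∀ y, IsSquareBound (fun w v => b w v y - α w v) ε) :
    (matrixSystem hE hN hψ1).IsApprox (γ.incl T) α ε := by
  set B : Matrix (Fin n → Fin N) (Fin n → Fin N) C(K, ℂ) :=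
    b - α.map (algebraMap ℂ C(K, ℂ)) with hB
  let D : (Fin n → Fin N) × (Fin n → Fin N) → γ.unionCore := fun p =>
    E p.1 p.2 * T - ∑ u, α p.2 u • E p.1 u
  have hD : ∀ p, γ.HasMatrix n (D p) (Matrix.single p.1 p.2 (ψ * ψ).ofRealC * B) := fun p => by
    have h1 := ((hE p.1 p.2).mul hT).sub (HasMatrix.sum Finset.univ fun u =>
      (hE p.1 u).smul (α p.2 u))
    have h2 : Matrix.single p.1 p.2 (ψ * ψ).ofRealC * α.map (algebraMap ℂ C(K, ℂ)) =
        ∑ u, α p.2 u • Matrix.single p.1 u (ψ * ψ).ofRealC := by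
      refine Matrix.ext fun w v => ContinuousMap.ext fun y => ?_
      rw [Matrix.sum_apply, Finset.sum_eq_single v]
      · by_cases hw : w = p.1
        · subst hw
          simp [mul_comm]
        · simp [Matrix.single_mul_apply_of_ne _ _ _ _ _ hw, Ne.symm hw]
      · intro u _ hu
        simp [hu]
      · simp
    rw [hB, mul_sub, h2]
    exact h1
  have hdef : ∀ p, (matrixSystem hE hN hψ1).defect (γ.incl T) α p = γ.incl (D p) := fun p => by
    simp only [D, MatrixSystem.defect, matrixSystem, incl_sub, incl_mul, incl_sum, incl_smul]
  have hZ := HasMatrix.sum Finset.univ fun v : Fin n → Fin N => hD (v, v)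
  set Z : γ.unionCore := ∑ v, D (v, v) with hZdef
  set P : Matrix (Fin n → Fin N) (Fin n → Fin N) C(K, ℂ) :=
    Matrix.diagonal fun _ => (ψ * ψ).ofRealC with hP
  have hPs : ∑ v : Fin n → Fin N, Matrix.single v v (ψ * ψ).ofRealC = P :=
    Matrix.sum_single_eq_diagonal _
  simp only [← Finset.sum_mul, hPs] at hZ
  have hsum : ∑ p, star (D p) * D p = (Fintype.card (Fin n → Fin N) : ℂ) • (star Z * Z) := by
    refine (HasMatrix.sum Finset.univ fun p => ((hD p).conjTranspose hN).mul (hD p)).ext ?_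
    have h1 := (((hZ.conjTranspose hN).mul hZ).smul (Fintype.card (Fin n → Fin N) : ℂ))
    convert h1 using 1
    have hreal : star (ψ * ψ).ofRealC = (ψ * ψ).ofRealC := by ext y; simp
    have hPP : ∑ p : (Fin n → Fin N) × (Fin n → Fin N),
        Matrix.single p.2 p.1 (ψ * ψ).ofRealC * Matrix.single p.1 p.2 (ψ * ψ).ofRealC =
          (Fintype.card (Fin n → Fin N) : ℂ) • (P.conjTranspose * P) := by
      simp only [Matrix.single_mul_single_same]
      rw [Fintype.sum_prod_type]
      simp only
      rw [Finset.sum_const, Finset.card_univ, Nat.cast_smul_eq_nsmul,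
        Matrix.sum_single_eq_diagonal, hP, Matrix.diagonal_conjTranspose,
        Matrix.diagonal_mul_diagonal]
      simp only [Pi.star_apply, hreal]
    calc ∑ p : (Fin n → Fin N) × (Fin n → Fin N),
        (Matrix.single p.1 p.2 (ψ * ψ).ofRealC * B).conjTranspose *
          (Matrix.single p.1 p.2 (ψ * ψ).ofRealC * B) =
        B.conjTranspose * (∑ p : (Fin n → Fin N) × (Fin n → Fin N),
          Matrix.single p.2 p.1 (ψ * ψ).ofRealC * Matrix.single p.1 p.2 (ψ * ψ).ofRealC) * B := by
          rw [Finset.mul_sum, Finset.sum_mul]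
          refine Finset.sum_congr rfl fun p _ => ?_
          rw [Matrix.conjTranspose_mul, Matrix.conjTranspose_single, hreal]
          simp only [Matrix.mul_assoc]
      _ = _ := by
          rw [hPP, Matrix.conjTranspose_mul]
          simp only [Matrix.mul_assoc, Matrix.mul_smul, Matrix.smul_mul]
  have hZn : ‖γ.incl Z‖ ≤ ε := by
    refine hZ.norm_incl_le hε fun y ξ => ?_
    refine le_trans (Finset.sum_le_sum fun w _ => ?_) (h y ξ)
    have h1 : ∑ v, (P * B) w v y * ξ v =
        ((ψ y * ψ y : ℝ) : ℂ) * ∑ v, (b w v y - α w v) * ξ v := by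
      rw [Finset.mul_sum]
      refine Finset.sum_congr rfl fun v _ => ?_
      rw [hP, Matrix.diagonal_mul, hB]
      simp [mul_assoc]
    rw [h1, norm_mul, Complex.norm_real]
    refine pow_le_pow_left₀ (by positivity) (mul_le_of_le_one_left (norm_nonneg _) ?_) 2
    have h2 := hψ1 y
    rw [Real.norm_of_nonneg (mul_nonneg h2.1 h2.1)]
    exact mul_le_one₀ h2.2 h2.1 h2.2
  rw [MatrixSystem.IsApprox]
  simp only [hdef, ← incl_star, ← incl_mul]
  rw [← incl_sum, hsum, incl_smul, incl_mul, incl_star, norm_smul, Complex.norm_natCast,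
    CStarRing.norm_star_mul_self, sq]
  gcongr

end

/-! ### Matrix approximation for the Hutchinson trace -/

open MeasureTheory

variable [MeasurableSpace K] [BorelSpace K]

/-- By outer regularity the null set has a neighbourhood of measure below `ε`; `ψ` is 1 outside it,
so the integrand is at most its indicator function. -/
lemma exists_cutoff {μ : Measure K} [IsProbabilityMeasure μ] {s : Set K} (hs : IsClosed s)
    (hμs : μ s = 0) {ε : ℝ} (hε : 0 < ε) : ∃ ψ : C(K, ℝ), (∀ y ∈ s, ψ y = 0) ∧
      (∀ y, ψ y ∈ Set.Icc (0 : ℝ) 1) ∧ ∫ y, (ψ y * ψ y * (ψ y * ψ y) - 1) ^ 2 ∂μ ≤ ε := by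
  obtain ⟨U, hsU, hU, hμU⟩ := Set.exists_isOpen_lt_of_lt s (ENNReal.ofReal ε)
    (by rw [hμs]; exact ENNReal.ofReal_pos.2 hε)
  obtain ⟨ψ, h0, h1, hψ⟩ := exists_continuous_zero_one_of_isClosed hs hU.isClosed_compl
    (Set.disjoint_compl_right_iff_subset.2 hsU)
  refine ⟨ψ, fun y hy => h0 hy, hψ, ?_⟩
  have h2 : ∫ y, (ψ y * ψ y * (ψ y * ψ y) - 1) ^ 2 ∂μ ≤ ∫ y, U.indicator 1 y ∂μ := by
    refine integral_mono (integrable_of_continuous (by fun_prop))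
      ((integrable_const (1 : ℝ)).indicator hU.measurableSet) fun y => ?_
    by_cases hy : y ∈ U
    · rw [Set.indicator_of_mem hy, Pi.one_apply]
      have h3 := hψ y
      have h4 : ψ y * ψ y * (ψ y * ψ y) ≤ 1 := mul_le_one₀ (mul_le_one₀ h3.2 h3.1 h3.2)
        (mul_nonneg h3.1 h3.1) (mul_le_one₀ h3.2 h3.1 h3.2)
      have h5 : 0 ≤ ψ y * ψ y * (ψ y * ψ y) :=
        mul_nonneg (mul_nonneg h3.1 h3.1) (mul_nonneg h3.1 h3.1)
      simp only
      nlinarith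
    · rw [Set.indicator_of_notMem hy]
      have h3 : ψ y = 1 := h1 hy
      simp [h3]
  refine h2.trans ?_
  rw [integral_indicator_one hU.measurableSet, Measure.real]
  exact ENNReal.toReal_le_of_le_ofReal hε.le hμU.le

omit [BorelSpace K] in
-- The unit of the system has the scalar matrix `ψ⁴`, so the trace formula turns the squared norm
-- into an integral.
lemma norm_unit_vector_sub_sq {τ : γ.Core →ₚ[ℂ] ℂ} (hN : 2 ≤ N) {μ : Measure K}
    (h : ∀ n (T : γ.unionCore) a, γ.Represents n T a →
      τ (γ.incl T) = ((N : ℂ) ^ n)⁻¹ * ∫ x, a.trace x ∂μ) {ψ : C(K, ℝ)}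
    {E : (Fin n → Fin N) → (Fin n → Fin N) → γ.unionCore}
    (hE : ∀ w v, γ.HasMatrix n (E w v) (Matrix.single w v (ψ * ψ).ofRealC))
    (hψ1 : ∀ y, ψ y ∈ Set.Icc (0 : ℝ) 1) :
    ‖τ.gnsStarAlgHom (matrixSystem hE hN hψ1).unit τ.cyclicVector - τ.cyclicVector‖ ^ 2 =
      ∫ y, (ψ y * ψ y * (ψ y * ψ y) - 1) ^ 2 ∂μ := by
  have h1 := (hasMatrix_sum_single hE).sub (HasMatrix.one (γ := γ) (n := n))
  set V : γ.unionCore := ∑ w, E w w * E w w - 1 with hV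
  have h2 : τ.gnsStarAlgHom (matrixSystem hE hN hψ1).unit τ.cyclicVector - τ.cyclicVector =
      τ.gnsStarAlgHom (γ.incl V) τ.cyclicVector := by
    have h3 : γ.incl V = (matrixSystem hE hN hψ1).unit - 1 := by
      simp only [hV, incl_sub, incl_sum, incl_mul, incl_one, MatrixSystem.unit, matrixSystem]
    rw [h3, map_sub, map_one, sub_apply]
    rfl
  have h3 := norm_map_sq (π := τ.gnsStarAlgHom) (γ.incl V) τ.cyclicVector
  rw [τ.inner_cyclicVector_gns, ← incl_star, ← incl_mul,
    h n _ _ ((h1.conjTranspose hN).mul h1).2] at h3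
  rw [h2]
  have h4 : ∀ x, (Matrix.trace ((Matrix.diagonal (fun _ : Fin n → Fin N =>
      ((ψ * ψ) * (ψ * ψ)).ofRealC) - 1).conjTranspose * (Matrix.diagonal (fun _ : Fin n → Fin N =>
      ((ψ * ψ) * (ψ * ψ)).ofRealC) - 1)) : C(K, ℂ)) x =
      (((N : ℝ) ^ n * (ψ x * ψ x * (ψ x * ψ x) - 1) ^ 2 : ℝ) : ℂ) := fun x => by
    rw [← Matrix.diagonal_one, Matrix.diagonal_sub, Matrix.diagonal_conjTranspose,
      Matrix.diagonal_mul_diagonal, Matrix.trace_diagonal, ContinuousMap.sum_apply]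
    simp [sq]
  simp only [h4] at h3
  rw [integral_complex_ofReal, integral_const_mul] at h3
  push_cast at h3
  rw [inv_mul_cancel_left₀ (pow_ne_zero_complex hN n)] at h3
  exact_mod_cast h3

/-- At a high level the matrices of the finitely many given elements and of their adjoints are
nearly constant, and their values at one point `z` serve as `α`. Since `μ` does not charge the
collision set, the cutoff hardly moves `Ω`. -/
theorem IsContinuousTrace.hasMatrixApproximation [Nonempty K] {τ : γ.Core →ₚ[ℂ] ℂ} (hN : 2 ≤ N)
    (hτ : γ.IsContinuousTrace τ) :
    HasMatrixApproximation τ.gnsStarAlgHom τ.cyclicVector (Set.range γ.incl) := by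
  obtain ⟨μ, hμ, h⟩ := hτ.apply_incl hN
  have := hμ.1
  obtain ⟨z⟩ := ‹Nonempty K›
  intro F hF ε hε k
  have h1 : ∀ᶠ n in Filter.atTop, ∀ x ∈ F, ∃ (T : γ.unionCore) (b : _) (b' : _),
      γ.incl T = x ∧ γ.HasMatrix n T b ∧ γ.HasMatrix n (star T) b' ∧
      (∀ y z, IsSquareBound (fun w v => b w v y - b w v z) ε) ∧
      ∀ y z, IsSquareBound (fun w v => b' w v y - b' w v z) ε := by
    rw [Filter.eventually_all_finset]
    intro x hx
    obtain ⟨T, rfl⟩ := hF hx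
    obtain ⟨n₀, hn₀⟩ := exists_isSquareBound_sub hN T hε
    obtain ⟨n₁, hn₁⟩ := exists_isSquareBound_sub hN (star T) hε
    filter_upwards [Filter.eventually_ge_atTop n₀, Filter.eventually_ge_atTop n₁] with n h0 h1
    obtain ⟨hT, b, hb, hb'⟩ := hn₀ n h0
    obtain ⟨hS, c, hc, hc'⟩ := hn₁ n h1
    exact ⟨T, b, c, rfl, ⟨hT, hb⟩, ⟨hS, hc⟩, hb', hc'⟩
  obtain ⟨n, hn, hkn⟩ := (h1.and (Filter.eventually_ge_atTop k)).exists
  obtain ⟨ψ, hψ0, hψ1, hψ⟩ := exists_cutoff (finite_collisionSet (γ := γ) n).isClosed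
    (hμ.measure_collisionSet hN n) (pow_pos hε 2)
  obtain ⟨E, hE⟩ := exists_hasMatrix_single hψ0
  have hcard : Fintype.card (Fin n → Fin N) = N ^ n := by simp
  refine ⟨Fin n → Fin N, inferInstance, matrixSystem hE hN hψ1, ?_, ?_, ?_, fun x hx => ?_⟩
  · rw [hcard]
    exact hkn.trans (Nat.lt_pow_self (by omega)).le
  · rw [hcard]
    exact pow_pos (by omega) n
  · refine le_of_sq_le_sq ?_ hε.le
    rw [norm_unit_vector_sub_sq hN h hE hψ1]
    exact hψ
  · obtain ⟨T, b, b', rfl, hb, hb', hbd, hbd'⟩ := hn x hx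
    have h2 : b' = b.conjTranspose := (hb.conjTranspose hN).2.unique hN hb'.2 ▸ rfl
    refine ⟨fun w v => b w v z, isApprox_matrixSystem hE hN hψ1 hb hε.le fun y => hbd y z, ?_⟩
    rw [← incl_star]
    refine isApprox_matrixSystem hE hN hψ1 hb' hε.le fun y => ?_
    have h3 := hbd' y z
    have h4 : ∀ w v, b' w v z = Matrix.conjTranspose (fun w v => b w v z) w v := fun w v => by
      rw [h2]; rfl
    simpa only [h4] using h3

/-- The trace of the Hutchinson measure generates the injective factor of type II₁. -/
theorem IsContinuousTrace.isTypeII1Factor_and_isInjective [Nonempty K] {τ : γ.Core →ₚ[ℂ] ℂ}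
    (hN : 2 ≤ N) (hτ : γ.IsContinuousTrace τ) :
    (gnsVN τ).IsTypeII1Factor ∧ (gnsVN τ).IsInjective := by
  have hΩ := PositiveLinearMap.isTracialVector hτ.1.2
  have h := hτ.hasMatrixApproximation hN
  have h1 : ‖τ.cyclicVector‖ = 1 := by
    have h2 := norm_map_sq (π := τ.gnsStarAlgHom) 1 τ.cyclicVector
    rw [τ.inner_cyclicVector_gns, star_one, one_mul, hτ.1.1, map_one, one_apply_eq_self] at h2
    have h3 : ‖τ.cyclicVector‖ ^ 2 = 1 := by exact_mod_cast h2
    nlinarith [norm_nonneg τ.cyclicVector]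
  exact ⟨hΩ.isTypeII1Factor_generatedVN denseRange_incl h1 h,
    hΩ.isInjective_generatedVN denseRange_incl h⟩

end BranchedMap

/-! ### The main theorem -/

theorem mainTheorem2 {K : Type u} [MetricSpace K] [CompactSpace K] [Nonempty K]
    [MeasurableSpace K] [BorelSpace K] {N : ℕ} (hN : 2 ≤ N) (γ : BranchedMap K N) :
    -- the primitive ideal space
    ((fun P : Ideal γ.Core => (P : Set γ.Core)) '' primitiveIdeals γ.Core =
      insert {0} {J | ∃ b ∈ γ.branchSet, ∃ n, J = γ.coreIdeal b n}) ∧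
    -- its Jacobson topology
    (∀ U : Set (primitiveIdeals γ.Core), IsOpen[jacobsonTopology γ.Core] U ↔
      U = ∅ ∨ ((∃ P ∈ U, (P : Ideal γ.Core) = ⊥) ∧ Uᶜ.Finite)) ∧
    -- the zero ideal and the Hutchinson trace
    ((∃! τ, γ.IsContinuousTrace τ) ∧ ∀ τ, γ.IsContinuousTrace τ →
      traceKernel τ = {0} ∧ (gnsVN τ).IsTypeII1Factor ∧ (gnsVN τ).IsInjective) ∧
    -- the ideals of the branch points and the discrete traces
    ∀ b ∈ γ.branchSet, ∀ n, (∃! τ, γ.IsDiscreteTrace b n τ) ∧ ∀ τ, γ.IsDiscreteTrace b n τ →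
      traceKernel τ = γ.coreIdeal b n ∧
      (gnsVN τ).IsFactor ∧
      Nonempty ((gnsVN τ).toStarSubalgebra ≃⋆ₐ[ℂ]
        Matrix (Fin n → Fin N) (Fin n → Fin N) ℂ) ∧
      ∃ (J : Ideal γ.Core) (_ : J.IsTwoSided), (J : Set γ.Core) = γ.coreIdeal b n ∧
        ∃ e : (γ.Core ⧸ J) ≃ₐ[ℂ] Matrix (Fin n → Fin N) (Fin n → Fin N) ℂ,
          ∀ x, e (Ideal.Quotient.mk J (star x)) = star (e (Ideal.Quotient.mk J x)) := by
  exact ⟨BranchedMap.image_primitiveIdeals hN, BranchedMap.isOpen_primitiveIdeals_iff hN,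
    ⟨BranchedMap.existsUnique_isContinuousTrace hN, fun τ hτ =>
      ⟨hτ.traceKernel_eq hN, hτ.isTypeII1Factor_and_isInjective hN⟩⟩,
    fun b hb n => ⟨BranchedMap.existsUnique_isDiscreteTrace hN hb n, fun τ hτ =>
      BranchedMap.isDiscreteTrace_properties hN hb hτ⟩⟩
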